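/- **Soundness of NM-DEKL$^3_\infty$.** *Calculus.* Contexts $\Gamma=x_1:A_1,\dots,x_m:A_m$ consist of computational types. The **computational layer** has judgements $\Gamma\vdash t:A$ and $\Gamma\vdash t\equiv t':A$, where types are the terms of the universes, $\Gamma\vdash A:\mathsf{Uc}_i$, and $\mathsf{Uc}_i:\mathsf{Uc}_{i+1}$. It has $\Pi$-types ($\beta$, $\eta$), $\Sigma$-types ($\beta$, $\eta$), identity types with $\mathsf{refl}$ and $J$ (and the $J$-computation rule), each closed in every $\mathsf{Uc}_i$; base types $\mathsf{State},\mathsf{Event},\mathsf{Nat}:\mathsf{Uc}_0$; $\mathsf{Step}(s,e,s'):\mathsf{Uc}_0$; finite traces $\mathsf{FinTrace}:\mathsf{Uc}_0$ with $\mathsf{nil}(s)$ and $\mathsf{step}(\tau,e,s)$; infinite traces $\mathsf{InfTrace}:\mathsf{Uc}_0$ with $\mathsf{head}(\pi):\mathsf{State}$, $\mathsf{tail}(\pi):\mathsf{Event}\times\mathsf{InfTrace}$ and guarded corecursion $F=\mathsf{cofix}\,f.\,\lambda x{:}A.\,\langle s(x),(e(x),f(r(x)))\rangle$ with $\mathsf{head}(F\,a)\equiv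 s(a)$, $\mathsf{tail}(F\,a)\equiv(e(a),F\,(r(a)))$; extension types $\mathsf{Ext}_f(\tau,\tau'):\mathsf{Uc}_0$ with $\mathrm{id}_\tau$ and composition. Definitional equality is the congruence generated by the computation rules, and typing is closed under conversion. The **propositional layer** has the judgements $\Gamma\vdash P:\mathsf{Prop}$ and $\Gamma\vdash P\equiv Q:\mathsf{Prop}$ (possibly with $n$ additional propositional variables $X_0,\dots,X_{n-1}:\mathsf{Prop}$), with $\top,\bot,\wedge,\vee,\to$, $\forall_{x:A}$, $\exists_{x:A}$ for $A:\mathsf{Uc}_i$, and $\mu X.\varphi$, $\nu X.\varphi$ for $X$ occurring only positively in $\varphi$; $\equiv$ is the congruence induced by $\equiv$ of the computational layer. The **constructive layer** has the judgements $\Gamma\vdash B:\mathsf{Type}_{\ell,i}$, $\Gamma;\Theta\vdash u:B$ and the corresponding equalities, where $\Theta$ is a (possibly empty) list of declared constructive variables $k:B$. Its types are $\mathsf{Type}_{\ell,i}:\mathsf{Type}_{\ell,i+1}$, $\mathsf{Prop}:\mathsf{Type}_{\ell,0}$, $K_f(\tau):\mathsf{Type}_{\ell,0}$ for $\tau:\mathsf{FinTrace}$,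 $K_\infty(\pi):\mathsf{Type}_{\ell,0}$ for $\pi:\mathsf{InfTrace}$, and each proposition $P$, as the type of its proofs. Its terms are variables, types and propositions as elements of their universes, $\mathsf{restrict}(\varepsilon,k):K_f(\tau)$ for $\varepsilon:\mathsf{Ext}_f(\tau,\tau')$ and $k:K_f(\tau')$, the fixed-point proofs $\mathsf{fold},\mathsf{unfold}$ (for $\mu$) and $\mathsf{in},\mathsf{out}$ (for $\nu$), and application of a proof of $P\to Q$ to a proof of $P$. Definitional equality is the congruence (with conversion) generated by $\mathsf{restrict}(\mathrm{id}_\tau,k)\equiv k$, $\mathsf{restrict}(\varepsilon_1,\mathsf{restrict}(\varepsilon_2,k))\equiv\mathsf{restrict}(\varepsilon_2\circ\varepsilon_1,k)$, the mutual inverseness of $\mathsf{fold},\mathsf{unfold}$ and of $\mathsf{in},\mathsf{out}$, and proof irrelevance. *Models.* A model $\mathcal M$ consists of a category $\mathcal C$ with finite limits and limits of $\omega^{op}$-sequences, a small trajectory category $\mathcal T_f$, and (1) a category with families $(\mathcal C,\mathsf{Ty}_c,\mathsf{Tm}_c)$ with $\Pi$-, $\Sigma$- and intensional identity types, universes $U_0,U_1,\dots$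 ($U_i$ named in $U_{i+1}$, terms of $U_i$ determined by the types they name, each $U_i$ closed under these type formers), closed types for the base types, transitions, and finite traces with their constructors and their extensions (a category in each context, containing an extension from $\tau$ to $\mathsf{step}(\tau,e,s)$), all stable under substitution, and $\mathsf{InfTrace}$ a final coalgebra of $Z\mapsto\mathsf{State}\times(\mathsf{Event}\times Z)$; (2) an object $K\to\mathsf{FinTrace}$ of $\mathcal C$, with restriction of its elements along extensions of traces, natural in the context and functorial, so that the fibres of $K$ form a contravariant functor on the traces and extensions in each context, which for closed traces is induced, along a functor from closed traces and extensions to $\mathcal T_f$, by a presheaf $K_f:\mathcal T_f^{op}\to\mathcal C$; (3) a subobject classifier $\Omega$ of $\mathcal C$; stable Heyting operations on subobjects, quantifiers along comprehension projections with the Beck–Chevalley condition, and stable least and greatest fixed points of stable monotone operators on subobjects; (4) presheaves $U^\ell_i:\mathcal T_f^{op}\to\mathcal C$ with universal families and names, natural in the context, for the types of the constructive layer. For an object $X$ of $\mathcal C$ put $\mathsf{Ty}_\ell(X)=[\mathcal T_f^{op},\mathcal C/X]$, $\mathsf{Tm}_\ell(X,B)=\mathrm{Hom}(1,B)$ and $\mathsf{Prop}(X)=\mathsf{Sub}(1_X)\cong\mathsf{Sub}(X)$.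 *Interpretation.* $\llbracket-\rrbracket_{\mathcal M}$ is defined by recursion on raw (fully annotated) syntax as a partial function: the empty context is the terminal object, context extension is comprehension, each type or term former is the corresponding operation of $\mathcal M$; $\llbracket K_f(\tau)\rrbracket$ is the constant presheaf on the fibre of $K$ over $\llbracket\tau\rrbracket$, $\llbracket K_\infty(\pi)\rrbracket$ that on the limit of the fibres over the finite prefixes of $\llbracket\pi\rrbracket$, $\mathsf{restrict}$ is post-composition with the restriction map, $\llbracket\mathsf{Prop}\rrbracket$ is constant at $X^*\Omega$, a proposition as a type is constant at the corresponding subobject, $\llbracket\mathsf{Type}_{\ell,i}\rrbracket=X^*U^\ell_i$, and $\mu,\nu$ are least and greatest fixed points. *Theorem.* For every model $\mathcal M$: 0. if $\Gamma$ is a well-formed context, then $\llbracket\Gamma\rrbracket_{\mathcal M}$ is defined (and is an object of $\mathcal C$); 1. if $\Gamma\vdash A:\mathsf{Uc}_i$, then $\llbracket A\rrbracket_{\mathcal M}$ is defined and $\llbracket A\rrbracket_{\mathcal M}\in\mathsf{Ty}_c(\llbracket\Gamma\rrbracket_{\mathcal M})$; 2. if $\Gamma\vdash t:A$ in the computational layer,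 then $\llbracket t\rrbracket_{\mathcal M}$ and $\llbracket A\rrbracket_{\mathcal M}$ are defined and $\llbracket t\rrbracket_{\mathcal M}\in\mathsf{Tm}_c(\llbracket\Gamma\rrbracket_{\mathcal M},\llbracket A\rrbracket_{\mathcal M})$; 3. if $\Gamma\vdash B:\mathsf{Type}_{\ell,i}$, then $\llbracket B\rrbracket_{\mathcal M}$ is defined and $\llbracket B\rrbracket_{\mathcal M}\in\mathsf{Ty}_\ell(\llbracket\Gamma\rrbracket_{\mathcal M})$; 4. if $\Gamma;\Theta\vdash u:B$ in the constructive layer, then $\llbracket u\rrbracket_{\mathcal M}$ and $\llbracket B\rrbracket_{\mathcal M}$ are defined and $\llbracket u\rrbracket_{\mathcal M}\in\mathsf{Tm}_\ell(\llbracket\Gamma\rrbracket_{\mathcal M},\llbracket B\rrbracket_{\mathcal M})$; 5. if $\Gamma\vdash P:\mathsf{Prop}$, then $\llbracket P\rrbracket_{\mathcal M}$ is defined and $\llbracket P\rrbracket_{\mathcal M}\in\mathsf{Prop}(\llbracket\Gamma\rrbracket_{\mathcal M})$; 6. definitionally equal expressions have equal interpretations: if $\Gamma\vdash t\equiv t':A$,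 or $\Gamma\vdash B\equiv B':\mathsf{Type}_{\ell,i}$, or $\Gamma;\Theta\vdash u\equiv u':B$, or $\Gamma\vdash P\equiv Q:\mathsf{Prop}$ is derivable, then both sides are defined and $\llbracket t\rrbracket_{\mathcal M}=\llbracket t'\rrbracket_{\mathcal M}$, $\llbracket B\rrbracket_{\mathcal M}=\llbracket B'\rrbracket_{\mathcal M}$, $\llbracket u\rrbracket_{\mathcal M}=\llbracket u'\rrbracket_{\mathcal M}$, $\llbracket P\rrbracket_{\mathcal M}=\llbracket Q\rrbracket_{\mathcal M}$, respectively, in the set of the matching clause 2–5. In 3–6, if propositional variables or constructive variables are present, the claims hold for every choice of values of the propositional variables in $\mathsf{Prop}(\llbracket\Gamma\rrbracket_{\mathcal M})$ and of values of the declared constructive variables in $\mathsf{Tm}_\ell$ of their interpreted types. -/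

import Mathlib

open CategoryTheory CategoryTheory.Limits Opposite

universe u v w z

namespace NMDEKL

noncomputable section

/-! ## Raw syntax of the computational layer

De Bruijn indices; all binders are annotated with their types, and so are eliminators. -/

/-- Raw expressions of the computational layer (types are terms of a universe, à la Russell). -/
inductive Term : Type
  | var (n : ℕ)
  /-- the universe `Uc_i` -/
  | univ (i : ℕ)
  /-- `Π x:A. B`; `B` binds one variable -/
  | pi (A B : Term)
  /-- `λ x:A. t` of type `Π x:A. B`; `B`, `t` bind one variable -/
  | lam (A B t : Term)
  /-- application of `f : Π x:A. B` to `a` -/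
  | app (A B f a : Term)
  /-- `Σ x:A. B`; `B` binds one variable -/
  | sig (A B : Term)
  | pair (A B a b : Term)
  | fst (A B t : Term)
  | snd (A B t : Term)
  /-- `Id_A(a,b)` -/
  | idt (A a b : Term)
  | refl (A a : Term)
  /-- `J_{A,C}(d,a,b,p)`; `C` binds `x y : A` and `p : Id_A(x,y)`, `d` binds `x : A` -/
  | idrec (A C d a b p : Term)
  | state
  | event
  | nat
  /-- the type `Step(s,e,s')` of transitions -/
  | stepT (s e s' : Term)
  | finTrace
  | nil (s : Term)
  /-- the trace constructor `step(τ,e,s)` -/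
  | step (τ e s : Term)
  | infTrace
  | head (π : Term)
  | tail (π : Term)
  /-- guarded corecursion: the value at `a : A` of
  `cofix f. λ x:A. ⟨s(x), (e(x), f (r(x)))⟩`; `s`, `e`, `r` bind `x` -/
  | cofix (A s e r a : Term)
  /-- `Ext_f(τ,τ')` -/
  | ext (τ τ' : Term)
  /-- `id_τ : Ext_f(τ,τ)` -/
  | extId (τ : Term)
  /-- `ε₂ ∘ ε₁ : Ext_f(τ,τ'')` for `ε₁ : Ext_f(τ,τ')`, `ε₂ : Ext_f(τ',τ'')` -/
  | extComp (τ τ' τ'' ε₁ ε₂ : Term)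

namespace Term

/-- Lifting a renaming under one binder. -/
def upR (ξ : ℕ → ℕ) : ℕ → ℕ
  | 0 => 0
  | n + 1 => ξ n + 1

/-- Renaming of variables. -/
def ren : (ℕ → ℕ) → Term → Term
  | ξ, var n => var (ξ n)
  | _, univ i => univ i
  | ξ, pi A B => pi (ren ξ A) (ren (upR ξ) B)
  | ξ, lam A B t => lam (ren ξ A) (ren (upR ξ) B) (ren (upR ξ) t)
  | ξ, app A B f a => app (ren ξ A) (ren (upR ξ) B) (ren ξ f) (ren ξ a)
  | ξ, sig A B => sig (ren ξ A) (ren (upR ξ) B)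
  | ξ, pair A B a b => pair (ren ξ A) (ren (upR ξ) B) (ren ξ a) (ren ξ b)
  | ξ, fst A B t => fst (ren ξ A) (ren (upR ξ) B) (ren ξ t)
  | ξ, snd A B t => snd (ren ξ A) (ren (upR ξ) B) (ren ξ t)
  | ξ, idt A a b => idt (ren ξ A) (ren ξ a) (ren ξ b)
  | ξ, refl A a => refl (ren ξ A) (ren ξ a)
  | ξ, idrec A C d a b p =>
      idrec (ren ξ A) (ren (upR (upR (upR ξ))) C) (ren (upR ξ) d) (ren ξ a) (ren ξ b) (ren ξ p)
  | _, state => state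
  | _, event => event
  | _, nat => nat
  | ξ, stepT s e s' => stepT (ren ξ s) (ren ξ e) (ren ξ s')
  | _, finTrace => finTrace
  | ξ, nil s => nil (ren ξ s)
  | ξ, step τ e s => step (ren ξ τ) (ren ξ e) (ren ξ s)
  | _, infTrace => infTrace
  | ξ, head π => head (ren ξ π)
  | ξ, tail π => tail (ren ξ π)
  | ξ, cofix A s e r a =>
      cofix (ren ξ A) (ren (upR ξ) s) (ren (upR ξ) e) (ren (upR ξ) r) (ren ξ a)
  | ξ, ext τ τ' => ext (ren ξ τ) (ren ξ τ')
  | ξ, extId τ => extId (ren ξ τ)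
  | ξ, extComp τ τ' τ'' ε₁ ε₂ =>
      extComp (ren ξ τ) (ren ξ τ') (ren ξ τ'') (ren ξ ε₁) (ren ξ ε₂)

/-- Weakening by one variable. -/
def wk (t : Term) : Term := ren Nat.succ t

/-- Lifting a substitution under one binder. -/
def upS (σ : ℕ → Term) : ℕ → Term
  | 0 => var 0
  | n + 1 => wk (σ n)

/-- Simultaneous substitution. -/
def sub : (ℕ → Term) → Term → Term
  | σ, var n => σ n
  | _, univ i => univ i
  | σ, pi A B => pi (sub σ A) (sub (upS σ) B)
  | σ, lam A B t => lam (sub σ A) (sub (upS σ) B) (sub (upS σ) t)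
  | σ, app A B f a => app (sub σ A) (sub (upS σ) B) (sub σ f) (sub σ a)
  | σ, sig A B => sig (sub σ A) (sub (upS σ) B)
  | σ, pair A B a b => pair (sub σ A) (sub (upS σ) B) (sub σ a) (sub σ b)
  | σ, fst A B t => fst (sub σ A) (sub (upS σ) B) (sub σ t)
  | σ, snd A B t => snd (sub σ A) (sub (upS σ) B) (sub σ t)
  | σ, idt A a b => idt (sub σ A) (sub σ a) (sub σ b)
  | σ, refl A a => refl (sub σ A) (sub σ a)
  | σ, idrec A C d a b p =>
      idrec (sub σ A) (sub (upS (upS (upS σ))) C) (sub (upS σ) d) (sub σ a) (sub σ b) (sub σ p)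
  | _, state => state
  | _, event => event
  | _, nat => nat
  | σ, stepT s e s' => stepT (sub σ s) (sub σ e) (sub σ s')
  | _, finTrace => finTrace
  | σ, nil s => nil (sub σ s)
  | σ, step τ e s => step (sub σ τ) (sub σ e) (sub σ s)
  | _, infTrace => infTrace
  | σ, head π => head (sub σ π)
  | σ, tail π => tail (sub σ π)
  | σ, cofix A s e r a =>
      cofix (sub σ A) (sub (upS σ) s) (sub (upS σ) e) (sub (upS σ) r) (sub σ a)
  | σ, ext τ τ' => ext (sub σ τ) (sub σ τ')
  | σ, extId τ => extId (sub σ τ)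
  | σ, extComp τ τ' τ'' ε₁ ε₂ =>
      extComp (sub σ τ) (sub σ τ') (sub σ τ'') (sub σ ε₁) (sub σ ε₂)

/-- Extending a substitution by a term for the variable `0`. -/
def scons (a : Term) (σ : ℕ → Term) : ℕ → Term
  | 0 => a
  | n + 1 => σ n

/-- `t[a/x]` for the last variable `x`. -/
def inst (t a : Term) : Term := sub (scons a var) t

/-- `C[a/x, b/y, p/z]` for the last three variables `x, y, z`. -/
def inst₃ (C a b p : Term) : Term := sub (scons p (scons b (scons a var))) C

/-- The reflexive instance `C(x, x, refl_x)`, in the context extended by `x : A`. -/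
def motiveRefl (A C : Term) : Term :=
  sub (scons (refl (wk A) (var 0)) (scons (var 0) (scons (var 0) fun n => var (n + 1)))) C

/-- The type `Event × InfTrace`. -/
def eventInf : Term := sig event infTrace

end Term

/-! ## Judgements of the computational layer -/

open Term

mutual

/-- `⊢ Γ ctx`; the head of the list is the most recent variable. -/
inductive WfCtx : List Term → Prop
  | nil : WfCtx []
  | cons {Γ A i} : WfCtx Γ → HasTy Γ A (univ i) → WfCtx (A :: Γ)

/-- `Γ ⊢ t : A` in the computational layer; `Γ ⊢ A : Uc_i` is `HasTy Γ A (univ i)`. -/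
inductive HasTy : List Term → Term → Term → Prop
  | var {Γ n A} : WfCtx Γ → Γ[n]? = some A → HasTy Γ (var n) (ren (fun k => k + (n + 1)) A)
  | conv {Γ t A B i} : HasTy Γ t A → DefEq Γ A B (univ i) → HasTy Γ t B
  | univ {Γ i} : WfCtx Γ → HasTy Γ (univ i) (univ (i + 1))
  | pi {Γ A B i} : HasTy Γ A (univ i) → HasTy (A :: Γ) B (univ i) → HasTy Γ (pi A B) (univ i)
  | lam {Γ A B t i} : HasTy Γ A (univ i) → HasTy (A :: Γ) B (univ i) → HasTy (A :: Γ) t B →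
      HasTy Γ (lam A B t) (pi A B)
  | app {Γ A B f a i} : HasTy Γ A (univ i) → HasTy (A :: Γ) B (univ i) →
      HasTy Γ f (pi A B) → HasTy Γ a A → HasTy Γ (app A B f a) (inst B a)
  | sig {Γ A B i} : HasTy Γ A (univ i) → HasTy (A :: Γ) B (univ i) → HasTy Γ (sig A B) (univ i)
  | pair {Γ A B a b i} : HasTy Γ A (univ i) → HasTy (A :: Γ) B (univ i) →
      HasTy Γ a A → HasTy Γ b (inst B a) → HasTy Γ (pair A B a b) (sig A B)
  | fst {Γ A B t i} : HasTy Γ A (univ i) → HasTy (A :: Γ) B (univ i) →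
      HasTy Γ t (sig A B) → HasTy Γ (fst A B t) A
  | snd {Γ A B t i} : HasTy Γ A (univ i) → HasTy (A :: Γ) B (univ i) →
      HasTy Γ t (sig A B) → HasTy Γ (snd A B t) (inst B (fst A B t))
  | idt {Γ A a b i} : HasTy Γ A (univ i) → HasTy Γ a A → HasTy Γ b A →
      HasTy Γ (idt A a b) (univ i)
  | refl {Γ A a i} : HasTy Γ A (univ i) → HasTy Γ a A → HasTy Γ (refl A a) (idt A a a)
  | idrec {Γ A C d a b p i j} : HasTy Γ A (univ i) →
      HasTy (idt (wk (wk A)) (var 1) (var 0) :: wk A :: A :: Γ) C (univ j) →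
      HasTy (A :: Γ) d (motiveRefl A C) →
      HasTy Γ a A → HasTy Γ b A → HasTy Γ p (idt A a b) →
      HasTy Γ (idrec A C d a b p) (inst₃ C a b p)
  | state {Γ} : WfCtx Γ → HasTy Γ state (univ 0)
  | event {Γ} : WfCtx Γ → HasTy Γ event (univ 0)
  | nat {Γ} : WfCtx Γ → HasTy Γ nat (univ 0)
  | stepT {Γ s e s'} : HasTy Γ s state → HasTy Γ e event → HasTy Γ s' state →
      HasTy Γ (stepT s e s') (univ 0)
  | finTrace {Γ} : WfCtx Γ → HasTy Γ finTrace (univ 0)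
  | nil {Γ s} : HasTy Γ s state → HasTy Γ (nil s) finTrace
  | step {Γ τ e s} : HasTy Γ τ finTrace → HasTy Γ e event → HasTy Γ s state →
      HasTy Γ (step τ e s) finTrace
  | infTrace {Γ} : WfCtx Γ → HasTy Γ infTrace (univ 0)
  | head {Γ π} : HasTy Γ π infTrace → HasTy Γ (head π) state
  | tail {Γ π} : HasTy Γ π infTrace → HasTy Γ (tail π) eventInf
  | cofix {Γ A s e r a i} : HasTy Γ A (univ i) → HasTy (A :: Γ) s state →
      HasTy (A :: Γ) e event → HasTy (A :: Γ) r (wk A) → HasTy Γ a A →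
      HasTy Γ (cofix A s e r a) infTrace
  | ext {Γ τ τ'} : HasTy Γ τ finTrace → HasTy Γ τ' finTrace → HasTy Γ (ext τ τ') (univ 0)
  | extId {Γ τ} : HasTy Γ τ finTrace → HasTy Γ (extId τ) (ext τ τ)
  | extComp {Γ τ τ' τ'' ε₁ ε₂} : HasTy Γ τ finTrace → HasTy Γ τ' finTrace →
      HasTy Γ τ'' finTrace → HasTy Γ ε₁ (ext τ τ') → HasTy Γ ε₂ (ext τ' τ'') →
      HasTy Γ (extComp τ τ' τ'' ε₁ ε₂) (ext τ τ'')

/-- `Γ ⊢ t ≡ t' : A` in the computational layer. -/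
inductive DefEq : List Term → Term → Term → Term → Prop
  | rfl {Γ t A} : HasTy Γ t A → DefEq Γ t t A
  | symm {Γ t t' A} : DefEq Γ t t' A → DefEq Γ t' t A
  | trans {Γ t t' t'' A} : DefEq Γ t t' A → DefEq Γ t' t'' A → DefEq Γ t t'' A
  | conv {Γ t t' A B i} : DefEq Γ t t' A → DefEq Γ A B (univ i) → DefEq Γ t t' B
  -- computation rules
  | piBeta {Γ A B t a i} : HasTy Γ A (univ i) → HasTy (A :: Γ) B (univ i) →
      HasTy (A :: Γ) t B → HasTy Γ a A →
      DefEq Γ (app A B (lam A B t) a) (inst t a) (inst B a)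
  | piEta {Γ A B f i} : HasTy Γ A (univ i) → HasTy (A :: Γ) B (univ i) → HasTy Γ f (pi A B) →
      DefEq Γ (lam A B (app (wk A) (ren (upR Nat.succ) B) (wk f) (var 0))) f (pi A B)
  | fstBeta {Γ A B a b i} : HasTy Γ A (univ i) → HasTy (A :: Γ) B (univ i) →
      HasTy Γ a A → HasTy Γ b (inst B a) → DefEq Γ (fst A B (pair A B a b)) a A
  | sndBeta {Γ A B a b i} : HasTy Γ A (univ i) → HasTy (A :: Γ) B (univ i) →
      HasTy Γ a A → HasTy Γ b (inst B a) → DefEq Γ (snd A B (pair A B a b)) b (inst B a)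
  | sigEta {Γ A B t i} : HasTy Γ A (univ i) → HasTy (A :: Γ) B (univ i) →
      HasTy Γ t (sig A B) → DefEq Γ (pair A B (fst A B t) (snd A B t)) t (sig A B)
  | idBeta {Γ A C d a i j} : HasTy Γ A (univ i) →
      HasTy (idt (wk (wk A)) (var 1) (var 0) :: wk A :: A :: Γ) C (univ j) →
      HasTy (A :: Γ) d (motiveRefl A C) → HasTy Γ a A →
      DefEq Γ (idrec A C d a a (refl A a)) (inst d a) (inst₃ C a a (refl A a))
  | headCofix {Γ A s e r a i} : HasTy Γ A (univ i) → HasTy (A :: Γ) s state →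
      HasTy (A :: Γ) e event → HasTy (A :: Γ) r (wk A) → HasTy Γ a A →
      DefEq Γ (head (cofix A s e r a)) (inst s a) state
  | tailCofix {Γ A s e r a i} : HasTy Γ A (univ i) → HasTy (A :: Γ) s state →
      HasTy (A :: Γ) e event → HasTy (A :: Γ) r (wk A) → HasTy Γ a A →
      DefEq Γ (tail (cofix A s e r a))
        (pair event infTrace (inst e a) (cofix A s e r (inst r a))) eventInf
  -- closure under the term formers
  | pi {Γ A A' B B' i} : DefEq Γ A A' (univ i) → DefEq (A :: Γ) B B' (univ i) →
      DefEq Γ (pi A B) (pi A' B') (univ i)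
  | lam {Γ A A' B B' t t' i} : DefEq Γ A A' (univ i) → DefEq (A :: Γ) B B' (univ i) →
      DefEq (A :: Γ) t t' B → DefEq Γ (lam A B t) (lam A' B' t') (pi A B)
  | app {Γ A A' B B' f f' a a' i} : DefEq Γ A A' (univ i) → DefEq (A :: Γ) B B' (univ i) →
      DefEq Γ f f' (pi A B) → DefEq Γ a a' A →
      DefEq Γ (app A B f a) (app A' B' f' a') (inst B a)
  | sig {Γ A A' B B' i} : DefEq Γ A A' (univ i) → DefEq (A :: Γ) B B' (univ i) →
      DefEq Γ (sig A B) (sig A' B') (univ i)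
  | pair {Γ A A' B B' a a' b b' i} : DefEq Γ A A' (univ i) → DefEq (A :: Γ) B B' (univ i) →
      DefEq Γ a a' A → DefEq Γ b b' (inst B a) →
      DefEq Γ (pair A B a b) (pair A' B' a' b') (sig A B)
  | fst {Γ A A' B B' t t' i} : DefEq Γ A A' (univ i) → DefEq (A :: Γ) B B' (univ i) →
      DefEq Γ t t' (sig A B) → DefEq Γ (fst A B t) (fst A' B' t') A
  | snd {Γ A A' B B' t t' i} : DefEq Γ A A' (univ i) → DefEq (A :: Γ) B B' (univ i) →
      DefEq Γ t t' (sig A B) → DefEq Γ (snd A B t) (snd A' B' t') (inst B (fst A B t))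
  | idt {Γ A A' a a' b b' i} : DefEq Γ A A' (univ i) → DefEq Γ a a' A → DefEq Γ b b' A →
      DefEq Γ (idt A a b) (idt A' a' b') (univ i)
  | refl {Γ A A' a a' i} : DefEq Γ A A' (univ i) → DefEq Γ a a' A →
      DefEq Γ (refl A a) (refl A' a') (idt A a a)
  | idrec {Γ A A' C C' d d' a a' b b' p p' i j} : DefEq Γ A A' (univ i) →
      DefEq (idt (wk (wk A)) (var 1) (var 0) :: wk A :: A :: Γ) C C' (univ j) →
      DefEq (A :: Γ) d d' (motiveRefl A C) →
      DefEq Γ a a' A → DefEq Γ b b' A → DefEq Γ p p' (idt A a b) →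
      DefEq Γ (idrec A C d a b p) (idrec A' C' d' a' b' p') (inst₃ C a b p)
  | stepT {Γ s s' e e' t t'} : DefEq Γ s s' state → DefEq Γ e e' event → DefEq Γ t t' state →
      DefEq Γ (stepT s e t) (stepT s' e' t') (univ 0)
  | nil {Γ s s'} : DefEq Γ s s' state → DefEq Γ (nil s) (nil s') finTrace
  | step {Γ τ τ' e e' s s'} : DefEq Γ τ τ' finTrace → DefEq Γ e e' event → DefEq Γ s s' state →
      DefEq Γ (step τ e s) (step τ' e' s') finTrace
  | head {Γ π π'} : DefEq Γ π π' infTrace → DefEq Γ (head π) (head π') state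
  | tail {Γ π π'} : DefEq Γ π π' infTrace → DefEq Γ (tail π) (tail π') eventInf
  | cofix {Γ A A' s s' e e' r r' a a' i} : DefEq Γ A A' (univ i) → DefEq (A :: Γ) s s' state →
      DefEq (A :: Γ) e e' event → DefEq (A :: Γ) r r' (wk A) → DefEq Γ a a' A →
      DefEq Γ (cofix A s e r a) (cofix A' s' e' r' a') infTrace
  | ext {Γ τ₁ τ₁' τ₂ τ₂'} : DefEq Γ τ₁ τ₁' finTrace → DefEq Γ τ₂ τ₂' finTrace →
      DefEq Γ (ext τ₁ τ₂) (ext τ₁' τ₂') (univ 0)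
  | extId {Γ τ τ'} : DefEq Γ τ τ' finTrace → DefEq Γ (extId τ) (extId τ') (ext τ τ)
  | extComp {Γ τ₁ τ₁' τ₂ τ₂' τ₃ τ₃' ε₁ ε₁' ε₂ ε₂'} : DefEq Γ τ₁ τ₁' finTrace →
      DefEq Γ τ₂ τ₂' finTrace → DefEq Γ τ₃ τ₃' finTrace →
      DefEq Γ ε₁ ε₁' (ext τ₁ τ₂) → DefEq Γ ε₂ ε₂' (ext τ₂ τ₃) →
      DefEq Γ (extComp τ₁ τ₂ τ₃ ε₁ ε₂) (extComp τ₁' τ₂' τ₃' ε₁' ε₂') (ext τ₁ τ₃)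

end

/-! ## The propositional layer -/

/-- Raw propositions. `pvar k` is a propositional variable `X : Prop` (a separate family of
de Bruijn indices, bound by `mu` and `nu`); `all A P` and `ex A P` bind a variable of the
computational type `A`. -/
inductive Prp : Type
  | pvar (k : ℕ)
  | top
  | bot
  | and (P Q : Prp)
  | or (P Q : Prp)
  | imp (P Q : Prp)
  | all (A : Term) (P : Prp)
  | ex (A : Term) (P : Prp)
  | mu (P : Prp)
  | nu (P : Prp)

namespace Prp

/-- Renaming of computational variables. -/
def tren : (ℕ → ℕ) → Prp → Prp
  | _, pvar k => pvar k
  | _, top => top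
  | _, bot => bot
  | ξ, and P Q => and (tren ξ P) (tren ξ Q)
  | ξ, or P Q => or (tren ξ P) (tren ξ Q)
  | ξ, imp P Q => imp (tren ξ P) (tren ξ Q)
  | ξ, all A P => all (Term.ren ξ A) (tren (Term.upR ξ) P)
  | ξ, ex A P => ex (Term.ren ξ A) (tren (Term.upR ξ) P)
  | ξ, mu P => mu (tren ξ P)
  | ξ, nu P => nu (tren ξ P)

/-- Renaming of propositional variables. -/
def pren : (ℕ → ℕ) → Prp → Prp
  | ξ, pvar k => pvar (ξ k)
  | _, top => top
  | _, bot => bot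
  | ξ, and P Q => and (pren ξ P) (pren ξ Q)
  | ξ, or P Q => or (pren ξ P) (pren ξ Q)
  | ξ, imp P Q => imp (pren ξ P) (pren ξ Q)
  | ξ, all A P => all A (pren ξ P)
  | ξ, ex A P => ex A (pren ξ P)
  | ξ, mu P => mu (pren (Term.upR ξ) P)
  | ξ, nu P => nu (pren (Term.upR ξ) P)

/-- Lifting a substitution for propositional variables under `mu` and `nu`. -/
def upP (σ : ℕ → Prp) : ℕ → Prp
  | 0 => pvar 0
  | k + 1 => pren Nat.succ (σ k)

/-- Substitution for propositional variables. -/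
def psub : (ℕ → Prp) → Prp → Prp
  | σ, pvar k => σ k
  | _, top => top
  | _, bot => bot
  | σ, and P Q => and (psub σ P) (psub σ Q)
  | σ, or P Q => or (psub σ P) (psub σ Q)
  | σ, imp P Q => imp (psub σ P) (psub σ Q)
  | σ, all A P => all A (psub (fun k => tren Nat.succ (σ k)) P)
  | σ, ex A P => ex A (psub (fun k => tren Nat.succ (σ k)) P)
  | σ, mu P => mu (psub (upP σ) P)
  | σ, nu P => nu (psub (upP σ) P)

/-- `φ(Q)`: substitution of `Q` for the last propositional variable. -/
def pinst (P Q : Prp) : Prp :=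
  psub (fun k => match k with | 0 => Q | k + 1 => pvar k) P

/-- `Occ true k P`: the variable `k` occurs only positively in `P`
(`Occ false k P`: only negatively). -/
def Occ : Bool → ℕ → Prp → Prop
  | b, k, pvar j => j = k → b = true
  | _, _, top => True
  | _, _, bot => True
  | b, k, and P Q => Occ b k P ∧ Occ b k Q
  | b, k, or P Q => Occ b k P ∧ Occ b k Q
  | b, k, imp P Q => Occ (!b) k P ∧ Occ b k Q
  | b, k, all _ P => Occ b k P
  | b, k, ex _ P => Occ b k P
  | b, k, mu P => Occ b (k + 1) P
  | b, k, nu P => Occ b (k + 1) P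

end Prp

/-- `Γ, X₀ : Prop, …, X_{n-1} : Prop ⊢ P : Prop`. -/
inductive IsProp : List Term → ℕ → Prp → Prop
  | pvar {Γ n k} : WfCtx Γ → k < n → IsProp Γ n (.pvar k)
  | top {Γ n} : WfCtx Γ → IsProp Γ n .top
  | bot {Γ n} : WfCtx Γ → IsProp Γ n .bot
  | and {Γ n P Q} : IsProp Γ n P → IsProp Γ n Q → IsProp Γ n (.and P Q)
  | or {Γ n P Q} : IsProp Γ n P → IsProp Γ n Q → IsProp Γ n (.or P Q)
  | imp {Γ n P Q} : IsProp Γ n P → IsProp Γ n Q → IsProp Γ n (.imp P Q)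
  | all {Γ n A P i} : HasTy Γ A (univ i) → IsProp (A :: Γ) n P → IsProp Γ n (.all A P)
  | ex {Γ n A P i} : HasTy Γ A (univ i) → IsProp (A :: Γ) n P → IsProp Γ n (.ex A P)
  | mu {Γ n P} : IsProp Γ (n + 1) P → P.Occ true 0 → IsProp Γ n (.mu P)
  | nu {Γ n P} : IsProp Γ (n + 1) P → P.Occ true 0 → IsProp Γ n (.nu P)

/-- `Γ, X₀ : Prop, …, X_{n-1} : Prop ⊢ P ≡ Q : Prop`. -/
inductive PropEq : List Term → ℕ → Prp → Prp → Prop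
  | rfl {Γ n P} : IsProp Γ n P → PropEq Γ n P P
  | symm {Γ n P Q} : PropEq Γ n P Q → PropEq Γ n Q P
  | trans {Γ n P Q R} : PropEq Γ n P Q → PropEq Γ n Q R → PropEq Γ n P R
  | and {Γ n P P' Q Q'} : PropEq Γ n P P' → PropEq Γ n Q Q' → PropEq Γ n (.and P Q) (.and P' Q')
  | or {Γ n P P' Q Q'} : PropEq Γ n P P' → PropEq Γ n Q Q' → PropEq Γ n (.or P Q) (.or P' Q')
  | imp {Γ n P P' Q Q'} : PropEq Γ n P P' → PropEq Γ n Q Q' → PropEq Γ n (.imp P Q) (.imp P' Q')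
  | all {Γ n A A' P P' i} : DefEq Γ A A' (univ i) → PropEq (A :: Γ) n P P' →
      PropEq Γ n (.all A P) (.all A' P')
  | ex {Γ n A A' P P' i} : DefEq Γ A A' (univ i) → PropEq (A :: Γ) n P P' →
      PropEq Γ n (.ex A P) (.ex A' P')
  | mu {Γ n P P'} : PropEq Γ (n + 1) P P' → P.Occ true 0 → P'.Occ true 0 →
      PropEq Γ n (.mu P) (.mu P')
  | nu {Γ n P P'} : PropEq Γ (n + 1) P P' → P.Occ true 0 → P'.Occ true 0 →
      PropEq Γ n (.nu P) (.nu P')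

/-! ## The constructive layer -/

/-- Raw types of the constructive layer: `Type_ℓ,i`, `Prop`, `K_f(τ)`, `K_∞(π)`, and a
proposition regarded as the type of its proofs. -/
inductive LTy : Type
  | univ (i : ℕ)
  | prop
  | kf (τ : Term)
  | kinf (π : Term)
  | prf (P : Prp)

/-- The level `i` with `B : Type_ℓ,i`. -/
def LTy.level : LTy → ℕ
  | .univ i => i + 1
  | _ => 0

/-- Raw terms of the constructive layer. Variables refer to a list of declared constructive
variables. `ty B` is the type `B` as an element of its universe, `prp P` the proposition `P` as an
element of `Prop`. -/
inductive LTm : Type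
  | var (k : ℕ)
  | ty (B : LTy)
  | prp (P : Prp)
  /-- `restrict(ε,k) : K_f(τ)` for `ε : Ext_f(τ,τ')` and `k : K_f(τ')` -/
  | restrict (τ τ' ε : Term) (k : LTm)
  /-- `fold : φ(μX.φ) → μX.φ` -/
  | fold (φ : Prp)
  /-- `unfold : μX.φ → φ(μX.φ)` -/
  | unfold (φ : Prp)
  /-- `in : ψ(νX.ψ) → νX.ψ` -/
  | nuIn (ψ : Prp)
  /-- `out : νX.ψ → ψ(νX.ψ)` -/
  | nuOut (ψ : Prp)
  /-- application of a proof of `P → Q` to a proof of `P` -/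
  | mp (P Q : Prp) (f p : LTm)

/-- `Γ ⊢ B : Type_ℓ,i` (with `n` propositional variables). -/
inductive IsLTy : List Term → ℕ → LTy → ℕ → Prop
  | univ {Γ n i} : WfCtx Γ → IsLTy Γ n (.univ i) (i + 1)
  | prop {Γ n} : WfCtx Γ → IsLTy Γ n .prop 0
  | kf {Γ n τ} : HasTy Γ τ finTrace → IsLTy Γ n (.kf τ) 0
  | kinf {Γ n π} : HasTy Γ π infTrace → IsLTy Γ n (.kinf π) 0
  | prf {Γ n P} : IsProp Γ n P → IsLTy Γ n (.prf P) 0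

/-- `Γ ⊢ B ≡ B' : Type_ℓ,i`. -/
inductive LTyEq : List Term → ℕ → LTy → LTy → ℕ → Prop
  | rfl {Γ n B i} : IsLTy Γ n B i → LTyEq Γ n B B i
  | symm {Γ n B B' i} : LTyEq Γ n B B' i → LTyEq Γ n B' B i
  | trans {Γ n B B' B'' i} : LTyEq Γ n B B' i → LTyEq Γ n B' B'' i → LTyEq Γ n B B'' i
  | kf {Γ n τ τ'} : DefEq Γ τ τ' finTrace → LTyEq Γ n (.kf τ) (.kf τ') 0
  | kinf {Γ n π π'} : DefEq Γ π π' infTrace → LTyEq Γ n (.kinf π) (.kinf π') 0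
  | prf {Γ n P Q} : PropEq Γ n P Q → LTyEq Γ n (.prf P) (.prf Q) 0

/-- A list of declarations of constructive variables `k : B` over `Γ`. -/
def WfDecl (Γ : List Term) (n : ℕ) (Θ : List LTy) : Prop :=
  WfCtx Γ ∧ ∀ B ∈ Θ, ∃ i, IsLTy Γ n B i

/-- `Γ; Θ ⊢ u : B` in the constructive layer. -/
inductive HasLTy : List Term → ℕ → List LTy → LTm → LTy → Prop
  | var {Γ n Θ k B} : WfDecl Γ n Θ → Θ[k]? = some B → HasLTy Γ n Θ (.var k) B
  | conv {Γ n Θ u B B' i} : HasLTy Γ n Θ u B → LTyEq Γ n B B' i → HasLTy Γ n Θ u B'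
  | ty {Γ n Θ B i} : WfDecl Γ n Θ → IsLTy Γ n B i → HasLTy Γ n Θ (.ty B) (.univ i)
  | prp {Γ n Θ P} : WfDecl Γ n Θ → IsProp Γ n P → HasLTy Γ n Θ (.prp P) .prop
  | restrict {Γ n Θ τ τ' ε k} : HasTy Γ τ finTrace → HasTy Γ τ' finTrace →
      HasTy Γ ε (ext τ τ') → HasLTy Γ n Θ k (.kf τ') →
      HasLTy Γ n Θ (.restrict τ τ' ε k) (.kf τ)
  | fold {Γ n Θ φ} : WfDecl Γ n Θ → IsProp Γ (n + 1) φ → φ.Occ true 0 →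
      HasLTy Γ n Θ (.fold φ) (.prf (.imp (φ.pinst (.mu φ)) (.mu φ)))
  | unfold {Γ n Θ φ} : WfDecl Γ n Θ → IsProp Γ (n + 1) φ → φ.Occ true 0 →
      HasLTy Γ n Θ (.unfold φ) (.prf (.imp (.mu φ) (φ.pinst (.mu φ))))
  | nuIn {Γ n Θ ψ} : WfDecl Γ n Θ → IsProp Γ (n + 1) ψ → ψ.Occ true 0 →
      HasLTy Γ n Θ (.nuIn ψ) (.prf (.imp (ψ.pinst (.nu ψ)) (.nu ψ)))
  | nuOut {Γ n Θ ψ} : WfDecl Γ n Θ → IsProp Γ (n + 1) ψ → ψ.Occ true 0 →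
      HasLTy Γ n Θ (.nuOut ψ) (.prf (.imp (.nu ψ) (ψ.pinst (.nu ψ))))
  | mp {Γ n Θ P Q f p} : IsProp Γ n P → IsProp Γ n Q →
      HasLTy Γ n Θ f (.prf (.imp P Q)) → HasLTy Γ n Θ p (.prf P) →
      HasLTy Γ n Θ (.mp P Q f p) (.prf Q)

/-- `Γ; Θ ⊢ u ≡ u' : B` in the constructive layer. -/
inductive LDefEq : List Term → ℕ → List LTy → LTm → LTm → LTy → Prop
  | rfl {Γ n Θ u B} : HasLTy Γ n Θ u B → LDefEq Γ n Θ u u B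
  | symm {Γ n Θ u u' B} : LDefEq Γ n Θ u u' B → LDefEq Γ n Θ u' u B
  | trans {Γ n Θ u u' u'' B} : LDefEq Γ n Θ u u' B → LDefEq Γ n Θ u' u'' B → LDefEq Γ n Θ u u'' B
  | conv {Γ n Θ u u' B B' i} : LDefEq Γ n Θ u u' B → LTyEq Γ n B B' i → LDefEq Γ n Θ u u' B'
  -- functor laws of restriction
  | restrictId {Γ n Θ τ k} : HasTy Γ τ finTrace → HasLTy Γ n Θ k (.kf τ) →
      LDefEq Γ n Θ (.restrict τ τ (extId τ) k) k (.kf τ)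
  | restrictComp {Γ n Θ τ τ' τ'' ε₁ ε₂ k} : HasTy Γ τ finTrace → HasTy Γ τ' finTrace →
      HasTy Γ τ'' finTrace → HasTy Γ ε₁ (ext τ τ') → HasTy Γ ε₂ (ext τ' τ'') →
      HasLTy Γ n Θ k (.kf τ'') →
      LDefEq Γ n Θ (.restrict τ τ' ε₁ (.restrict τ' τ'' ε₂ k))
        (.restrict τ τ'' (extComp τ τ' τ'' ε₁ ε₂) k) (.kf τ)
  -- the fixed-point proof terms are mutually inverse
  | foldUnfold {Γ n Θ φ w} : IsProp Γ (n + 1) φ → φ.Occ true 0 → HasLTy Γ n Θ w (.prf (.mu φ)) →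
      LDefEq Γ n Θ (.mp (φ.pinst (.mu φ)) (.mu φ) (.fold φ)
        (.mp (.mu φ) (φ.pinst (.mu φ)) (.unfold φ) w)) w (.prf (.mu φ))
  | unfoldFold {Γ n Θ φ w} : IsProp Γ (n + 1) φ → φ.Occ true 0 →
      HasLTy Γ n Θ w (.prf (φ.pinst (.mu φ))) →
      LDefEq Γ n Θ (.mp (.mu φ) (φ.pinst (.mu φ)) (.unfold φ)
        (.mp (φ.pinst (.mu φ)) (.mu φ) (.fold φ) w)) w (.prf (φ.pinst (.mu φ)))
  | inOut {Γ n Θ ψ w} : IsProp Γ (n + 1) ψ → ψ.Occ true 0 → HasLTy Γ n Θ w (.prf (.nu ψ)) →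
      LDefEq Γ n Θ (.mp (ψ.pinst (.nu ψ)) (.nu ψ) (.nuIn ψ)
        (.mp (.nu ψ) (ψ.pinst (.nu ψ)) (.nuOut ψ) w)) w (.prf (.nu ψ))
  | outIn {Γ n Θ ψ w} : IsProp Γ (n + 1) ψ → ψ.Occ true 0 →
      HasLTy Γ n Θ w (.prf (ψ.pinst (.nu ψ))) →
      LDefEq Γ n Θ (.mp (.nu ψ) (ψ.pinst (.nu ψ)) (.nuOut ψ)
        (.mp (ψ.pinst (.nu ψ)) (.nu ψ) (.nuIn ψ) w)) w (.prf (ψ.pinst (.nu ψ)))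
  -- propositions are proof-irrelevant
  | irrel {Γ n Θ P p p'} : IsProp Γ n P → HasLTy Γ n Θ p (.prf P) → HasLTy Γ n Θ p' (.prf P) →
      LDefEq Γ n Θ p p' (.prf P)
  -- closure under the term formers
  | ty {Γ n Θ B B' i} : WfDecl Γ n Θ → LTyEq Γ n B B' i → LDefEq Γ n Θ (.ty B) (.ty B') (.univ i)
  | prp {Γ n Θ P P'} : WfDecl Γ n Θ → PropEq Γ n P P' → LDefEq Γ n Θ (.prp P) (.prp P') .prop
  | restrict {Γ n Θ τ₁ τ₁' τ₂ τ₂' ε ε' k k'} : DefEq Γ τ₁ τ₁' finTrace →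
      DefEq Γ τ₂ τ₂' finTrace → DefEq Γ ε ε' (ext τ₁ τ₂) → LDefEq Γ n Θ k k' (.kf τ₂) →
      LDefEq Γ n Θ (.restrict τ₁ τ₂ ε k) (.restrict τ₁' τ₂' ε' k') (.kf τ₁)
  | mp {Γ n Θ P P' Q Q' f f' p p'} : PropEq Γ n P P' → PropEq Γ n Q Q' →
      LDefEq Γ n Θ f f' (.prf (.imp P Q)) → LDefEq Γ n Θ p p' (.prf P) →
      LDefEq Γ n Θ (.mp P Q f p) (.mp P' Q' f' p') (.prf Q)

/-! ## Computational models: categories with families -/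

/-- A category with families on the category `C` of contexts. `Tm X` is the set of all terms in
context `X`, with `tp` giving the type, so that `{t : Tm X // tp t = A}` is the set of terms
of type `A`. -/
structure CwF (C : Type u) [Category.{v} C] where
  Ty : C → Type w
  Tm : C → Type w
  tp : ∀ {X : C}, Tm X → Ty X
  /-- substitution in types -/
  sT : ∀ {X Y : C}, (Y ⟶ X) → Ty X → Ty Y
  sT_id : ∀ {X : C} (A : Ty X), sT (𝟙 X) A = A
  sT_comp : ∀ {X Y Z : C} (g : Z ⟶ Y) (f : Y ⟶ X) (A : Ty X), sT (g ≫ f) A = sT g (sT f A)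
  /-- substitution in terms -/
  sM : ∀ {X Y : C}, (Y ⟶ X) → Tm X → Tm Y
  sM_id : ∀ {X : C} (t : Tm X), sM (𝟙 X) t = t
  sM_comp : ∀ {X Y Z : C} (g : Z ⟶ Y) (f : Y ⟶ X) (t : Tm X), sM (g ≫ f) t = sM g (sM f t)
  tp_sM : ∀ {X Y : C} (f : Y ⟶ X) (t : Tm X), tp (sM f t) = sT f (tp t)
  /-- comprehension -/
  ext : ∀ {X : C}, Ty X → C
  p : ∀ {X : C} (A : Ty X), ext A ⟶ X
  q : ∀ {X : C} (A : Ty X), Tm (ext A)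
  tp_q : ∀ {X : C} (A : Ty X), tp (q A) = sT (p A) A
  pair : ∀ {X Y : C} (A : Ty X) (f : Y ⟶ X) (t : Tm Y), tp t = sT f A → (Y ⟶ ext A)
  pair_p : ∀ {X Y : C} (A : Ty X) (f : Y ⟶ X) (t : Tm Y) (h : tp t = sT f A),
    pair A f t h ≫ p A = f
  pair_q : ∀ {X Y : C} (A : Ty X) (f : Y ⟶ X) (t : Tm Y) (h : tp t = sT f A),
    sM (pair A f t h) (q A) = t
  ext_hom : ∀ {X Y : C} (A : Ty X) (g g' : Y ⟶ ext A),
    g ≫ p A = g' ≫ p A → sM g (q A) = sM g' (q A) → g = g'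

namespace CwF

variable {C : Type u} [Category.{v} C] (W : CwF.{u, v, w} C)

/-- The set `Tm_c(X, A)`. -/
def TmC {X : C} (A : W.Ty X) : Type w := {t : W.Tm X // W.tp t = A}

/-- The lift `Y.A[f] ⟶ X.A` of `f : Y ⟶ X`. -/
def lift {X Y : C} (A : W.Ty X) (f : Y ⟶ X) : W.ext (W.sT f A) ⟶ W.ext A :=
  W.pair A (W.p _ ≫ f) (W.q _) (by rw [W.tp_q, W.sT_comp])

theorem lift_p {X Y : C} (A : W.Ty X) (f : Y ⟶ X) :
    W.lift A f ≫ W.p A = W.p _ ≫ f := W.pair_p _ _ _ _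

/-- The section `⟨id, a⟩ : X ⟶ X.A` given by a term `a` of type `A`. -/
def sec {X : C} (A : W.Ty X) (a : W.Tm X) (h : W.tp a = A) : X ⟶ W.ext A :=
  W.pair A (𝟙 X) a (by rw [h, W.sT_id])

theorem sec_p {X : C} (A : W.Ty X) (a : W.Tm X) (h : W.tp a = A) :
    W.sec A a h ≫ W.p A = 𝟙 X := W.pair_p _ _ _ _

/-- The map `⟨id, a, b⟩ : X ⟶ X.A.A` given by terms `a`, `b` of type `A`. -/
def sec₂ {X : C} (A : W.Ty X) (a b : W.Tm X) (ha : W.tp a = A) (hb : W.tp b = A) :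
    X ⟶ W.ext (W.sT (W.p A) A) :=
  W.pair _ (W.sec A a ha) b (by rw [← W.sT_comp, W.sec_p, W.sT_id, hb])

/-- The diagonal `X.A ⟶ X.A.A`. -/
def diag {X : C} (A : W.Ty X) : W.ext A ⟶ W.ext (W.sT (W.p A) A) :=
  W.pair _ (𝟙 _) (W.q A) (by rw [W.tp_q, W.sT_id])

/-- The lift `Y.A[f].A[f] ⟶ X.A.A` of `f : Y ⟶ X`. -/
def lift₂ {X Y : C} (A : W.Ty X) (f : Y ⟶ X) :
    W.ext (W.sT (W.p (W.sT f A)) (W.sT f A)) ⟶ W.ext (W.sT (W.p A) A) :=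
  W.pair _ (W.p _ ≫ W.lift A f) (W.q _) (by
    rw [W.tp_q, ← W.sT_comp (W.p _ ≫ W.lift A f) (W.p A) A, Category.assoc, W.lift_p, W.sT_comp,
      W.sT_comp])

/-- The environment of variables after extending the context by `A`. -/
def push {X : C} (A : W.Ty X) (env : List (W.Tm X)) : List (W.Tm (W.ext A)) :=
  W.q A :: env.map (W.sM (W.p A))

variable [HasTerminal C]

/-- A closed type in the context `X`. -/
def cl (X : C) (A : W.Ty (⊤_ C)) : W.Ty X := W.sT (terminal.from X) A

/-- `t` is a term of the closed type `A`. -/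
def Is {X : C} (t : W.Tm X) (A : W.Ty (⊤_ C)) : Prop := W.tp t = W.cl X A

/-- The map `X ⟶ 1.A` given by a term of a closed type. -/
def clMap {X : C} (A : W.Ty (⊤_ C)) (t : W.Tm X) (h : W.Is t A) : X ⟶ W.ext A :=
  W.pair A (terminal.from X) t h

theorem sT_cl {X Y : C} (f : Y ⟶ X) (A : W.Ty (⊤_ C)) : W.sT f (W.cl X A) = W.cl Y A := by
  rw [cl, cl, ← W.sT_comp]
  congr 1
  exact Subsingleton.elim _ _

theorem Is.sub {W : CwF.{u, v, w} C} {X Y : C} {t : W.Tm X} {A : W.Ty (⊤_ C)} (h : W.Is t A)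
    (f : Y ⟶ X) : W.Is (W.sM f t) A := by
  have h' : W.tp t = W.cl X A := h
  show W.tp (W.sM f t) = W.cl Y A
  rw [W.tp_sM, h', W.sT_cl]

end CwF

/-- A category with families with `Π`, `Σ`, intensional identity types, a hierarchy of Russell
universes, and the base types of states, events, and traces. -/
structure CompModel (C : Type u) [Category.{v} C] [HasTerminal C] extends CwF.{u, v, w} C where
  /-- dependent products: `λ`-abstraction is a bijection, natural in the context -/
  Pi : ∀ {X : C} (A : Ty X), Ty (ext A) → Ty X
  Pi_nat : ∀ {X Y : C} (f : Y ⟶ X) (A : Ty X) (B : Ty (ext A)),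
    sT f (Pi A B) = Pi (sT f A) (sT (toCwF.lift A f) B)
  lam : ∀ {X : C} (A : Ty X), Tm (ext A) → Tm X
  tp_lam : ∀ {X : C} (A : Ty X) (b : Tm (ext A)), tp (lam A b) = Pi A (tp b)
  lam_nat : ∀ {X Y : C} (f : Y ⟶ X) (A : Ty X) (b : Tm (ext A)),
    sM f (lam A b) = lam (sT f A) (sM (toCwF.lift A f) b)
  lam_bij : ∀ {X : C} (A : Ty X) (B : Ty (ext A)) (g : Tm X), tp g = Pi A B →
    ∃! b : Tm (ext A), tp b = B ∧ lam A b = g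
  /-- dependent sums: `mkGen A B` is the generic pair, in the context `X.A.B` -/
  Sig : ∀ {X : C} (A : Ty X), Ty (ext A) → Ty X
  Sig_nat : ∀ {X Y : C} (f : Y ⟶ X) (A : Ty X) (B : Ty (ext A)),
    sT f (Sig A B) = Sig (sT f A) (sT (toCwF.lift A f) B)
  mkGen : ∀ {X : C} (A : Ty X) (B : Ty (ext A)), Tm (ext B)
  tp_mkGen : ∀ {X : C} (A : Ty X) (B : Ty (ext A)), tp (mkGen A B) = sT (p B ≫ p A) (Sig A B)
  mkGen_nat : ∀ {X Y : C} (f : Y ⟶ X) (A : Ty X) (B : Ty (ext A)),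
    sM (toCwF.lift B (toCwF.lift A f)) (mkGen A B) = mkGen (sT f A) (sT (toCwF.lift A f) B)
  mkGen_bij : ∀ {X : C} (A : Ty X) (B : Ty (ext A)) (t : Tm X), tp t = Sig A B →
    ∃! g : X ⟶ ext B, g ≫ p B ≫ p A = 𝟙 X ∧ sM g (mkGen A B) = t
  /-- identity types: `IdT A` is the identity type in the context `X.A.A`, `rflGen A` the generic
  reflexivity proof in the context `X.A` -/
  IdT : ∀ {X : C} (A : Ty X), Ty (ext (sT (p A) A))
  IdT_nat : ∀ {X Y : C} (f : Y ⟶ X) (A : Ty X),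
    sT (toCwF.lift₂ A f) (IdT A) = IdT (sT f A)
  rflGen : ∀ {X : C} (A : Ty X), Tm (ext A)
  tp_rflGen : ∀ {X : C} (A : Ty X), tp (rflGen A) = sT (toCwF.diag A) (IdT A)
  rflGen_nat : ∀ {X Y : C} (f : Y ⟶ X) (A : Ty X),
    sM (toCwF.lift A f) (rflGen A) = rflGen (sT f A)
  J : ∀ {X : C} (A : Ty X) (M : Ty (ext (IdT A))) (d : Tm (ext A)),
    tp d = sT (pair (IdT A) (toCwF.diag A) (rflGen A) (tp_rflGen A)) M → Tm (ext (IdT A))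
  tp_J : ∀ {X : C} (A : Ty X) (M : Ty (ext (IdT A))) (d : Tm (ext A)) h, tp (J A M d h) = M
  J_beta : ∀ {X : C} (A : Ty X) (M : Ty (ext (IdT A))) (d : Tm (ext A)) h,
    sM (pair (IdT A) (toCwF.diag A) (rflGen A) (tp_rflGen A)) (J A M d h) = d
  J_nat : ∀ {X Y : C} (f : Y ⟶ X) (A : Ty X) (M : Ty (ext (IdT A))) (d : Tm (ext A)) h
    (g : ext (IdT (sT f A)) ⟶ ext (IdT A)) h',
    g ≫ p (IdT A) = p (IdT (sT f A)) ≫ toCwF.lift₂ A f → sM g (q (IdT A)) = q (IdT (sT f A)) →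
    sM g (J A M d h) = J (sT f A) (sT g M) (sM (toCwF.lift A f) d) h'
  /-- universes: a term of `U i` is (the name of) a type, which determines the term -/
  U : ℕ → Ty (⊤_ C)
  El : ∀ {X : C}, Tm X → Ty X
  El_nat : ∀ {X Y : C} (f : Y ⟶ X) (a : Tm X) (i : ℕ), toCwF.Is a (U i) →
    sT f (El a) = El (sM f a)
  El_inj : ∀ {X : C} (a b : Tm X) (i : ℕ), toCwF.Is a (U i) → toCwF.Is b (U i) →
    El a = El b → a = b
  U_small : ∀ (X : C) (i : ℕ), ∃ c : Tm X, toCwF.Is c (U (i + 1)) ∧ El c = toCwF.cl X (U i)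
  Pi_small : ∀ {X : C} (i : ℕ) (a : Tm X) (b : Tm (ext (El a))), toCwF.Is a (U i) →
    toCwF.Is b (U i) → ∃ c : Tm X, toCwF.Is c (U i) ∧ El c = Pi (El a) (El b)
  Sig_small : ∀ {X : C} (i : ℕ) (a : Tm X) (b : Tm (ext (El a))), toCwF.Is a (U i) →
    toCwF.Is b (U i) → ∃ c : Tm X, toCwF.Is c (U i) ∧ El c = Sig (El a) (El b)
  Id_small : ∀ {X : C} (i : ℕ) (a : Tm X), toCwF.Is a (U i) →
    ∃ c : Tm (ext (sT (p (El a)) (El a))), toCwF.Is c (U i) ∧ El c = IdT (El a)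
  /-- base types -/
  State : Ty (⊤_ C)
  Event : Ty (⊤_ C)
  NatT : Ty (⊤_ C)
  FinT : Ty (⊤_ C)
  InfT : Ty (⊤_ C)
  State_small : ∀ X : C, ∃ c : Tm X, toCwF.Is c (U 0) ∧ El c = toCwF.cl X State
  Event_small : ∀ X : C, ∃ c : Tm X, toCwF.Is c (U 0) ∧ El c = toCwF.cl X Event
  NatT_small : ∀ X : C, ∃ c : Tm X, toCwF.Is c (U 0) ∧ El c = toCwF.cl X NatT
  FinT_small : ∀ X : C, ∃ c : Tm X, toCwF.Is c (U 0) ∧ El c = toCwF.cl X FinT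
  InfT_small : ∀ X : C, ∃ c : Tm X, toCwF.Is c (U 0) ∧ El c = toCwF.cl X InfT
  /-- transitions -/
  StepT : ∀ {X : C}, Tm X → Tm X → Tm X → Ty X
  StepT_nat : ∀ {X Y : C} (f : Y ⟶ X) (s e s' : Tm X), toCwF.Is s State → toCwF.Is e Event →
    toCwF.Is s' State → sT f (StepT s e s') = StepT (sM f s) (sM f e) (sM f s')
  StepT_small : ∀ {X : C} (s e s' : Tm X), toCwF.Is s State → toCwF.Is e Event →
    toCwF.Is s' State → ∃ c : Tm X, toCwF.Is c (U 0) ∧ El c = StepT s e s'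
  /-- finite traces -/
  nil : ∀ {X : C}, Tm X → Tm X
  nil_is : ∀ {X : C} (s : Tm X), toCwF.Is s State → toCwF.Is (nil s) FinT
  nil_nat : ∀ {X Y : C} (f : Y ⟶ X) (s : Tm X), toCwF.Is s State →
    sM f (nil s) = nil (sM f s)
  step : ∀ {X : C}, Tm X → Tm X → Tm X → Tm X
  step_is : ∀ {X : C} (τ e s : Tm X), toCwF.Is τ FinT → toCwF.Is e Event → toCwF.Is s State →
    toCwF.Is (step τ e s) FinT
  step_nat : ∀ {X Y : C} (f : Y ⟶ X) (τ e s : Tm X), toCwF.Is τ FinT → toCwF.Is e Event →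
    toCwF.Is s State → sM f (step τ e s) = step (sM f τ) (sM f e) (sM f s)
  /-- extensions of finite traces, forming a category in every context -/
  Ext : ∀ {X : C}, Tm X → Tm X → Ty X
  Ext_nat : ∀ {X Y : C} (f : Y ⟶ X) (τ τ' : Tm X), toCwF.Is τ FinT → toCwF.Is τ' FinT →
    sT f (Ext τ τ') = Ext (sM f τ) (sM f τ')
  Ext_small : ∀ {X : C} (τ τ' : Tm X), toCwF.Is τ FinT → toCwF.Is τ' FinT →
    ∃ c : Tm X, toCwF.Is c (U 0) ∧ El c = Ext τ τ'
  eid : ∀ {X : C}, Tm X → Tm X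
  tp_eid : ∀ {X : C} (τ : Tm X), toCwF.Is τ FinT → tp (eid τ) = Ext τ τ
  eid_nat : ∀ {X Y : C} (f : Y ⟶ X) (τ : Tm X), toCwF.Is τ FinT → sM f (eid τ) = eid (sM f τ)
  /-- `ecomp τ τ' τ'' ε₁ ε₂` is `ε₂ ∘ ε₁` -/
  ecomp : ∀ {X : C}, Tm X → Tm X → Tm X → Tm X → Tm X → Tm X
  tp_ecomp : ∀ {X : C} (τ τ' τ'' ε₁ ε₂ : Tm X), toCwF.Is τ FinT → toCwF.Is τ' FinT →
    toCwF.Is τ'' FinT → tp ε₁ = Ext τ τ' → tp ε₂ = Ext τ' τ'' →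
    tp (ecomp τ τ' τ'' ε₁ ε₂) = Ext τ τ''
  ecomp_nat : ∀ {X Y : C} (f : Y ⟶ X) (τ τ' τ'' ε₁ ε₂ : Tm X), toCwF.Is τ FinT →
    toCwF.Is τ' FinT → toCwF.Is τ'' FinT → tp ε₁ = Ext τ τ' → tp ε₂ = Ext τ' τ'' →
    sM f (ecomp τ τ' τ'' ε₁ ε₂) = ecomp (sM f τ) (sM f τ') (sM f τ'') (sM f ε₁) (sM f ε₂)
  eid_ecomp : ∀ {X : C} (τ τ' ε : Tm X), toCwF.Is τ FinT → toCwF.Is τ' FinT →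
    tp ε = Ext τ τ' → ecomp τ τ τ' (eid τ) ε = ε
  ecomp_eid : ∀ {X : C} (τ τ' ε : Tm X), toCwF.Is τ FinT → toCwF.Is τ' FinT →
    tp ε = Ext τ τ' → ecomp τ τ' τ' ε (eid τ') = ε
  ecomp_assoc : ∀ {X : C} (τ₁ τ₂ τ₃ τ₄ ε₁ ε₂ ε₃ : Tm X), toCwF.Is τ₁ FinT → toCwF.Is τ₂ FinT →
    toCwF.Is τ₃ FinT → toCwF.Is τ₄ FinT → tp ε₁ = Ext τ₁ τ₂ → tp ε₂ = Ext τ₂ τ₃ →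
    tp ε₃ = Ext τ₃ τ₄ →
    ecomp τ₁ τ₃ τ₄ (ecomp τ₁ τ₂ τ₃ ε₁ ε₂) ε₃ = ecomp τ₁ τ₂ τ₄ ε₁ (ecomp τ₂ τ₃ τ₄ ε₂ ε₃)
  /-- the one-step extension from `τ` to `step τ e s` -/
  eone : ∀ {X : C}, Tm X → Tm X → Tm X → Tm X
  tp_eone : ∀ {X : C} (τ e s : Tm X), toCwF.Is τ FinT → toCwF.Is e Event → toCwF.Is s State →
    tp (eone τ e s) = Ext τ (step τ e s)
  eone_nat : ∀ {X Y : C} (f : Y ⟶ X) (τ e s : Tm X), toCwF.Is τ FinT → toCwF.Is e Event →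
    toCwF.Is s State → sM f (eone τ e s) = eone (sM f τ) (sM f e) (sM f s)
  /-- infinite traces: the final coalgebra of `Z ↦ State × (Event × Z)`, with structure map
  `π ↦ (head π, (evt π, rest π))` -/
  head : ∀ {X : C}, Tm X → Tm X
  evt : ∀ {X : C}, Tm X → Tm X
  rest : ∀ {X : C}, Tm X → Tm X
  head_is : ∀ {X : C} (π : Tm X), toCwF.Is π InfT → toCwF.Is (head π) State
  evt_is : ∀ {X : C} (π : Tm X), toCwF.Is π InfT → toCwF.Is (evt π) Event
  rest_is : ∀ {X : C} (π : Tm X), toCwF.Is π InfT → toCwF.Is (rest π) InfT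
  head_nat : ∀ {X Y : C} (f : Y ⟶ X) (π : Tm X), toCwF.Is π InfT →
    sM f (head π) = head (sM f π)
  evt_nat : ∀ {X Y : C} (f : Y ⟶ X) (π : Tm X), toCwF.Is π InfT → sM f (evt π) = evt (sM f π)
  rest_nat : ∀ {X Y : C} (f : Y ⟶ X) (π : Tm X), toCwF.Is π InfT →
    sM f (rest π) = rest (sM f π)
  InfT_final : ∀ {Z : C} (s e : Tm Z) (r : Z ⟶ Z), toCwF.Is s State → toCwF.Is e Event →
    ∃! π : Tm Z, toCwF.Is π InfT ∧ head π = s ∧ evt π = e ∧ rest π = sM r π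

namespace CompModel

variable {C : Type u} [Category.{v} C] [HasTerminal C] (M : CompModel.{u, v, w} C)

/-- The body of a term of type `Pi A B`. -/
def unlam {X : C} (A : M.Ty X) (B : M.Ty (M.ext A)) (g : M.Tm X) (h : M.tp g = M.Pi A B) :
    M.Tm (M.ext A) :=
  (M.lam_bij A B g h).choose

/-- The components of a term of type `Sig A B`, as a map into `X.A.B`. -/
def unpair {X : C} (A : M.Ty X) (B : M.Ty (M.ext A)) (t : M.Tm X) (h : M.tp t = M.Sig A B) :
    X ⟶ M.ext B :=
  (M.mkGen_bij A B t h).choose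

/-- The pair `(a, b)`. -/
def mkPair {X : C} (A : M.Ty X) (B : M.Ty (M.ext A)) (a b : M.Tm X) (ha : M.tp a = A)
    (hb : M.tp b = M.sT (M.sec A a ha) B) : M.Tm X :=
  M.sM (M.pair B (M.sec A a ha) b hb) (M.mkGen A B)

/-- `Id_A(a, b)`. -/
def idAt {X : C} (A : M.Ty X) (a b : M.Tm X) (ha : M.tp a = A) (hb : M.tp b = A) : M.Ty X :=
  M.sT (M.sec₂ A a b ha hb) (M.IdT A)

/-- `(evt π, rest π) : Event × InfT`. -/
def tail {X : C} (π : M.Tm X) (h : M.Is π M.InfT) : M.Tm X :=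
  M.mkPair (M.cl X M.Event) (M.cl _ M.InfT) (M.evt π) (M.rest π) (M.evt_is π h)
    (by rw [M.sT_cl]; exact M.rest_is π h)

/-- The unique coalgebra map into the final coalgebra, from a coalgebra on `X.A` over `X`. -/
def corec {X : C} (A : M.Ty X) (s e r : M.Tm (M.ext A)) (hs : M.Is s M.State)
    (he : M.Is e M.Event) (hr : M.tp r = M.sT (M.p A) A) : M.Tm (M.ext A) :=
  (M.InfT_final s e (M.pair A (M.p A) r hr) hs he).choose

open Classical in
/-- The term of the universe `V` that names the type `A`, if there is one. -/
def code {X : C} (V A : M.Ty X) : Option (M.Tm X) :=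
  if h : ∃ c : M.Tm X, M.tp c = V ∧ M.El c = A then some h.choose else none

open Classical in
/-- A term of some universe, as a type. -/
def asTy {X : C} (a : M.Tm X) : Option (M.Ty X) :=
  if ∃ i, M.Is a (M.U i) then some (M.El a) else none

/-! ### Interpretation of the computational layer -/

open Classical in
/-- The (partial) interpretation of raw expressions in the context `X`, where `env` lists the
values of the variables. -/
def interp : Term → (X : C) → List (M.Tm X) → Option (M.Tm X)
  | .var n, _, env => env[n]?
  | .univ i, X, _ => M.code (M.cl X (M.U (i + 1))) (M.cl X (M.U i))
  | .pi A B, X, env =>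
      (interp A X env).bind fun a => (interp B (M.ext (M.El a)) (M.push _ env)).bind fun b =>
        if ∃ i, M.Is a (M.U i) ∧ M.Is b (M.U i) then
          M.code (M.tp a) (M.Pi (M.El a) (M.El b)) else none
  | .lam A B t, X, env =>
      ((interp A X env).bind M.asTy).bind fun A' =>
      ((interp B (M.ext A') (M.push A' env)).bind M.asTy).bind fun B' =>
      (interp t (M.ext A') (M.push A' env)).bind fun b =>
        if M.tp b = B' then some (M.lam A' b) else none
  | .app A B f a, X, env =>
      ((interp A X env).bind M.asTy).bind fun A' =>
      ((interp B (M.ext A') (M.push A' env)).bind M.asTy).bind fun B' =>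
      (interp f X env).bind fun g => (interp a X env).bind fun x =>
        if h : M.tp g = M.Pi A' B' ∧ M.tp x = A' then
          some (M.sM (M.sec A' x h.2) (M.unlam A' B' g h.1)) else none
  | .sig A B, X, env =>
      (interp A X env).bind fun a => (interp B (M.ext (M.El a)) (M.push _ env)).bind fun b =>
        if ∃ i, M.Is a (M.U i) ∧ M.Is b (M.U i) then
          M.code (M.tp a) (M.Sig (M.El a) (M.El b)) else none
  | .pair A B a b, X, env =>
      ((interp A X env).bind M.asTy).bind fun A' =>
      ((interp B (M.ext A') (M.push A' env)).bind M.asTy).bind fun B' =>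
      (interp a X env).bind fun x => (interp b X env).bind fun y =>
        if h : ∃ hx : M.tp x = A', M.tp y = M.sT (M.sec A' x hx) B' then
          some (M.mkPair A' B' x y h.choose h.choose_spec) else none
  | .fst A B t, X, env =>
      ((interp A X env).bind M.asTy).bind fun A' =>
      ((interp B (M.ext A') (M.push A' env)).bind M.asTy).bind fun B' =>
      (interp t X env).bind fun x =>
        if h : M.tp x = M.Sig A' B' then
          some (M.sM (M.unpair A' B' x h ≫ M.p B') (M.q A')) else none
  | .snd A B t, X, env =>
      ((interp A X env).bind M.asTy).bind fun A' =>
      ((interp B (M.ext A') (M.push A' env)).bind M.asTy).bind fun B' =>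
      (interp t X env).bind fun x =>
        if h : M.tp x = M.Sig A' B' then
          some (M.sM (M.unpair A' B' x h) (M.q B')) else none
  | .idt A a b, X, env =>
      (interp A X env).bind fun A' => (interp a X env).bind fun x =>
      (interp b X env).bind fun y =>
        if h : (∃ i, M.Is A' (M.U i)) ∧ M.tp x = M.El A' ∧ M.tp y = M.El A' then
          M.code (M.tp A') (M.idAt (M.El A') x y h.2.1 h.2.2) else none
  | .refl A a, X, env =>
      ((interp A X env).bind M.asTy).bind fun A' => (interp a X env).bind fun x =>
        if h : M.tp x = A' then some (M.sM (M.sec A' x h) (M.rflGen A')) else none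
  | .idrec A D d a b p, X, env =>
      ((interp A X env).bind M.asTy).bind fun A' =>
      ((interp D (M.ext (M.IdT A'))
        (M.push (M.IdT A') (M.push (M.sT (M.p A') A') (M.push A' env)))).bind M.asTy).bind
        fun D' =>
      (interp d (M.ext A') (M.push A' env)).bind fun d' =>
      (interp a X env).bind fun x => (interp b X env).bind fun y =>
      (interp p X env).bind fun e =>
        if h : ∃ (_ : M.tp d' =
              M.sT (M.pair (M.IdT A') (M.diag A') (M.rflGen A') (M.tp_rflGen A')) D')
            (hx : M.tp x = A') (hy : M.tp y = A'), M.tp e = M.idAt A' x y hx hy then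
          some (M.sM (M.pair (M.IdT A')
              (M.sec₂ A' x y h.choose_spec.choose h.choose_spec.choose_spec.choose) e
              h.choose_spec.choose_spec.choose_spec)
            (M.J A' D' d' h.choose))
        else none
  | .state, X, _ => M.code (M.cl X (M.U 0)) (M.cl X M.State)
  | .event, X, _ => M.code (M.cl X (M.U 0)) (M.cl X M.Event)
  | .nat, X, _ => M.code (M.cl X (M.U 0)) (M.cl X M.NatT)
  | .stepT s e s', X, env =>
      (interp s X env).bind fun x => (interp e X env).bind fun y =>
      (interp s' X env).bind fun x' =>
        if M.Is x M.State ∧ M.Is y M.Event ∧ M.Is x' M.State then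
          M.code (M.cl X (M.U 0)) (M.StepT x y x') else none
  | .finTrace, X, _ => M.code (M.cl X (M.U 0)) (M.cl X M.FinT)
  | .nil s, X, env => (interp s X env).bind fun x =>
      if M.Is x M.State then some (M.nil x) else none
  | .step τ e s, X, env =>
      (interp τ X env).bind fun t => (interp e X env).bind fun y =>
      (interp s X env).bind fun x =>
        if M.Is t M.FinT ∧ M.Is y M.Event ∧ M.Is x M.State then some (M.step t y x) else none
  | .infTrace, X, _ => M.code (M.cl X (M.U 0)) (M.cl X M.InfT)
  | .head π, X, env => (interp π X env).bind fun x =>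
      if M.Is x M.InfT then some (M.head x) else none
  | .tail π, X, env => (interp π X env).bind fun x =>
      if h : M.Is x M.InfT then some (M.tail x h) else none
  | .cofix A s e r a, X, env =>
      ((interp A X env).bind M.asTy).bind fun A' =>
      (interp s (M.ext A') (M.push A' env)).bind fun s' =>
      (interp e (M.ext A') (M.push A' env)).bind fun e' =>
      (interp r (M.ext A') (M.push A' env)).bind fun r' =>
      (interp a X env).bind fun x =>
        if h : (M.Is s' M.State ∧ M.Is e' M.Event) ∧
            M.tp r' = M.sT (M.p A') A' ∧ M.tp x = A' then
          some (M.sM (M.sec A' x h.2.2) (M.corec A' s' e' r' h.1.1 h.1.2 h.2.1)) else none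
  | .ext τ τ', X, env =>
      (interp τ X env).bind fun t => (interp τ' X env).bind fun t' =>
        if M.Is t M.FinT ∧ M.Is t' M.FinT then
          M.code (M.cl X (M.U 0)) (M.Ext t t') else none
  | .extId τ, X, env => (interp τ X env).bind fun t =>
      if M.Is t M.FinT then some (M.eid t) else none
  | .extComp τ τ' τ'' ε₁ ε₂, X, env =>
      (interp τ X env).bind fun t => (interp τ' X env).bind fun t' =>
      (interp τ'' X env).bind fun t'' =>
      (interp ε₁ X env).bind fun x => (interp ε₂ X env).bind fun y =>
        if (M.Is t M.FinT ∧ M.Is t' M.FinT ∧ M.Is t'' M.FinT) ∧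
            M.tp x = M.Ext t t' ∧ M.tp y = M.Ext t' t'' then
          some (M.ecomp t t' t'' x y) else none

/-- The interpretation `⟦A⟧` of a raw expression as a type. -/
def interpTy (A : Term) (X : C) (env : List (M.Tm X)) : Option (M.Ty X) :=
  (M.interp A X env).bind M.asTy

/-- The interpretation of a context: an object of `C` with the values of the variables. -/
def interpCtx : List Term → Option (Σ X : C, List (M.Tm X))
  | [] => some ⟨⊤_ C, []⟩
  | A :: Γ => (interpCtx Γ).bind fun S => (M.interpTy A S.1 S.2).map fun A' =>
      ⟨M.ext A', M.push A' S.2⟩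

/-! ### The trajectory category in a context -/

/-- Finite traces in the context `X`. -/
structure Tr (X : C) where
  tm : M.Tm X
  is : M.Is tm M.FinT

/-- Extensions of finite traces in the context `X`. -/
@[ext]
structure Tr.Hom {M : CompModel.{u, v, w} C} {X : C} (τ τ' : M.Tr X) where
  tm : M.Tm X
  tp_tm : M.tp tm = M.Ext τ.tm τ'.tm

/-- Traces and their extensions form a category. -/
instance (X : C) : Category (M.Tr X) where
  Hom τ τ' := Tr.Hom τ τ'
  id τ := ⟨M.eid τ.tm, M.tp_eid _ τ.is⟩
  comp {τ τ' τ''} ε ε' := ⟨M.ecomp τ.tm τ'.tm τ''.tm ε.tm ε'.tm,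
    M.tp_ecomp _ _ _ _ _ τ.is τ'.is τ''.is ε.tp_tm ε'.tp_tm⟩
  id_comp {τ τ'} ε := Tr.Hom.ext (M.eid_ecomp _ _ _ τ.is τ'.is ε.tp_tm)
  comp_id {τ τ'} ε := Tr.Hom.ext (M.ecomp_eid _ _ _ τ.is τ'.is ε.tp_tm)
  assoc {τ₁ τ₂ τ₃ τ₄} ε₁ ε₂ ε₃ := Tr.Hom.ext (M.ecomp_assoc _ _ _ _ _ _ _ τ₁.is τ₂.is τ₃.is
    τ₄.is ε₁.tp_tm ε₂.tp_tm ε₃.tp_tm)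

namespace Tr

variable {M}

/-- Reindexing of traces along `f : Y ⟶ X`. -/
def sub {X Y : C} (f : Y ⟶ X) (τ : M.Tr X) : M.Tr Y := ⟨M.sM f τ.tm, τ.is.sub f⟩

/-- Reindexing of extensions along `f : Y ⟶ X`. -/
def hsub {X Y : C} (f : Y ⟶ X) {τ τ' : M.Tr X} (ε : τ ⟶ τ') : τ.sub f ⟶ τ'.sub f :=
  Hom.mk (M.sM f (Hom.tm ε)) (by
    rw [M.tp_sM, Hom.tp_tm, M.Ext_nat f _ _ τ.is τ'.is]; rfl)

/-- The map `X ⟶ 1.FinT` given by a trace in the context `X`. -/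
def toHom {X : C} (τ : M.Tr X) : X ⟶ M.ext M.FinT := M.clMap M.FinT τ.tm τ.is

theorem sub_toHom {X Y : C} (f : Y ⟶ X) (τ : M.Tr X) : (τ.sub f).toHom = f ≫ τ.toHom := by
  apply M.ext_hom
  · exact Subsingleton.elim _ _
  · exact (M.pair_q _ _ _ _).trans ((congrArg (M.sM f) (M.pair_q _ _ _ _).symm).trans
      (M.sM_comp _ _ _).symm)

@[simp]
theorem id_tm {X : C} (τ : M.Tr X) : Hom.tm (𝟙 τ) = M.eid τ.tm := rfl

@[simp]
theorem comp_tm {X : C} {τ τ' τ'' : M.Tr X} (ε : τ ⟶ τ') (ε' : τ' ⟶ τ'') :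
    Hom.tm (ε ≫ ε') = M.ecomp τ.tm τ'.tm τ''.tm (Hom.tm ε) (Hom.tm ε') := rfl

theorem hsub_id {X Y : C} (f : Y ⟶ X) (τ : M.Tr X) : hsub f (𝟙 τ) = 𝟙 (τ.sub f) :=
  Hom.ext (M.eid_nat f _ τ.is)

theorem hsub_comp {X Y : C} (f : Y ⟶ X) {τ τ' τ'' : M.Tr X} (ε : τ ⟶ τ') (ε' : τ' ⟶ τ'') :
    hsub f (ε ≫ ε') = hsub f ε ≫ hsub f ε' :=
  Hom.ext (M.ecomp_nat f _ _ _ _ _ τ.is τ'.is τ''.is (Hom.tp_tm ε) (Hom.tp_tm ε'))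

end Tr

/-- The remainder of an infinite trace after `n` steps. -/
def drop {X : C} (π : M.Tm X) : ℕ → M.Tm X
  | 0 => π
  | n + 1 => M.rest (drop π n)

theorem drop_is {X : C} (π : M.Tm X) (h : M.Is π M.InfT) : ∀ n, M.Is (M.drop π n) M.InfT
  | 0 => h
  | n + 1 => M.rest_is _ (drop_is π h n)

/-- The finite prefix with `n` steps of an infinite trace. -/
def prefixTr {X : C} (π : M.Tm X) (h : M.Is π M.InfT) : ℕ → M.Tr X
  | 0 => ⟨M.nil (M.head π), M.nil_is _ (M.head_is _ h)⟩
  | n + 1 => ⟨M.step (prefixTr π h n).tm (M.evt (M.drop π n)) (M.head (M.drop π (n + 1))),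
      M.step_is _ _ _ (prefixTr π h n).is (M.evt_is _ (M.drop_is π h n))
        (M.head_is _ (M.drop_is π h (n + 1)))⟩

/-- The extension from each prefix to the next one. -/
def prefixExt {X : C} (π : M.Tm X) (h : M.Is π M.InfT) (n : ℕ) :
    M.prefixTr π h n ⟶ M.prefixTr π h (n + 1) :=
  Tr.Hom.mk (M.eone (M.prefixTr π h n).tm (M.evt (M.drop π n)) (M.head (M.drop π (n + 1))))
    (M.tp_eone _ _ _ (M.prefixTr π h n).is (M.evt_is _ (M.drop_is π h n))
      (M.head_is _ (M.drop_is π h (n + 1))))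

end CompModel

/-! ## The knowledge presheaf -/

/-- A computational model with a knowledge fibre `K_f`: an object `K` over the object of finite
traces, with restriction of its elements along extensions of traces, compatible with change of
context and satisfying the functor laws. -/
structure KnowModel (C : Type u) [Category.{v} C] [HasFiniteLimits C] extends
    CompModel.{u, v, w} C where
  K : C
  Kp : K ⟶ ext FinT
  res : ∀ {X : C} {τ τ' : toCompModel.Tr X}, (τ ⟶ τ') → (X ⟶ K) → (X ⟶ K)
  res_over : ∀ {X : C} {τ τ' : toCompModel.Tr X} (ε : τ ⟶ τ') (k : X ⟶ K),
    k ≫ Kp = τ'.toHom → res ε k ≫ Kp = τ.toHom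
  res_nat : ∀ {X Y : C} (f : Y ⟶ X) {τ τ' : toCompModel.Tr X} (ε : τ ⟶ τ') (k : X ⟶ K),
    k ≫ Kp = τ'.toHom → f ≫ res ε k = res (CompModel.Tr.hsub f ε) (f ≫ k)
  res_id : ∀ {X : C} (τ : toCompModel.Tr X) (k : X ⟶ K), k ≫ Kp = τ.toHom → res (𝟙 τ) k = k
  res_comp : ∀ {X : C} {τ τ' τ'' : toCompModel.Tr X} (ε₁ : τ ⟶ τ') (ε₂ : τ' ⟶ τ'') (k : X ⟶ K),
    k ≫ Kp = τ''.toHom → res ε₁ (res ε₂ k) = res (ε₁ ≫ ε₂) k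

namespace KnowModel

open CompModel

variable {C : Type u} [Category.{v} C] [HasFiniteLimits C] (M : KnowModel.{u, v, w} C)

theorem res_congr {X : C} {τ τ' σ σ' : M.Tr X} (ε : τ ⟶ τ') (δ : σ ⟶ σ') (k : X ⟶ M.K)
    (h : τ.tm = σ.tm) (h' : τ'.tm = σ'.tm) (hε : Tr.Hom.tm ε = Tr.Hom.tm δ) :
    M.res ε k = M.res δ k := by
  cases τ; cases τ'; cases σ; cases σ'
  cases h; cases h'
  have : ε = δ := Tr.Hom.ext hε
  rw [this]

/-- The fibre `K_f(τ)` over the context `X`: the pullback of `K` along `τ`. -/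
def kfObj {X : C} (τ : M.Tr X) : Over X := (Over.pullback τ.toHom).obj (Over.mk M.Kp)

/-- The tautological element of `K_f(τ)`, over the total object of `K_f(τ)`. -/
def kfElt {X : C} (τ : M.Tr X) : (M.kfObj τ).left ⟶ M.K := pullback.fst M.Kp τ.toHom

theorem kfElt_over {X : C} (τ : M.Tr X) :
    M.kfElt τ ≫ M.Kp = (τ.sub (M.kfObj τ).hom).toHom :=
  (pullback.condition (f := M.Kp) (g := τ.toHom)).trans (Tr.sub_toHom _ τ).symm

/-- The restriction map `K_f(τ') ⟶ K_f(τ)` over `X` along `ε : τ ⟶ τ'`. -/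
def kfMap {X : C} {τ τ' : M.Tr X} (ε : τ ⟶ τ') : M.kfObj τ' ⟶ M.kfObj τ :=
  Over.homMk (pullback.lift (f := M.Kp) (g := τ.toHom)
    (M.res (Tr.hsub (M.kfObj τ').hom ε) (M.kfElt τ')) (M.kfObj τ').hom
    ((M.res_over _ _ (M.kfElt_over τ')).trans (Tr.sub_toHom _ τ)))
    (pullback.lift_snd _ _ _)

theorem kfMap_elt {X : C} {τ τ' : M.Tr X} (ε : τ ⟶ τ') :
    (M.kfMap ε).left ≫ M.kfElt τ = M.res (Tr.hsub (M.kfObj τ').hom ε) (M.kfElt τ') :=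
  pullback.lift_fst _ _ _

theorem kf_hom_ext {X : C} {τ : M.Tr X} {B : Over X} (f g : B ⟶ M.kfObj τ)
    (h : f.left ≫ M.kfElt τ = g.left ≫ M.kfElt τ) : f = g := by
  apply Over.OverMorphism.ext
  exact pullback.hom_ext h ((Over.w f).trans (Over.w g).symm)

/-- The presheaf `K_f` in the context `X`, with values in `C/X`. -/
def kf (X : C) : (M.Tr X)ᵒᵖ ⥤ Over X where
  obj τ := M.kfObj τ.unop
  map ε := M.kfMap ε.unop
  map_id τ := by
    apply M.kf_hom_ext
    rw [kfMap_elt, unop_id, Tr.hsub_id, M.res_id _ _ (M.kfElt_over _), Over.id_left,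
      Category.id_comp]
  map_comp {τ₁ τ₂ τ₃} ε₁ ε₂ := by
    apply M.kf_hom_ext
    rw [kfMap_elt, Over.comp_left, Category.assoc, kfMap_elt,
      M.res_nat _ _ _ (M.kfElt_over _), kfMap_elt, unop_comp, Tr.hsub_comp,
      ← M.res_comp _ _ _ (M.kfElt_over _)]
    have h : ∀ t : M.Tm X, M.sM (M.kfMap ε₁.unop).left (M.sM (M.kfObj τ₂.unop).hom t) =
        M.sM (M.kfObj τ₁.unop).hom t := fun t => by
      rw [← M.sM_comp, Over.w]
    exact M.res_congr _ _ _ (h _).symm (h _).symm (h _).symm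

/-- The fibre `K_∞(π)` over the context `X`: the limit of the fibres over the finite prefixes
of `π`, along restriction. -/
def kinfObj [HasLimitsOfShape ℕᵒᵖ C] {X : C} (π : M.Tm X) (h : M.Is π M.InfT) : Over X :=
  limit (Functor.ofOpSequence (X := fun n => M.kfObj (M.prefixTr π h n))
    fun n => M.kfMap (M.prefixExt π h n))

end KnowModel

/-! ## Models -/

section Layers

variable {C : Type u} [Category.{v} C]

/-- `Ty_ℓ(X) = [T_fᵒᵖ, C/X]`. -/
abbrev TyL (Tf : Type z) [SmallCategory Tf] (X : C) := Tfᵒᵖ ⥤ Over X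

/-- `Tm_ℓ(X, B)`: global elements of the presheaf `B`, i.e. maps `1 ⟶ B` in `[T_fᵒᵖ, C/X]`. -/
abbrev TmL {Tf : Type z} [SmallCategory Tf] {X : C} (B : TyL Tf X) :=
  (Functor.const Tfᵒᵖ).obj (Over.mk (𝟙 X)) ⟶ B

/-- An object of `C/X` as a constant presheaf. -/
abbrev constL (Tf : Type z) [SmallCategory Tf] {X : C} (B : Over X) : TyL Tf X :=
  (Functor.const Tfᵒᵖ).obj B

variable [HasFiniteLimits C]

/-- `Prop(X)`: subobjects of `X` in `C`, which are the same as subobjects of the terminal object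
of `C/X`, see `PropL.equivSlice`. -/
abbrev PropL (X : C) := Subobject X

/-- `Sub_{C/X}(1_X)` and the set of subobjects of `X` are isomorphic. -/
def PropL.equivSlice (X : C) : Subobject (Over.mk (𝟙 X)) ≃o PropL X :=
  (Subobject.lowerEquivalence (MonoOver.slice (f := Over.mk (𝟙 X))
    (fun g => by
      have : Mono ((MonoOver.forget (Over.mk (𝟙 X))).obj g).hom := g.mono
      show Mono ((MonoOver.forget (Over.mk (𝟙 X))).obj g).hom.left
      infer_instance)
    (fun g => by
      have h := g.mono
      exact @Over.mono_of_mono_left _ _ _ _ _ _ h))).toOrderIso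

/-- Inverse image of propositions. -/
abbrev pb {X Y : C} (f : Y ⟶ X) (P : PropL X) : PropL Y := (Subobject.pullback f).obj P

/-- A monotone operator on propositions over `X`, given compatibly in all contexts over `X`. -/
structure StableOp (X : C) where
  app : ∀ {Y : C}, (Y ⟶ X) → PropL Y → PropL Y
  nat : ∀ {Y Z : C} (g : Z ⟶ Y) (f : Y ⟶ X) (Q : PropL Y), pb g (app f Q) = app (g ≫ f) (pb g Q)
  mono : ∀ {Y : C} (f : Y ⟶ X), Monotone (app f)

/-- A closed presheaf as a constructive type in the context `X`. -/
abbrev clL {Tf : Type z} [SmallCategory Tf] (V : Tfᵒᵖ ⥤ C) (X : C) : TyL Tf X := V ⋙ Over.star X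

/-- The section over `X` given by a map `X ⟶ V`. -/
def starSec {X V : C} (g : X ⟶ V) : Over.mk (𝟙 X) ⟶ (Over.star X).obj V :=
  (Over.forgetAdjStar X).homEquiv (Over.mk (𝟙 X)) V g

theorem starSec_comp {X V V' : C} (g : X ⟶ V) (h : V ⟶ V') :
    starSec (g ≫ h) = starSec g ≫ (Over.star X).map h :=
  Adjunction.homEquiv_naturality_right _ _ _

/-- The term given by a family of elements `X ⟶ V(o)` natural in `o`. -/
def clSec {Tf : Type z} [SmallCategory Tf] {V : Tfᵒᵖ ⥤ C} {X : C}
    (a : (Functor.const Tfᵒᵖ).obj X ⟶ V) : TmL (clL V X) where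
  app o := starSec (a.app o)
  naturality o o' m := by
    have h : a.app o' = a.app o ≫ V.map m := (Category.id_comp _).symm.trans (a.naturality m)
    exact ((Category.id_comp _).trans (congrArg starSec h)).trans (starSec_comp _ _)

/-- The family `a` of elements of `V` names the type `B`: `B` is the pullback along `a` of the
universal family `el : E ⟶ V`. -/
def IsCode {Tf : Type z} [SmallCategory Tf] {E V : Tfᵒᵖ ⥤ C} (el : E ⟶ V) {X : C}
    (B : TyL Tf X) (a : (Functor.const Tfᵒᵖ).obj X ⟶ V) : Prop :=
  ∃ top : B ⋙ Over.forget X ⟶ E,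
    ∀ o, IsPullback (top.app o) (B.obj o).hom (el.app o) (a.app o)

end Layers

/-- A three-layer model: a computational model with a knowledge fibre, on a category `C` of
contexts, together with the data over the trajectory category `Tf`. -/
structure Model (C : Type u) [Category.{v} C] [HasFiniteLimits C] [HasLimitsOfShape ℕᵒᵖ C]
    (Tf : Type z) [SmallCategory Tf] extends KnowModel.{u, v, w} C where
  /-- closed traces and their extensions are sent to objects and morphisms of `Tf` -/
  tr : toCompModel.Tr (⊤_ C) ⥤ Tf
  /-- the knowledge presheaf on `Tf`, whose value at a closed trace is the fibre over it -/
  Kf : Tfᵒᵖ ⥤ C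
  kfIso : tr.op ⋙ Kf ≅ toKnowModel.kf (⊤_ C) ⋙ Over.forget _
  /-- the subobject classifier -/
  Ω : Subobject.Classifier C
  /-- Heyting structure and quantifiers on propositions, stable under reindexing -/
  bot : ∀ X : C, PropL X
  bot_le : ∀ {X : C} (P : PropL X), bot X ≤ P
  pb_bot : ∀ {X Y : C} (f : Y ⟶ X), pb f (bot X) = bot Y
  sup : ∀ {X : C}, PropL X → PropL X → PropL X
  sup_le : ∀ {X : C} (P Q R : PropL X), sup P Q ≤ R ↔ P ≤ R ∧ Q ≤ R
  pb_sup : ∀ {X Y : C} (f : Y ⟶ X) (P Q : PropL X), pb f (sup P Q) = sup (pb f P) (pb f Q)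
  imp : ∀ {X : C}, PropL X → PropL X → PropL X
  le_imp : ∀ {X : C} (P Q R : PropL X), R ≤ imp P Q ↔ R ⊓ P ≤ Q
  pb_imp : ∀ {X Y : C} (f : Y ⟶ X) (P Q : PropL X), pb f (imp P Q) = imp (pb f P) (pb f Q)
  all : ∀ {X : C} (A : Ty X), PropL (ext A) → PropL X
  le_all : ∀ {X : C} (A : Ty X) (P : PropL (ext A)) (R : PropL X),
    R ≤ all A P ↔ pb (p A) R ≤ P
  pb_all : ∀ {X Y : C} (f : Y ⟶ X) (A : Ty X) (P : PropL (ext A)),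
    pb f (all A P) = all (sT f A) (pb (toCwF.lift A f) P)
  ex : ∀ {X : C} (A : Ty X), PropL (ext A) → PropL X
  ex_le : ∀ {X : C} (A : Ty X) (P : PropL (ext A)) (R : PropL X),
    ex A P ≤ R ↔ P ≤ pb (p A) R
  pb_ex : ∀ {X Y : C} (f : Y ⟶ X) (A : Ty X) (P : PropL (ext A)),
    pb f (ex A P) = ex (sT f A) (pb (toCwF.lift A f) P)
  /-- least and greatest fixed points of monotone operators, stable under reindexing -/
  mu : ∀ {X : C}, StableOp X → PropL X
  mu_fold : ∀ {X : C} (F : StableOp X), F.app (𝟙 X) (mu F) ≤ mu F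
  mu_least : ∀ {X Y : C} (F : StableOp X) (f : Y ⟶ X) (Q : PropL Y), F.app f Q ≤ Q →
    pb f (mu F) ≤ Q
  nu : ∀ {X : C}, StableOp X → PropL X
  nu_out : ∀ {X : C} (F : StableOp X), nu F ≤ F.app (𝟙 X) (nu F)
  nu_greatest : ∀ {X Y : C} (F : StableOp X) (f : Y ⟶ X) (Q : PropL Y), Q ≤ F.app f Q →
    Q ≤ pb f (nu F)
  /-- universes of the constructive layer: presheaves `UL i` with universal families `el i` -/
  UL : ℕ → Tfᵒᵖ ⥤ C
  EL : ℕ → Tfᵒᵖ ⥤ C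
  el : ∀ i, EL i ⟶ UL i
  /-- names of the types of the constructive layer -/
  ulCode : ∀ i, (Functor.const Tfᵒᵖ).obj (⊤_ C) ⟶ UL (i + 1)
  ulCode_is : ∀ i, IsCode (el (i + 1)) (clL (UL i) (⊤_ C)) (ulCode i)
  propCode : (Functor.const Tfᵒᵖ).obj (⊤_ C) ⟶ UL 0
  propCode_is : IsCode (el 0) (constL Tf ((Over.star (⊤_ C)).obj Ω.Ω)) propCode
  kfCode : ∀ {X : C}, toCompModel.Tr X → ((Functor.const Tfᵒᵖ).obj X ⟶ UL 0)
  kfCode_is : ∀ {X : C} (τ : toCompModel.Tr X),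
    IsCode (el 0) (constL Tf (toKnowModel.kfObj τ)) (kfCode τ)
  kfCode_nat : ∀ {X Y : C} (f : Y ⟶ X) (τ : toCompModel.Tr X),
    kfCode (τ.sub f) = (Functor.const Tfᵒᵖ).map f ≫ kfCode τ
  kinfCode : ∀ {X : C} (π : Tm X), toCwF.Is π InfT → ((Functor.const Tfᵒᵖ).obj X ⟶ UL 0)
  kinfCode_is : ∀ {X : C} (π : Tm X) (h : toCwF.Is π InfT),
    IsCode (el 0) (constL Tf (toKnowModel.kinfObj π h)) (kinfCode π h)
  kinfCode_nat : ∀ {X Y : C} (f : Y ⟶ X) (π : Tm X) (h : toCwF.Is π InfT),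
    kinfCode (sM f π) (h.sub f) = (Functor.const Tfᵒᵖ).map f ≫ kinfCode π h
  prfCode : ∀ {X : C}, PropL X → ((Functor.const Tfᵒᵖ).obj X ⟶ UL 0)
  prfCode_is : ∀ {X : C} (P : PropL X), IsCode (el 0) (constL Tf (Over.mk P.arrow)) (prfCode P)
  prfCode_nat : ∀ {X Y : C} (f : Y ⟶ X) (P : PropL X),
    prfCode (pb f P) = (Functor.const Tfᵒᵖ).map f ≫ prfCode P

namespace Model

variable {C : Type u} [Category.{v} C] [HasFiniteLimits C] [HasLimitsOfShape ℕᵒᵖ C]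
  {Tf : Type z} [SmallCategory Tf] (M : Model.{u, v, w, z} C Tf)

/-! ### Interpretation of the propositional layer -/

/-- `m` is the least fixed point of the partial operator `F`. -/
def IsLfp {X : C} (F : PropL X → Option (PropL X)) (m : PropL X) : Prop :=
  F m = some m ∧ ∀ Q Q', F Q = some Q' → Q' ≤ Q → m ≤ Q

/-- `m` is the greatest fixed point of the partial operator `F`. -/
def IsGfp {X : C} (F : PropL X → Option (PropL X)) (m : PropL X) : Prop :=
  F m = some m ∧ ∀ Q Q', F Q = some Q' → Q ≤ Q' → Q ≤ m

open Classical in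
/-- The (partial) interpretation of raw propositions as subobjects, where `env` and `ρ` list the
values of the computational and of the propositional variables. -/
def interpP : Prp → (X : C) → List (M.Tm X) → List (PropL X) → Option (PropL X)
  | .pvar k, _, _, ρ => ρ[k]?
  | .top, _, _, _ => some ⊤
  | .bot, X, _, _ => some (M.bot X)
  | .and P Q, X, env, ρ =>
      (interpP P X env ρ).bind fun P' => (interpP Q X env ρ).map fun Q' => P' ⊓ Q'
  | .or P Q, X, env, ρ =>
      (interpP P X env ρ).bind fun P' => (interpP Q X env ρ).map fun Q' => M.sup P' Q'
  | .imp P Q, X, env, ρ =>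
      (interpP P X env ρ).bind fun P' => (interpP Q X env ρ).map fun Q' => M.imp P' Q'
  | .all A P, X, env, ρ => (M.interpTy A X env).bind fun A' =>
      (interpP P (M.ext A') (M.push A' env) (ρ.map (pb (M.p A')))).map (M.all A')
  | .ex A P, X, env, ρ => (M.interpTy A X env).bind fun A' =>
      (interpP P (M.ext A') (M.push A' env) (ρ.map (pb (M.p A')))).map (M.ex A')
  | .mu P, X, env, ρ =>
      if h : ∃ m, IsLfp (fun Q => interpP P X env (Q :: ρ)) m then some h.choose else none
  | .nu P, X, env, ρ =>
      if h : ∃ m, IsGfp (fun Q => interpP P X env (Q :: ρ)) m then some h.choose else none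

/-! ### Interpretation of the constructive layer -/

/-- `K_f(τ)` in the context `X`. -/
abbrev kfTy {X : C} (τ : M.Tr X) : TyL Tf X := constL Tf (M.kfObj τ)

/-- The type of propositions in the context `X`. -/
abbrev propTy (X : C) : TyL Tf X := constL Tf ((Over.star X).obj M.Ω.Ω)

/-- A proposition as the type of its proofs. -/
abbrev prfTy {X : C} (P : PropL X) : TyL Tf X := constL Tf (Over.mk P.arrow)

open Classical in
/-- The (partial) interpretation of types of the constructive layer. -/
def interpLTy (B : LTy) (X : C) (env : List (M.Tm X)) (ρ : List (PropL X)) : Option (TyL Tf X) :=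
  match B with
  | .univ i => some (clL (M.UL i) X)
  | .prop => some (M.propTy X)
  | .kf τ => (M.interp τ X env).bind fun t =>
      if h : M.Is t M.FinT then some (M.kfTy ⟨t, h⟩) else none
  | .kinf π => (M.interp π X env).bind fun t =>
      if h : M.Is t M.InfT then some (constL Tf (M.kinfObj t h)) else none
  | .prf P => (M.interpP P X env ρ).map fun P' => prfTy P'

open Classical in
/-- The (partial) interpretation of types of the constructive layer as elements of a universe. -/
def interpCode (B : LTy) (X : C) (env : List (M.Tm X)) (ρ : List (PropL X)) :
    Option ((Functor.const Tfᵒᵖ).obj X ⟶ M.UL B.level) :=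
  match B with
  | .univ i => some ((Functor.const Tfᵒᵖ).map (terminal.from X) ≫ M.ulCode i)
  | .prop => some ((Functor.const Tfᵒᵖ).map (terminal.from X) ≫ M.propCode)
  | .kf τ => (M.interp τ X env).bind fun t =>
      if h : M.Is t M.FinT then some (M.kfCode ⟨t, h⟩) else none
  | .kinf π => (M.interp π X env).bind fun t =>
      if h : M.Is t M.InfT then some (M.kinfCode t h) else none
  | .prf P => (M.interpP P X env ρ).map fun P' => M.prfCode P'

open Classical in
/-- The proof of a proposition, if it has one. It is unique, as `Over.mk P.arrow` is a subobject of
the terminal object of `C/X`. -/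
def proof (Tf : Type z) [SmallCategory Tf] {X : C} (P : PropL X) :
    Option (Σ B : TyL Tf X, TmL B) :=
  if h : Nonempty (TmL (prfTy (Tf := Tf) P)) then some ⟨_, h.some⟩ else none

open Classical in
/-- The (partial) interpretation of terms of the constructive layer, where `θ` lists the values of
the constructive variables. -/
def interpL : LTm → (X : C) → List (M.Tm X) → List (PropL X) →
    List (Σ B : TyL Tf X, TmL B) → Option (Σ B : TyL Tf X, TmL B)
  | .var k, _, _, _, θ => θ[k]?
  | .ty B, X, env, ρ, _ =>
      (M.interpCode B X env ρ).map fun a => ⟨clL (M.UL B.level) X, clSec a⟩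
  | .prp P, X, env, ρ, _ => (M.interpP P X env ρ).map fun P' =>
      ⟨M.propTy X, (Functor.const Tfᵒᵖ).map (starSec (M.Ω.χ P'.arrow))⟩
  | .restrict τ τ' ε k, X, env, ρ, θ =>
      (M.interp τ X env).bind fun t => (M.interp τ' X env).bind fun t' =>
      (M.interp ε X env).bind fun e => (interpL k X env ρ θ).bind fun κ =>
        if ht : M.Is t M.FinT then
          if ht' : M.Is t' M.FinT then
            if he : M.tp e = M.Ext t t' then
              if hk : κ.1 = M.kfTy ⟨t', ht'⟩ then
                some ⟨M.kfTy ⟨t, ht⟩, κ.2 ≫ eqToHom hk ≫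
                  (Functor.const Tfᵒᵖ).map ((M.kf X).map (Quiver.Hom.op
                    (CompModel.Tr.Hom.mk e he : (⟨t, ht⟩ : M.Tr X) ⟶ ⟨t', ht'⟩)))⟩
              else none
            else none
          else none
        else none
  | .fold φ, X, env, ρ, _ =>
      (M.interpP (.imp (φ.pinst (.mu φ)) (.mu φ)) X env ρ).bind (proof Tf)
  | .unfold φ, X, env, ρ, _ =>
      (M.interpP (.imp (.mu φ) (φ.pinst (.mu φ))) X env ρ).bind (proof Tf)
  | .nuIn ψ, X, env, ρ, _ =>
      (M.interpP (.imp (ψ.pinst (.nu ψ)) (.nu ψ)) X env ρ).bind (proof Tf)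
  | .nuOut ψ, X, env, ρ, _ =>
      (M.interpP (.imp (.nu ψ) (ψ.pinst (.nu ψ))) X env ρ).bind (proof Tf)
  | .mp P Q f p, X, env, ρ, θ =>
      (M.interpP P X env ρ).bind fun P' => (M.interpP Q X env ρ).bind fun Q' =>
      (interpL f X env ρ θ).bind fun f' => (interpL p X env ρ θ).bind fun p' =>
        if f'.1 = prfTy (M.imp P' Q') ∧ p'.1 = prfTy P' then proof Tf Q' else none

/-- `θ` assigns to the constructive variables declared in `Θ` terms of their types. -/
def Interprets (Θ : List LTy) (X : C) (env : List (M.Tm X)) (ρ : List (PropL X))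
    (θ : List (Σ B : TyL Tf X, TmL B)) : Prop :=
  List.Forall₂ (fun B b => M.interpLTy B X env ρ = some b.1) Θ θ

end Model

end

end NMDEKL

open NMDEKL

namespace NMDEKL

noncomputable section

set_option linter.unusedSectionVars false

/-! ## Categories with families -/

namespace CwF

variable {C : Type u} [Category.{v} C] (W : CwF.{u, v, w} C)

theorem pair_congr {X Y : C} {A : W.Ty X} {f f' : Y ⟶ X} {t t' : W.Tm Y} (hf : f = f')
    (ht : t = t') (h : W.tp t = W.sT f A) (h' : W.tp t' = W.sT f' A) :
    W.pair A f t h = W.pair A f' t' h' := by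
  subst hf ht; rfl

theorem comp_pair {X Y Z : C} (g : Z ⟶ Y) (A : W.Ty X) (f : Y ⟶ X) (t : W.Tm Y)
    (h : W.tp t = W.sT f A) :
    g ≫ W.pair A f t h =
      W.pair A (g ≫ f) (W.sM g t) (by rw [W.tp_sM, h, W.sT_comp]) := by
  apply W.ext_hom
  · rw [Category.assoc, W.pair_p, W.pair_p]
  · rw [W.sM_comp, W.pair_q, W.pair_q]

theorem lift_q {X Y : C} (A : W.Ty X) (f : Y ⟶ X) : W.sM (W.lift A f) (W.q A) = W.q _ :=
  W.pair_q _ _ _ _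

theorem sec_q {X : C} (A : W.Ty X) (a : W.Tm X) (h : W.tp a = A) :
    W.sM (W.sec A a h) (W.q A) = a := W.pair_q _ _ _ _

theorem sT_sec_p {X : C} (A : W.Ty X) (a : W.Tm X) (h : W.tp a = A) (B : W.Ty X) :
    W.sT (W.sec A a h) (W.sT (W.p A) B) = B := by
  rw [← W.sT_comp, W.sec_p, W.sT_id]

theorem tp_sM_of {X Y : C} (f : Y ⟶ X) {t : W.Tm X} {A : W.Ty X} (h : W.tp t = A) :
    W.tp (W.sM f t) = W.sT f A := by rw [W.tp_sM, h]

theorem comp_sec {X Y : C} (f : Y ⟶ X) (A : W.Ty X) (a : W.Tm X) (h : W.tp a = A) :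
    f ≫ W.sec A a h = W.pair A f (W.sM f a) (W.tp_sM_of f h) := by
  rw [sec, comp_pair]
  exact W.pair_congr (Category.comp_id f) rfl _ _

theorem sec_lift {X Y : C} (f : Y ⟶ X) (A : W.Ty X) (a : W.Tm Y) (h : W.tp a = W.sT f A) :
    W.sec (W.sT f A) a h ≫ W.lift A f = W.pair A f a h := by
  rw [lift, comp_pair]
  exact W.pair_congr (by rw [← Category.assoc, sec_p, Category.id_comp]) (W.sec_q _ _ _) _ _

theorem sec_sM_lift {X Y : C} (f : Y ⟶ X) (A : W.Ty X) (a : W.Tm X) (h : W.tp a = A) :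
    W.sec (W.sT f A) (W.sM f a) (W.tp_sM_of f h) ≫ W.lift A f = f ≫ W.sec A a h := by
  rw [sec_lift, comp_sec]

theorem pair_p_q {X : C} (A : W.Ty X) : W.pair A (W.p A) (W.q A) (W.tp_q A) = 𝟙 _ := by
  apply W.ext_hom
  · rw [W.pair_p, Category.id_comp]
  · rw [W.pair_q, W.sM_id]

theorem lift_comp_pair {X Y : C} (f : Y ⟶ X) (A : W.Ty X) (r : W.Tm (W.ext A))
    (hr : W.tp r = W.sT (W.p A) A) :
    W.lift A f ≫ W.pair A (W.p A) r hr =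
      W.pair (W.sT f A) (W.p _) (W.sM (W.lift A f) r)
        (by rw [W.tp_sM, hr, ← W.sT_comp, lift_p, W.sT_comp]) ≫ W.lift A f := by
  apply W.ext_hom
  · rw [Category.assoc, Category.assoc, W.pair_p]
    simp only [lift_p]
    rw [← Category.assoc, W.pair_p]
  · rw [W.sM_comp, W.sM_comp, W.pair_q, lift_q, W.pair_q]

theorem lift₂_p {X Y : C} (A : W.Ty X) (f : Y ⟶ X) :
    W.lift₂ A f ≫ W.p _ = W.p _ ≫ W.lift A f := W.pair_p _ _ _ _

theorem lift₂_q {X Y : C} (A : W.Ty X) (f : Y ⟶ X) :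
    W.sM (W.lift₂ A f) (W.q _) = W.q _ := W.pair_q _ _ _ _

theorem sec₂_p {X : C} (A : W.Ty X) (a b : W.Tm X) (ha : W.tp a = A) (hb : W.tp b = A) :
    W.sec₂ A a b ha hb ≫ W.p _ = W.sec A a ha := W.pair_p _ _ _ _

theorem sec₂_q {X : C} (A : W.Ty X) (a b : W.Tm X) (ha : W.tp a = A) (hb : W.tp b = A) :
    W.sM (W.sec₂ A a b ha hb) (W.q _) = b := W.pair_q _ _ _ _

theorem sec₂_lift₂ {X Y : C} (f : Y ⟶ X) (A : W.Ty X) (a b : W.Tm X) (ha : W.tp a = A)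
    (hb : W.tp b = A) :
    W.sec₂ (W.sT f A) (W.sM f a) (W.sM f b) (W.tp_sM_of f ha) (W.tp_sM_of f hb) ≫ W.lift₂ A f =
      f ≫ W.sec₂ A a b ha hb := by
  apply W.ext_hom
  · rw [Category.assoc, Category.assoc, lift₂_p, sec₂_p, ← Category.assoc, sec₂_p, sec_sM_lift]
  · rw [W.sM_comp, W.sM_comp, lift₂_q, sec₂_q, sec₂_q]

theorem sec_diag {X : C} (A : W.Ty X) (a : W.Tm X) (h : W.tp a = A) :
    W.sec A a h ≫ W.diag A = W.sec₂ A a a h h := by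
  rw [diag, comp_pair]
  exact W.pair_congr (Category.comp_id _) (W.sec_q _ _ _) _ _

/-- The diagonal is natural in the context. -/
theorem lift_diag {X Y : C} (f : Y ⟶ X) (A : W.Ty X) :
    W.lift A f ≫ W.diag A = W.diag (W.sT f A) ≫ W.lift₂ A f := by
  apply W.ext_hom
  · rw [Category.assoc, Category.assoc, lift₂_p, diag, W.pair_p, Category.comp_id, diag,
      ← Category.assoc, W.pair_p, Category.id_comp]
  · rw [W.sM_comp, W.sM_comp, lift₂_q, diag, W.pair_q, lift_q, diag, W.pair_q]

/-- In the context `X.A.A`, the map given by its two generic elements of type `A` is the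
identity. -/
theorem generic_sec₂_lift₂ {X : C} (A : W.Ty X) (h₁ h₂) :
    W.sec₂ (W.sT (W.p (W.sT (W.p A) A) ≫ W.p A) A) (W.sM (W.p _) (W.q A)) (W.q _) h₁ h₂ ≫
      W.lift₂ A _ = 𝟙 _ := by
  apply W.ext_hom
  · rw [Category.assoc, lift₂_p, ← Category.assoc, sec₂_p, Category.id_comp]
    apply W.ext_hom
    · rw [Category.assoc, lift_p, ← Category.assoc, sec_p, Category.id_comp]
    · rw [W.sM_comp, lift_q, sec_q]
  · rw [W.sM_comp, lift₂_q, sec₂_q, W.sM_id]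

theorem map_push_pair {X Y : C} (A : W.Ty X) (f : Y ⟶ X) (t : W.Tm Y) (h : W.tp t = W.sT f A)
    (env : List (W.Tm X)) :
    (W.push A env).map (W.sM (W.pair A f t h)) = t :: env.map (W.sM f) := by
  simp only [push, List.map_cons, W.pair_q, List.map_map, List.cons.injEq, true_and]
  refine List.map_congr_left fun x _ => ?_
  rw [Function.comp_apply, ← W.sM_comp, W.pair_p]

theorem map_sM_id {X : C} (env : List (W.Tm X)) : env.map (W.sM (𝟙 X)) = env := by
  conv_rhs => rw [← List.map_id env]
  exact List.map_congr_left fun x _ => W.sM_id x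

theorem map_sM_comp {X Y Z : C} (g : Z ⟶ Y) (f : Y ⟶ X) (env : List (W.Tm X)) :
    env.map (W.sM (g ≫ f)) = (env.map (W.sM f)).map (W.sM g) := by
  rw [List.map_map]
  exact List.map_congr_left fun x _ => W.sM_comp g f x

theorem map_push_lift {X Y : C} (A : W.Ty X) (f : Y ⟶ X) (env : List (W.Tm X)) :
    (W.push A env).map (W.sM (W.lift A f)) = W.push (W.sT f A) (env.map (W.sM f)) := by
  rw [lift, map_push_pair, push, ← map_sM_comp]

theorem map_push_sec {X : C} (A : W.Ty X) (a : W.Tm X) (h : W.tp a = A) (env : List (W.Tm X)) :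
    (W.push A env).map (W.sM (W.sec A a h)) = a :: env := by
  rw [sec, map_push_pair, map_sM_id]

end CwF

/-! ## Naturality of the operations of a computational model -/

namespace CompModel

variable {C : Type u} [Category.{v} C] [HasTerminal C] (M : CompModel.{u, v, w} C)

theorem code_eq {X : C} {i : ℕ} {c : M.Tm X} {A : M.Ty X} (hc : M.Is c (M.U i))
    (hA : M.El c = A) : M.code (M.cl X (M.U i)) A = some c := by
  have h : ∃ c : M.Tm X, M.tp c = M.cl X (M.U i) ∧ M.El c = A := ⟨c, hc, hA⟩
  rw [code, dif_pos h]
  exact congrArg some (M.El_inj _ _ i h.choose_spec.1 hc (h.choose_spec.2.trans hA.symm))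

theorem code_spec {X : C} {V A : M.Ty X} {c : M.Tm X} (h : M.code V A = some c) :
    M.tp c = V ∧ M.El c = A := by
  rw [code] at h
  split_ifs at h with h'
  cases h
  exact h'.choose_spec

theorem asTy_eq_some {X : C} {a : M.Tm X} {A : M.Ty X} :
    M.asTy a = some A ↔ (∃ i, M.Is a (M.U i)) ∧ M.El a = A := by
  rw [asTy]
  split_ifs with h <;> simp [h]

theorem interpTy_eq_some {A : Term} {X : C} {env : List (M.Tm X)} {A' : M.Ty X} :
    M.interpTy A X env = some A' ↔
      ∃ a i, M.interp A X env = some a ∧ M.Is a (M.U i) ∧ M.El a = A' := by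
  simp only [interpTy, Option.bind_eq_some_iff, asTy_eq_some]
  constructor
  · rintro ⟨a, h, ⟨i, hi⟩, hA⟩
    exact ⟨a, i, h, hi, hA⟩
  · rintro ⟨a, i, h, hi, hA⟩
    exact ⟨a, h, ⟨i, hi⟩, hA⟩

section Pi

variable {X : C} {A : M.Ty X} {B : M.Ty (M.ext A)}

theorem tp_unlam {g : M.Tm X} (h : M.tp g = M.Pi A B) : M.tp (M.unlam A B g h) = B :=
  (M.lam_bij A B g h).choose_spec.1.1

theorem lam_unlam {g : M.Tm X} (h : M.tp g = M.Pi A B) : M.lam A (M.unlam A B g h) = g :=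
  (M.lam_bij A B g h).choose_spec.1.2

theorem unlam_eq {g : M.Tm X} (h : M.tp g = M.Pi A B) {b : M.Tm (M.ext A)} (hb : M.tp b = B)
    (hg : M.lam A b = g) : M.unlam A B g h = b :=
  ((M.lam_bij A B g h).choose_spec.2 b ⟨hb, hg⟩).symm

theorem sM_unlam {Y : C} (f : Y ⟶ X) {g : M.Tm X} (h : M.tp g = M.Pi A B) (h') :
    M.sM (M.lift A f) (M.unlam A B g h) =
      M.unlam (M.sT f A) (M.sT (M.lift A f) B) (M.sM f g) h' :=
  (M.unlam_eq _ (M.tp_sM_of _ (M.tp_unlam h)) (by rw [← M.lam_nat, lam_unlam])).symm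

end Pi

section Sigma

variable {X : C} {A : M.Ty X} {B : M.Ty (M.ext A)}

theorem tp_mkPair {a b : M.Tm X} (ha : M.tp a = A) (hb : M.tp b = M.sT (M.sec A a ha) B) :
    M.tp (M.mkPair A B a b ha hb) = M.Sig A B := by
  rw [mkPair, M.tp_sM, M.tp_mkGen, ← M.sT_comp, ← Category.assoc, M.pair_p, M.sec_p, M.sT_id]

theorem unpair_mkPair {a b : M.Tm X} (ha : M.tp a = A) (hb : M.tp b = M.sT (M.sec A a ha) B) (h) :
    M.unpair A B (M.mkPair A B a b ha hb) h = M.pair B (M.sec A a ha) b hb :=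
  ((M.mkGen_bij A B _ h).choose_spec.2 _
    ⟨by rw [← Category.assoc, M.pair_p, M.sec_p], rfl⟩).symm

theorem exists_mkPair {t : M.Tm X} (h : M.tp t = M.Sig A B) :
    ∃ (a b : M.Tm X) (ha : M.tp a = A) (hb : M.tp b = M.sT (M.sec A a ha) B),
      t = M.mkPair A B a b ha hb := by
  obtain ⟨h₁, h₂⟩ := (M.mkGen_bij A B t h).choose_spec.1
  set g := (M.mkGen_bij A B t h).choose
  have ha : M.tp (M.sM (g ≫ M.p B) (M.q A)) = A := by
    rw [M.tp_sM, M.tp_q, ← M.sT_comp, Category.assoc, h₁, M.sT_id]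
  have hs : M.sec A _ ha = g ≫ M.p B := by
    apply M.ext_hom
    · rw [M.sec_p, Category.assoc, h₁]
    · rw [M.sec_q]
  have hb : M.tp (M.sM g (M.q B)) = M.sT (M.sec A _ ha) B := by
    rw [M.tp_sM, M.tp_q, hs, M.sT_comp]
  refine ⟨_, _, ha, hb, ?_⟩
  rw [mkPair, ← h₂]
  congr 1
  apply M.ext_hom
  · rw [M.pair_p, hs]
  · rw [M.pair_q]

theorem fst_mkPair {a b : M.Tm X} (ha : M.tp a = A) (hb : M.tp b = M.sT (M.sec A a ha) B) (h) :
    M.sM (M.unpair A B (M.mkPair A B a b ha hb) h ≫ M.p B) (M.q A) = a := by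
  rw [unpair_mkPair, M.pair_p, M.sec_q]

theorem snd_mkPair {a b : M.Tm X} (ha : M.tp a = A) (hb : M.tp b = M.sT (M.sec A a ha) B) (h) :
    M.sM (M.unpair A B (M.mkPair A B a b ha hb) h) (M.q B) = b := by
  rw [unpair_mkPair, M.pair_q]

theorem mkPair_congr {A' : M.Ty X} {B' : M.Ty (M.ext A')} {a b a' b' : M.Tm X} (hA : A = A')
    (hB : B ≍ B') (h₁ : a = a') (h₂ : b = b') (ha hb ha' hb') :
    M.mkPair A B a b ha hb = M.mkPair A' B' a' b' ha' hb' := by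
  subst hA h₁ h₂
  cases hB
  rfl

theorem tp_sM_sec {Y : C} (f : Y ⟶ X) {a b : M.Tm X} (ha : M.tp a = A)
    (hb : M.tp b = M.sT (M.sec A a ha) B) :
    M.tp (M.sM f b) =
      M.sT (M.sec (M.sT f A) (M.sM f a) (M.tp_sM_of f ha)) (M.sT (M.lift A f) B) := by
  rw [M.tp_sM, hb, ← M.sT_comp, ← M.sT_comp, M.sec_sM_lift]

theorem sM_mkPair {Y : C} (f : Y ⟶ X) {a b : M.Tm X} (ha : M.tp a = A)
    (hb : M.tp b = M.sT (M.sec A a ha) B) :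
    M.sM f (M.mkPair A B a b ha hb) = M.mkPair (M.sT f A) (M.sT (M.lift A f) B)
      (M.sM f a) (M.sM f b) (M.tp_sM_of f ha) (M.tp_sM_sec f ha hb) := by
  rw [mkPair, mkPair, ← M.mkGen_nat, ← M.sM_comp, ← M.sM_comp]
  congr 1
  apply M.ext_hom
  · rw [Category.assoc, Category.assoc, M.pair_p, M.lift_p, ← Category.assoc, M.pair_p,
      M.sec_sM_lift]
  · rw [M.sM_comp, M.sM_comp, M.pair_q, M.lift_q, M.pair_q]

end Sigma

section Id

variable {X Y : C} {A : M.Ty X}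

theorem sT_idAt (f : Y ⟶ X) {a b : M.Tm X} (ha : M.tp a = A) (hb : M.tp b = A) :
    M.sT f (M.idAt A a b ha hb) =
      M.idAt (M.sT f A) (M.sM f a) (M.sM f b) (M.tp_sM_of f ha) (M.tp_sM_of f hb) := by
  rw [idAt, idAt, ← M.IdT_nat, ← M.sT_comp, ← M.sT_comp, M.sec₂_lift₂]

theorem idAt_congr {A' : M.Ty X} {a b a' b' : M.Tm X} (hA : A = A') (h₁ : a = a') (h₂ : b = b')
    (ha hb ha' hb') : M.idAt A a b ha hb = M.idAt A' a' b' ha' hb' := by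
  subst hA h₁ h₂
  rfl

theorem tp_sec_rflGen {a : M.Tm X} (ha : M.tp a = A) :
    M.tp (M.sM (M.sec A a ha) (M.rflGen A)) = M.idAt A a a ha ha := by
  rw [M.tp_sM, M.tp_rflGen, ← M.sT_comp, M.sec_diag, idAt]

theorem sM_sec_rflGen (f : Y ⟶ X) {a : M.Tm X} (ha : M.tp a = A) :
    M.sM f (M.sM (M.sec A a ha) (M.rflGen A)) =
      M.sM (M.sec (M.sT f A) (M.sM f a) (M.tp_sM_of f ha)) (M.rflGen (M.sT f A)) := by
  rw [← M.rflGen_nat, ← M.sM_comp, ← M.sM_comp, M.sec_sM_lift]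

/-- The identity type of the two generic elements of `A` is the generic identity type. -/
theorem idAt_generic (A : M.Ty X) (h₁ h₂) :
    M.idAt (M.sT (M.p (M.sT (M.p A) A) ≫ M.p A) A) (M.sM (M.p _) (M.q A)) (M.q _) h₁ h₂ =
      M.IdT A := by
  rw [idAt, ← M.IdT_nat, ← M.sT_comp, M.generic_sec₂_lift₂, M.sT_id]

theorem refl_generic (A : M.Ty X) (h) :
    M.sM (M.sec (M.sT (M.p A) A) (M.q A) h) (M.rflGen (M.sT (M.p A) A)) = M.rflGen A := by
  rw [← M.rflGen_nat, ← M.sM_comp, M.sec_lift, M.pair_p_q, M.sM_id]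

/-- The lift of `f : Y ⟶ X` to a map between the contexts of generic identity proofs. -/
def liftId (A : M.Ty X) (f : Y ⟶ X) : M.ext (M.IdT (M.sT f A)) ⟶ M.ext (M.IdT A) :=
  M.pair (M.IdT A) (M.p _ ≫ M.lift₂ A f) (M.q _)
    (by rw [M.tp_q, M.sT_comp, M.IdT_nat])

theorem liftId_p (A : M.Ty X) (f : Y ⟶ X) :
    M.liftId A f ≫ M.p (M.IdT A) = M.p _ ≫ M.lift₂ A f := M.pair_p _ _ _ _

theorem liftId_q (A : M.Ty X) (f : Y ⟶ X) : M.sM (M.liftId A f) (M.q (M.IdT A)) = M.q _ :=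
  M.pair_q _ _ _ _

/-- The map `X.A ⟶ X.A.A.Id` given by the generic reflexivity proof. -/
def reflMap (A : M.Ty X) : M.ext A ⟶ M.ext (M.IdT A) :=
  M.pair (M.IdT A) (M.diag A) (M.rflGen A) (M.tp_rflGen A)

theorem lift_reflMap (A : M.Ty X) (f : Y ⟶ X) :
    M.lift A f ≫ M.reflMap A = M.reflMap (M.sT f A) ≫ M.liftId A f := by
  apply M.ext_hom
  · rw [Category.assoc, Category.assoc, liftId_p, reflMap, M.pair_p, reflMap, ← Category.assoc,
      M.pair_p, M.lift_diag]
  · rw [M.sM_comp, M.sM_comp, liftId_q, reflMap, M.pair_q, reflMap, M.pair_q, M.rflGen_nat]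

theorem map_push_liftId (A : M.Ty X) (f : Y ⟶ X) (env : List (M.Tm X)) :
    (M.push (M.IdT A) (M.push (M.sT (M.p A) A) (M.push A env))).map (M.sM (M.liftId A f)) =
      M.push (M.IdT (M.sT f A)) (M.push (M.sT (M.p (M.sT f A)) (M.sT f A))
        (M.push (M.sT f A) (env.map (M.sM f)))) := by
  rw [liftId, M.map_push_pair, M.map_sM_comp, CwF.lift₂, M.map_push_pair, M.map_sM_comp,
    M.map_push_lift]
  rfl

/-- The map `X ⟶ X.A.A.Id` given by terms `a`, `b` and a proof `e` of their identity. -/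
def idMap (A : M.Ty X) (a b e : M.Tm X) (ha : M.tp a = A) (hb : M.tp b = A)
    (he : M.tp e = M.idAt A a b ha hb) : X ⟶ M.ext (M.IdT A) :=
  M.pair (M.IdT A) (M.sec₂ A a b ha hb) e he

theorem idMap_p {a b e : M.Tm X} (ha : M.tp a = A) (hb : M.tp b = A)
    (he : M.tp e = M.idAt A a b ha hb) :
    M.idMap A a b e ha hb he ≫ M.p _ = M.sec₂ A a b ha hb := M.pair_p _ _ _ _

theorem idMap_q {a b e : M.Tm X} (ha : M.tp a = A) (hb : M.tp b = A)
    (he : M.tp e = M.idAt A a b ha hb) :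
    M.sM (M.idMap A a b e ha hb he) (M.q _) = e := M.pair_q _ _ _ _

theorem map_push_idMap {a b e : M.Tm X} (ha : M.tp a = A) (hb : M.tp b = A)
    (he : M.tp e = M.idAt A a b ha hb) (env : List (M.Tm X)) :
    (M.push (M.IdT A) (M.push (M.sT (M.p A) A) (M.push A env))).map
      (M.sM (M.idMap A a b e ha hb he)) = e :: b :: a :: env :=
  (M.map_push_pair _ _ _ _ _).trans
    (by rw [CwF.sec₂, M.map_push_pair, M.map_push_sec])

theorem map_push_reflMap (A : M.Ty X) (env : List (M.Tm X)) :
    (M.push (M.IdT A) (M.push (M.sT (M.p A) A) (M.push A env))).map (M.sM (M.reflMap A)) =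
      M.rflGen A :: M.q A :: M.push A env := by
  rw [reflMap, M.map_push_pair, CwF.diag, M.map_push_pair, M.map_sM_id]

theorem sM_J (f : Y ⟶ X) {D : M.Ty (M.ext (M.IdT A))} {d : M.Tm (M.ext A)}
    (h : M.tp d = M.sT (M.reflMap A) D) (h') :
    M.sM (M.liftId A f) (M.J A D d h) =
      M.J (M.sT f A) (M.sT (M.liftId A f) D) (M.sM (M.lift A f) d) h' :=
  M.J_nat f A D d h _ h' (M.liftId_p A f) (M.liftId_q A f)

theorem tp_sM_lift_reflMap (f : Y ⟶ X) {D : M.Ty (M.ext (M.IdT A))} {d : M.Tm (M.ext A)}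
    (h : M.tp d = M.sT (M.reflMap A) D) :
    M.tp (M.sM (M.lift A f) d) = M.sT (M.reflMap (M.sT f A)) (M.sT (M.liftId A f) D) := by
  rw [M.tp_sM, h, ← M.sT_comp, ← M.sT_comp, M.lift_reflMap]

theorem tp_sM_idAt (f : Y ⟶ X) {a b e : M.Tm X} (ha : M.tp a = A) (hb : M.tp b = A)
    (he : M.tp e = M.idAt A a b ha hb) :
    M.tp (M.sM f e) =
      M.idAt (M.sT f A) (M.sM f a) (M.sM f b) (M.tp_sM_of f ha) (M.tp_sM_of f hb) := by
  rw [M.tp_sM, he, M.sT_idAt]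

theorem idMap_liftId (f : Y ⟶ X) {a b e : M.Tm X} (ha : M.tp a = A) (hb : M.tp b = A)
    (he : M.tp e = M.idAt A a b ha hb) :
    M.idMap (M.sT f A) (M.sM f a) (M.sM f b) (M.sM f e) (M.tp_sM_of f ha) (M.tp_sM_of f hb)
        (M.tp_sM_idAt f ha hb he) ≫ M.liftId A f =
      f ≫ M.idMap A a b e ha hb he := by
  apply M.ext_hom
  · rw [Category.assoc, Category.assoc, liftId_p, ← Category.assoc, idMap_p, idMap_p,
      M.sec₂_lift₂]
  · rw [M.sM_comp, M.sM_comp, liftId_q, idMap_q, idMap_q]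

theorem sec_reflMap {a : M.Tm X} (ha : M.tp a = A) :
    M.sec A a ha ≫ M.reflMap A = M.idMap A a a (M.sM (M.sec A a ha) (M.rflGen A)) ha ha
      (M.tp_sec_rflGen ha) := by
  rw [reflMap, M.comp_pair]
  exact M.pair_congr (M.sec_diag _ _ _) rfl _ _

end Id

section Traces

variable {X Y : C} {A : M.Ty X}

theorem sM_tail (f : Y ⟶ X) {π : M.Tm X} (h : M.Is π M.InfT) :
    M.sM f (M.tail π h) = M.tail (M.sM f π) (h.sub f) := by
  refine (M.sM_mkPair f (M.evt_is π h) _).trans ?_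
  refine M.mkPair_congr (M.sT_cl _ _) ?_ (M.evt_nat f π h) (M.rest_nat f π h) _ _ _ _
  rw [M.sT_cl (M.lift _ f), M.sT_cl f]

variable {s e r : M.Tm (M.ext A)} (hs : M.Is s M.State) (he : M.Is e M.Event)
  (hr : M.tp r = M.sT (M.p A) A)

theorem corec_is : M.Is (M.corec A s e r hs he hr) M.InfT :=
  (M.InfT_final s e (M.pair A (M.p A) r hr) hs he).choose_spec.1.1

theorem head_corec : M.head (M.corec A s e r hs he hr) = s :=
  (M.InfT_final s e (M.pair A (M.p A) r hr) hs he).choose_spec.1.2.1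

theorem evt_corec : M.evt (M.corec A s e r hs he hr) = e :=
  (M.InfT_final s e (M.pair A (M.p A) r hr) hs he).choose_spec.1.2.2.1

theorem rest_corec : M.rest (M.corec A s e r hs he hr) =
    M.sM (M.pair A (M.p A) r hr) (M.corec A s e r hs he hr) :=
  (M.InfT_final s e (M.pair A (M.p A) r hr) hs he).choose_spec.1.2.2.2

theorem tp_sM_lift_p {r : M.Tm (M.ext A)} (hr : M.tp r = M.sT (M.p A) A) (f : Y ⟶ X) :
    M.tp (M.sM (M.lift A f) r) = M.sT (M.p (M.sT f A)) (M.sT f A) := by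
  rw [M.tp_sM, hr, ← M.sT_comp, M.lift_p, M.sT_comp]

theorem sM_corec (f : Y ⟶ X) :
    M.sM (M.lift A f) (M.corec A s e r hs he hr) =
      M.corec (M.sT f A) (M.sM (M.lift A f) s) (M.sM (M.lift A f) e) (M.sM (M.lift A f) r)
        (hs.sub _) (he.sub _) (M.tp_sM_lift_p hr f) := by
  have hc := M.corec_is hs he hr
  refine (M.InfT_final _ _ (M.pair _ (M.p _) _ (M.tp_sM_lift_p hr f)) (hs.sub _)
    (he.sub _)).choose_spec.2 _ ⟨hc.sub _, ?_, ?_, ?_⟩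
  · rw [← M.head_nat _ _ hc, head_corec]
  · rw [← M.evt_nat _ _ hc, evt_corec]
  · rw [← M.rest_nat _ _ hc, rest_corec, ← M.sM_comp, ← M.sM_comp, M.lift_comp_pair]

theorem sec_pair_p {a : M.Tm X} (ha : M.tp a = A) (h) :
    M.sec A a ha ≫ M.pair A (M.p A) r hr = M.sec A (M.sM (M.sec A a ha) r) h := by
  rw [M.comp_pair]
  exact M.pair_congr (M.sec_p _ _ _) rfl _ _

end Traces

end CompModel

namespace CompModel

variable {C : Type u} [Category.{v} C] [HasTerminal C] (M : CompModel.{u, v, w} C)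

/-! ## Values of the interpretation -/

section Values

variable {M} {X : C} {env : List (M.Tm X)}

theorem interp_pi {A B : Term} {a c : M.Tm X} {A' : M.Ty X} {b : M.Tm (M.ext A')} {i : ℕ}
    (hA : M.interp A X env = some a) (ha : M.Is a (M.U i)) (hA' : M.El a = A')
    (hB : M.interp B (M.ext A') (M.push A' env) = some b) (hb : M.Is b (M.U i))
    (hc : M.Is c (M.U i)) (hc' : M.El c = M.Pi A' (M.El b)) :
    M.interp (.pi A B) X env = some c := by
  subst hA'
  simp only [interp, hA, hB, Option.bind_some]
  rw [if_pos ⟨i, ha, hb⟩, ha, M.code_eq hc hc']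

theorem interp_sig {A B : Term} {a c : M.Tm X} {A' : M.Ty X} {b : M.Tm (M.ext A')} {i : ℕ}
    (hA : M.interp A X env = some a) (ha : M.Is a (M.U i)) (hA' : M.El a = A')
    (hB : M.interp B (M.ext A') (M.push A' env) = some b) (hb : M.Is b (M.U i))
    (hc : M.Is c (M.U i)) (hc' : M.El c = M.Sig A' (M.El b)) :
    M.interp (.sig A B) X env = some c := by
  subst hA'
  simp only [interp, hA, hB, Option.bind_some]
  rw [if_pos ⟨i, ha, hb⟩, ha, M.code_eq hc hc']

theorem interp_lam {A B t : Term} {A' : M.Ty X} {B' : M.Ty (M.ext A')} {b : M.Tm (M.ext A')}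
    (hA : M.interpTy A X env = some A')
    (hB : M.interpTy B (M.ext A') (M.push A' env) = some B')
    (ht : M.interp t (M.ext A') (M.push A' env) = some b) (hb : M.tp b = B') :
    M.interp (.lam A B t) X env = some (M.lam A' b) := by
  unfold interpTy at hA hB
  simp only [interp, hA, hB, ht, Option.bind_some]
  rw [if_pos hb]

theorem interp_app {A B f a : Term} {A' : M.Ty X} {B' : M.Ty (M.ext A')} {g x : M.Tm X}
    (hA : M.interpTy A X env = some A')
    (hB : M.interpTy B (M.ext A') (M.push A' env) = some B')
    (hf : M.interp f X env = some g) (ha : M.interp a X env = some x)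
    (hg : M.tp g = M.Pi A' B') (hx : M.tp x = A') :
    M.interp (.app A B f a) X env = some (M.sM (M.sec A' x hx) (M.unlam A' B' g hg)) := by
  unfold interpTy at hA hB
  simp only [interp, hA, hB, hf, ha, Option.bind_some]
  rw [dif_pos ⟨hg, hx⟩]

theorem interp_pair {A B a b : Term} {A' : M.Ty X} {B' : M.Ty (M.ext A')} {x y : M.Tm X}
    (hA : M.interpTy A X env = some A')
    (hB : M.interpTy B (M.ext A') (M.push A' env) = some B')
    (ha : M.interp a X env = some x) (hb : M.interp b X env = some y)
    (hx : M.tp x = A') (hy : M.tp y = M.sT (M.sec A' x hx) B') :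
    M.interp (.pair A B a b) X env = some (M.mkPair A' B' x y hx hy) := by
  unfold interpTy at hA hB
  simp only [interp, hA, hB, ha, hb, Option.bind_some]
  rw [dif_pos ⟨hx, hy⟩]

theorem interp_fst {A B t : Term} {A' : M.Ty X} {B' : M.Ty (M.ext A')} {x : M.Tm X}
    (hA : M.interpTy A X env = some A')
    (hB : M.interpTy B (M.ext A') (M.push A' env) = some B')
    (ht : M.interp t X env = some x) (hx : M.tp x = M.Sig A' B') :
    M.interp (.fst A B t) X env = some (M.sM (M.unpair A' B' x hx ≫ M.p B') (M.q A')) := by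
  unfold interpTy at hA hB
  simp only [interp, hA, hB, ht, Option.bind_some]
  rw [dif_pos hx]

theorem interp_snd {A B t : Term} {A' : M.Ty X} {B' : M.Ty (M.ext A')} {x : M.Tm X}
    (hA : M.interpTy A X env = some A')
    (hB : M.interpTy B (M.ext A') (M.push A' env) = some B')
    (ht : M.interp t X env = some x) (hx : M.tp x = M.Sig A' B') :
    M.interp (.snd A B t) X env = some (M.sM (M.unpair A' B' x hx) (M.q B')) := by
  unfold interpTy at hA hB
  simp only [interp, hA, hB, ht, Option.bind_some]
  rw [dif_pos hx]

theorem interp_fst_mkPair {A B t : Term} {A' : M.Ty X} {B' : M.Ty (M.ext A')} {x y : M.Tm X}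
    {hx : M.tp x = A'} {hy : M.tp y = M.sT (M.sec A' x hx) B'}
    (hA : M.interpTy A X env = some A')
    (hB : M.interpTy B (M.ext A') (M.push A' env) = some B')
    (ht : M.interp t X env = some (M.mkPair A' B' x y hx hy)) :
    M.interp (.fst A B t) X env = some x := by
  rw [interp_fst hA hB ht (M.tp_mkPair hx hy), M.fst_mkPair]

theorem interp_snd_mkPair {A B t : Term} {A' : M.Ty X} {B' : M.Ty (M.ext A')} {x y : M.Tm X}
    {hx : M.tp x = A'} {hy : M.tp y = M.sT (M.sec A' x hx) B'}
    (hA : M.interpTy A X env = some A')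
    (hB : M.interpTy B (M.ext A') (M.push A' env) = some B')
    (ht : M.interp t X env = some (M.mkPair A' B' x y hx hy)) :
    M.interp (.snd A B t) X env = some y := by
  rw [interp_snd hA hB ht (M.tp_mkPair hx hy), M.snd_mkPair]

theorem interp_idt {A a b : Term} {A' x y c : M.Tm X} {i : ℕ}
    (hA : M.interp A X env = some A') (ha : M.interp a X env = some x)
    (hb : M.interp b X env = some y) (hi : M.Is A' (M.U i)) (hx : M.tp x = M.El A')
    (hy : M.tp y = M.El A') (hc : M.Is c (M.U i))
    (hc' : M.El c = M.idAt (M.El A') x y hx hy) :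
    M.interp (.idt A a b) X env = some c := by
  simp only [interp, hA, ha, hb, Option.bind_some]
  rw [dif_pos ⟨⟨i, hi⟩, hx, hy⟩, hi, M.code_eq hc hc']

theorem interp_refl {A a : Term} {A' : M.Ty X} {x : M.Tm X}
    (hA : M.interpTy A X env = some A') (ha : M.interp a X env = some x) (hx : M.tp x = A') :
    M.interp (.refl A a) X env = some (M.sM (M.sec A' x hx) (M.rflGen A')) := by
  unfold interpTy at hA
  simp only [interp, hA, ha, Option.bind_some]
  rw [dif_pos hx]

theorem interp_idrec {A D d a b p : Term} {A' : M.Ty X} {D' : M.Ty (M.ext (M.IdT A'))}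
    {d' : M.Tm (M.ext A')} {x y e : M.Tm X} (hA : M.interpTy A X env = some A')
    (hD : M.interpTy D (M.ext (M.IdT A'))
      (M.push (M.IdT A') (M.push (M.sT (M.p A') A') (M.push A' env))) = some D')
    (hd : M.interp d (M.ext A') (M.push A' env) = some d')
    (ha : M.interp a X env = some x) (hb : M.interp b X env = some y)
    (hp : M.interp p X env = some e) (hd' : M.tp d' = M.sT (M.reflMap A') D')
    (hx : M.tp x = A') (hy : M.tp y = A') (he : M.tp e = M.idAt A' x y hx hy) :
    M.interp (.idrec A D d a b p) X env =
      some (M.sM (M.idMap A' x y e hx hy he) (M.J A' D' d' hd')) := by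
  unfold interpTy at hA hD
  simp only [interp, hA, hD, hd, ha, hb, hp, Option.bind_some]
  exact dif_pos ⟨hd', hx, hy, he⟩

theorem interp_stepT {s e s' : Term} {x y x' c : M.Tm X} (hs : M.interp s X env = some x)
    (he : M.interp e X env = some y) (hs' : M.interp s' X env = some x') (hx : M.Is x M.State)
    (hy : M.Is y M.Event) (hx' : M.Is x' M.State) (hc : M.Is c (M.U 0))
    (hc' : M.El c = M.StepT x y x') : M.interp (.stepT s e s') X env = some c := by
  simp only [interp, hs, he, hs', Option.bind_some]
  rw [if_pos ⟨hx, hy, hx'⟩, M.code_eq hc hc']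

theorem interp_nil {s : Term} {x : M.Tm X} (hs : M.interp s X env = some x)
    (hx : M.Is x M.State) : M.interp (.nil s) X env = some (M.nil x) := by
  simp only [interp, hs, Option.bind_some]
  rw [if_pos hx]

theorem interp_step {τ e s : Term} {t y x : M.Tm X} (hτ : M.interp τ X env = some t)
    (he : M.interp e X env = some y) (hs : M.interp s X env = some x) (ht : M.Is t M.FinT)
    (hy : M.Is y M.Event) (hx : M.Is x M.State) :
    M.interp (.step τ e s) X env = some (M.step t y x) := by
  simp only [interp, hτ, he, hs, Option.bind_some]
  rw [if_pos ⟨ht, hy, hx⟩]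

theorem interp_head {π : Term} {x : M.Tm X} (hπ : M.interp π X env = some x)
    (hx : M.Is x M.InfT) : M.interp (.head π) X env = some (M.head x) := by
  simp only [interp, hπ, Option.bind_some]
  rw [if_pos hx]

theorem interp_tail {π : Term} {x : M.Tm X} (hπ : M.interp π X env = some x)
    (hx : M.Is x M.InfT) : M.interp (.tail π) X env = some (M.tail x hx) := by
  simp only [interp, hπ, Option.bind_some]
  rw [dif_pos hx]

theorem interp_cofix {A s e r a : Term} {A' : M.Ty X} {s' e' r' : M.Tm (M.ext A')} {x : M.Tm X}
    (hA : M.interpTy A X env = some A')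
    (hs : M.interp s (M.ext A') (M.push A' env) = some s')
    (he : M.interp e (M.ext A') (M.push A' env) = some e')
    (hr : M.interp r (M.ext A') (M.push A' env) = some r')
    (ha : M.interp a X env = some x) (hs' : M.Is s' M.State) (he' : M.Is e' M.Event)
    (hr' : M.tp r' = M.sT (M.p A') A') (hx : M.tp x = A') :
    M.interp (.cofix A s e r a) X env =
      some (M.sM (M.sec A' x hx) (M.corec A' s' e' r' hs' he' hr')) := by
  unfold interpTy at hA
  simp only [interp, hA, hs, he, hr, ha, Option.bind_some]
  rw [dif_pos ⟨⟨hs', he'⟩, hr', hx⟩]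

theorem interp_ext {τ τ' : Term} {t t' c : M.Tm X} (hτ : M.interp τ X env = some t)
    (hτ' : M.interp τ' X env = some t') (ht : M.Is t M.FinT) (ht' : M.Is t' M.FinT)
    (hc : M.Is c (M.U 0)) (hc' : M.El c = M.Ext t t') :
    M.interp (.ext τ τ') X env = some c := by
  simp only [interp, hτ, hτ', Option.bind_some]
  rw [if_pos ⟨ht, ht'⟩, M.code_eq hc hc']

theorem interp_extId {τ : Term} {t : M.Tm X} (hτ : M.interp τ X env = some t)
    (ht : M.Is t M.FinT) : M.interp (.extId τ) X env = some (M.eid t) := by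
  simp only [interp, hτ, Option.bind_some]
  rw [if_pos ht]

theorem interp_extComp {τ τ' τ'' ε₁ ε₂ : Term} {t t' t'' x y : M.Tm X}
    (hτ : M.interp τ X env = some t) (hτ' : M.interp τ' X env = some t')
    (hτ'' : M.interp τ'' X env = some t'') (h₁ : M.interp ε₁ X env = some x)
    (h₂ : M.interp ε₂ X env = some y) (ht : M.Is t M.FinT) (ht' : M.Is t' M.FinT)
    (ht'' : M.Is t'' M.FinT) (hx : M.tp x = M.Ext t t') (hy : M.tp y = M.Ext t' t'') :
    M.interp (.extComp τ τ' τ'' ε₁ ε₂) X env = some (M.ecomp t t' t'' x y) := by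
  simp only [interp, hτ, hτ', hτ'', h₁, h₂, Option.bind_some]
  rw [if_pos ⟨⟨ht, ht', ht''⟩, hx, hy⟩]

end Values

/-! ## Reindexing -/

theorem code_sM {X Y : C} (f : Y ⟶ X) {i : ℕ} {A : M.Ty X} {A' : M.Ty Y} {c : M.Tm X}
    (h : M.code (M.cl X (M.U i)) A = some c) (hA : M.sT f A = A') :
    M.code (M.cl Y (M.U i)) A' = some (M.sM f c) := by
  obtain ⟨h₁, h₂⟩ := M.code_spec h
  have h₁ : M.Is c (M.U i) := h₁
  exact M.code_eq (h₁.sub f) (by rw [← M.El_nat f c i h₁, h₂, hA])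

theorem interpTy_sT_of {A : Term} {X Y : C} {f : Y ⟶ X} {env : List (M.Tm X)} {A' : M.Ty X}
    (ih : ∀ v, M.interp A X env = some v → M.interp A Y (env.map (M.sM f)) = some (M.sM f v))
    (h : M.interpTy A X env = some A') :
    M.interpTy A Y (env.map (M.sM f)) = some (M.sT f A') := by
  rw [interpTy_eq_some] at h ⊢
  obtain ⟨a, i, h, hi, hA⟩ := h
  exact ⟨_, i, ih a h, hi.sub f, by rw [← M.El_nat f a i hi, hA]⟩

/-- Interpretation commutes with reindexing along maps of contexts. -/
theorem interp_sM (t : Term) : ∀ {X Y : C} (f : Y ⟶ X) (env : List (M.Tm X)) (v : M.Tm X),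
    M.interp t X env = some v → M.interp t Y (env.map (M.sM f)) = some (M.sM f v) := by
  induction t with
  | var n =>
    intro X Y f env v h
    simp only [interp] at h ⊢
    rw [List.getElem?_map, h, Option.map_some]
  | univ i =>
    intro X Y f env v h
    simp only [interp] at h ⊢
    exact M.code_sM f h (M.sT_cl _ _)
  | state =>
    intro X Y f env v h
    simp only [interp] at h ⊢
    exact M.code_sM f h (M.sT_cl _ _)
  | event =>
    intro X Y f env v h
    simp only [interp] at h ⊢
    exact M.code_sM f h (M.sT_cl _ _)
  | nat =>
    intro X Y f env v h
    simp only [interp] at h ⊢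
    exact M.code_sM f h (M.sT_cl _ _)
  | finTrace =>
    intro X Y f env v h
    simp only [interp] at h ⊢
    exact M.code_sM f h (M.sT_cl _ _)
  | infTrace =>
    intro X Y f env v h
    simp only [interp] at h ⊢
    exact M.code_sM f h (M.sT_cl _ _)
  | pi A B ihA ihB =>
    intro X Y f env v h
    simp only [interp, Option.bind_eq_some_iff, Option.ite_none_right_eq_some] at h
    obtain ⟨a, hA, b, hB, ⟨i, ha, hb⟩, hv⟩ := h
    rw [ha] at hv
    obtain ⟨hv, hv'⟩ := M.code_spec hv
    have hv : M.Is v (M.U i) := hv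
    refine interp_pi (ihA f _ _ hA) (ha.sub f) (M.El_nat f a i ha).symm
      (b := M.sM (M.lift _ f) b) ?_ (hb.sub _) (hv.sub f) ?_
    · rw [← M.map_push_lift]
      exact ihB _ _ _ hB
    · rw [← M.El_nat f v i hv, hv', M.Pi_nat, M.El_nat _ b i hb]
  | sig A B ihA ihB =>
    intro X Y f env v h
    simp only [interp, Option.bind_eq_some_iff, Option.ite_none_right_eq_some] at h
    obtain ⟨a, hA, b, hB, ⟨i, ha, hb⟩, hv⟩ := h
    rw [ha] at hv
    obtain ⟨hv, hv'⟩ := M.code_spec hv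
    have hv : M.Is v (M.U i) := hv
    refine interp_sig (ihA f _ _ hA) (ha.sub f) (M.El_nat f a i ha).symm
      (b := M.sM (M.lift _ f) b) ?_ (hb.sub _) (hv.sub f) ?_
    · rw [← M.map_push_lift]
      exact ihB _ _ _ hB
    · rw [← M.El_nat f v i hv, hv', M.Sig_nat, M.El_nat _ b i hb]
  | lam A B t ihA ihB iht =>
    intro X Y f env v h
    rw [interp, Option.bind_eq_some_iff] at h
    obtain ⟨A', hA, h⟩ := h
    rw [Option.bind_eq_some_iff] at h
    obtain ⟨B', hB, h⟩ := h
    simp only [Option.bind_eq_some_iff, Option.ite_none_right_eq_some, Option.some.injEq] at h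
    obtain ⟨b, ht, hb, rfl⟩ := h
    rw [M.lam_nat]
    refine interp_lam (M.interpTy_sT_of (ihA f env) hA) (B' := M.sT (M.lift A' f) B') ?_ ?_
      (M.tp_sM_of _ hb)
    · rw [← M.map_push_lift]
      exact M.interpTy_sT_of (ihB _ _) hB
    · rw [← M.map_push_lift]
      exact iht _ _ _ ht
  | app A B g a ihA ihB ihg iha =>
    intro X Y f env v h
    rw [interp, Option.bind_eq_some_iff] at h
    obtain ⟨A', hA, h⟩ := h
    rw [Option.bind_eq_some_iff] at h
    obtain ⟨B', hB, h⟩ := h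
    simp only [Option.bind_eq_some_iff, Option.dite_none_right_eq_some, Option.some.injEq] at h
    obtain ⟨g', hg, x, hx, ⟨h₁, h₂⟩, rfl⟩ := h
    rw [← M.sM_comp, ← M.sec_sM_lift, M.sM_comp, M.sM_unlam f h₁
      (by rw [M.tp_sM, h₁, M.Pi_nat])]
    refine interp_app (M.interpTy_sT_of (ihA f env) hA) ?_ (ihg _ _ _ hg) (iha _ _ _ hx) _ _
    rw [← M.map_push_lift]
    exact M.interpTy_sT_of (ihB _ _) hB
  | pair A B a b ihA ihB iha ihb =>
    intro X Y f env v h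
    rw [interp, Option.bind_eq_some_iff] at h
    obtain ⟨A', hA, h⟩ := h
    rw [Option.bind_eq_some_iff] at h
    obtain ⟨B', hB, h⟩ := h
    simp only [Option.bind_eq_some_iff, Option.dite_none_right_eq_some, Option.some.injEq] at h
    obtain ⟨x, hx, y, hy, ⟨h₁, h₂⟩, rfl⟩ := h
    rw [M.sM_mkPair]
    refine interp_pair (M.interpTy_sT_of (ihA f env) hA) ?_ (iha _ _ _ hx) (ihb _ _ _ hy) _ _
    rw [← M.map_push_lift]
    exact M.interpTy_sT_of (ihB _ _) hB
  | fst A B t ihA ihB iht =>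
    intro X Y f env v h
    rw [interp, Option.bind_eq_some_iff] at h
    obtain ⟨A', hA, h⟩ := h
    rw [Option.bind_eq_some_iff] at h
    obtain ⟨B', hB, h⟩ := h
    simp only [Option.bind_eq_some_iff, Option.dite_none_right_eq_some, Option.some.injEq] at h
    obtain ⟨x, hx, h₁, rfl⟩ := h
    obtain ⟨a, b, ha, hb, rfl⟩ := M.exists_mkPair h₁
    have ht := iht f _ _ hx
    rw [M.sM_mkPair] at ht
    rw [M.fst_mkPair]
    refine interp_fst_mkPair (M.interpTy_sT_of (ihA f env) hA) ?_ ht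
    rw [← M.map_push_lift]
    exact M.interpTy_sT_of (ihB _ _) hB
  | snd A B t ihA ihB iht =>
    intro X Y f env v h
    rw [interp, Option.bind_eq_some_iff] at h
    obtain ⟨A', hA, h⟩ := h
    rw [Option.bind_eq_some_iff] at h
    obtain ⟨B', hB, h⟩ := h
    simp only [Option.bind_eq_some_iff, Option.dite_none_right_eq_some, Option.some.injEq] at h
    obtain ⟨x, hx, h₁, rfl⟩ := h
    obtain ⟨a, b, ha, hb, rfl⟩ := M.exists_mkPair h₁
    have ht := iht f _ _ hx
    rw [M.sM_mkPair] at ht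
    rw [M.snd_mkPair]
    refine interp_snd_mkPair (M.interpTy_sT_of (ihA f env) hA) ?_ ht
    rw [← M.map_push_lift]
    exact M.interpTy_sT_of (ihB _ _) hB
  | idt A a b ihA iha ihb =>
    intro X Y f env v h
    simp only [interp, Option.bind_eq_some_iff, Option.dite_none_right_eq_some] at h
    obtain ⟨A', hA, x, hx, y, hy, ⟨⟨i, hi⟩, h₁, h₂⟩, hv⟩ := h
    rw [hi] at hv
    obtain ⟨hv, hv'⟩ := M.code_spec hv
    have hv : M.Is v (M.U i) := hv
    have hE := M.El_nat f A' i hi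
    refine interp_idt (ihA f _ _ hA) (iha f _ _ hx) (ihb f _ _ hy) (hi.sub f)
      (by rw [M.tp_sM, h₁, hE]) (by rw [M.tp_sM, h₂, hE]) (hv.sub f) ?_
    rw [← M.El_nat f v i hv, hv', M.sT_idAt]
    exact M.idAt_congr hE rfl rfl _ _ _ _
  | refl A a ihA iha =>
    intro X Y f env v h
    rw [interp, Option.bind_eq_some_iff] at h
    obtain ⟨A', hA, h⟩ := h
    simp only [Option.bind_eq_some_iff, Option.dite_none_right_eq_some, Option.some.injEq] at h
    obtain ⟨x, hx, h₁, rfl⟩ := h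
    rw [M.sM_sec_rflGen]
    exact interp_refl (M.interpTy_sT_of (ihA f env) hA) (iha f _ _ hx) _
  | idrec A D d a b p ihA ihD ihd iha ihb ihp =>
    intro X Y f env v h
    rw [interp, Option.bind_eq_some_iff] at h
    obtain ⟨A', hA, h⟩ := h
    rw [Option.bind_eq_some_iff] at h
    obtain ⟨D', hD, h⟩ := h
    simp only [Option.bind_eq_some_iff, Option.dite_none_right_eq_some, Option.some.injEq] at h
    obtain ⟨d', hd, x, hx, y, hy, e, he, ⟨h₁, h₂, h₃, h₄⟩, rfl⟩ := h
    change _ = some (M.sM f (M.sM (M.idMap A' x y e h₂ h₃ h₄) (M.J A' D' d' h₁)))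
    rw [← M.sM_comp, ← M.idMap_liftId, M.sM_comp, M.sM_J f h₁ (M.tp_sM_lift_reflMap f h₁)]
    refine interp_idrec (M.interpTy_sT_of (ihA f env) hA) ?_ ?_ (iha f _ _ hx) (ihb f _ _ hy)
      (ihp f _ _ he) _ _ _ _
    · rw [← M.map_push_liftId]
      exact M.interpTy_sT_of (ihD _ _) hD
    · rw [← M.map_push_lift]
      exact ihd _ _ _ hd
  | stepT s e s' ihs ihe ihs' =>
    intro X Y f env v h
    simp only [interp, Option.bind_eq_some_iff, Option.ite_none_right_eq_some] at h
    obtain ⟨x, hx, y, hy, x', hx', ⟨h₁, h₂, h₃⟩, hv⟩ := h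
    obtain ⟨hv, hv'⟩ := M.code_spec hv
    have hv : M.Is v (M.U 0) := hv
    exact interp_stepT (ihs f _ _ hx) (ihe f _ _ hy) (ihs' f _ _ hx') (h₁.sub f) (h₂.sub f)
      (h₃.sub f) (hv.sub f) (by rw [← M.El_nat f v 0 hv, hv', M.StepT_nat f _ _ _ h₁ h₂ h₃])
  | nil s ih =>
    intro X Y f env v h
    simp only [interp, Option.bind_eq_some_iff, Option.ite_none_right_eq_some,
      Option.some.injEq] at h
    obtain ⟨x, hx, h₁, rfl⟩ := h
    rw [M.nil_nat f _ h₁]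
    exact interp_nil (ih f _ _ hx) (h₁.sub f)
  | step τ e s ihτ ihe ihs =>
    intro X Y f env v h
    simp only [interp, Option.bind_eq_some_iff, Option.ite_none_right_eq_some,
      Option.some.injEq] at h
    obtain ⟨t, ht, y, hy, x, hx, ⟨h₁, h₂, h₃⟩, rfl⟩ := h
    rw [M.step_nat f _ _ _ h₁ h₂ h₃]
    exact interp_step (ihτ f _ _ ht) (ihe f _ _ hy) (ihs f _ _ hx) (h₁.sub f) (h₂.sub f)
      (h₃.sub f)
  | head π ih =>
    intro X Y f env v h
    simp only [interp, Option.bind_eq_some_iff, Option.ite_none_right_eq_some,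
      Option.some.injEq] at h
    obtain ⟨x, hx, h₁, rfl⟩ := h
    rw [M.head_nat f _ h₁]
    exact interp_head (ih f _ _ hx) (h₁.sub f)
  | tail π ih =>
    intro X Y f env v h
    simp only [interp, Option.bind_eq_some_iff, Option.dite_none_right_eq_some,
      Option.some.injEq] at h
    obtain ⟨x, hx, h₁, rfl⟩ := h
    rw [M.sM_tail]
    exact interp_tail (ih f _ _ hx) (h₁.sub f)
  | cofix A s e r a ihA ihs ihe ihr iha =>
    intro X Y f env v h
    rw [interp, Option.bind_eq_some_iff] at h
    obtain ⟨A', hA, h⟩ := h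
    simp only [Option.bind_eq_some_iff, Option.dite_none_right_eq_some, Option.some.injEq] at h
    obtain ⟨s', hs, e', he, r', hr, x, hx, ⟨⟨h₁, h₂⟩, h₃, h₄⟩, rfl⟩ := h
    rw [← M.sM_comp, ← M.sec_sM_lift, M.sM_comp, M.sM_corec]
    refine interp_cofix (M.interpTy_sT_of (ihA f env) hA) ?_ ?_ ?_ (iha f _ _ hx) _ _ _ _
    · rw [← M.map_push_lift]
      exact ihs _ _ _ hs
    · rw [← M.map_push_lift]
      exact ihe _ _ _ he
    · rw [← M.map_push_lift]
      exact ihr _ _ _ hr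
  | ext τ τ' ih ih' =>
    intro X Y f env v h
    simp only [interp, Option.bind_eq_some_iff, Option.ite_none_right_eq_some] at h
    obtain ⟨t, ht, t', ht', ⟨h₁, h₂⟩, hv⟩ := h
    obtain ⟨hv, hv'⟩ := M.code_spec hv
    have hv : M.Is v (M.U 0) := hv
    exact interp_ext (ih f _ _ ht) (ih' f _ _ ht') (h₁.sub f) (h₂.sub f)
      (hv.sub f) (by rw [← M.El_nat f v 0 hv, hv', M.Ext_nat f _ _ h₁ h₂])
  | extId τ ih =>
    intro X Y f env v h
    simp only [interp, Option.bind_eq_some_iff, Option.ite_none_right_eq_some,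
      Option.some.injEq] at h
    obtain ⟨x, hx, h₁, rfl⟩ := h
    rw [M.eid_nat f _ h₁]
    exact interp_extId (ih f _ _ hx) (h₁.sub f)
  | extComp τ τ' τ'' ε₁ ε₂ ih ih' ih'' ih₁ ih₂ =>
    intro X Y f env v h
    simp only [interp, Option.bind_eq_some_iff, Option.ite_none_right_eq_some,
      Option.some.injEq] at h
    obtain ⟨t, ht, t', ht', t'', ht'', x, hx, y, hy, ⟨⟨h₁, h₂, h₃⟩, h₄, h₅⟩, rfl⟩ := h
    rw [M.ecomp_nat f _ _ _ _ _ h₁ h₂ h₃ h₄ h₅]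
    exact interp_extComp (ih f _ _ ht) (ih' f _ _ ht') (ih'' f _ _ ht'') (ih₁ f _ _ hx)
      (ih₂ f _ _ hy) (h₁.sub f) (h₂.sub f) (h₃.sub f)
      (by rw [M.tp_sM, h₄, M.Ext_nat f _ _ h₁ h₂]) (by rw [M.tp_sM, h₅, M.Ext_nat f _ _ h₂ h₃])

theorem interpTy_sT {A : Term} {X Y : C} (f : Y ⟶ X) {env : List (M.Tm X)} {A' : M.Ty X}
    (h : M.interpTy A X env = some A') :
    M.interpTy A Y (env.map (M.sM f)) = some (M.sT f A') :=
  M.interpTy_sT_of (M.interp_sM A f env) h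

/-! ## Renaming and substitution -/

theorem getElem?_push_upR {X : C} {ξ : ℕ → ℕ} {env env' : List (M.Tm X)}
    (h : ∀ n, env'[ξ n]? = env[n]?) (A : M.Ty X) (n : ℕ) :
    (M.push A env')[Term.upR ξ n]? = (M.push A env)[n]? := by
  cases n with
  | zero => rfl
  | succ n => simp [CwF.push, Term.upR, h]

/-- Interpretation of renamed expressions. -/
theorem interp_ren (t : Term) : ∀ (ξ : ℕ → ℕ) {X : C} {env env' : List (M.Tm X)},
    (∀ n, env'[ξ n]? = env[n]?) → M.interp (t.ren ξ) X env' = M.interp t X env := by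
  induction t with
  | var n => intro ξ X env env' h; exact h n
  | univ | state | event | nat | finTrace | infTrace => intros; rfl
  | pi A B ihA ihB | sig A B ihA ihB =>
    intro ξ X env env' h
    have hB := fun A' => ihB _ (M.getElem?_push_upR h A')
    simp only [Term.ren, interp, ihA ξ h, hB]
  | lam A B t ihA ihB iht =>
    intro ξ X env env' h
    have hB := fun A' => ihB _ (M.getElem?_push_upR h A')
    have ht := fun A' => iht _ (M.getElem?_push_upR h A')
    simp only [Term.ren, interp, ihA ξ h, hB, ht]
  | app A B a b ihA ihB iha ihb | pair A B a b ihA ihB iha ihb =>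
    intro ξ X env env' h
    have hB := fun A' => ihB _ (M.getElem?_push_upR h A')
    simp only [Term.ren, interp, ihA ξ h, hB, iha ξ h, ihb ξ h]
  | fst A B t ihA ihB iht | snd A B t ihA ihB iht =>
    intro ξ X env env' h
    have hB := fun A' => ihB _ (M.getElem?_push_upR h A')
    simp only [Term.ren, interp, ihA ξ h, hB, iht ξ h]
  | idrec A D d a b p ihA ihD ihd iha ihb ihp =>
    intro ξ X env env' h
    have hD := fun A' A₁ A₂ => ihD _
      (M.getElem?_push_upR (M.getElem?_push_upR (M.getElem?_push_upR h A') A₁) A₂)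
    have hd := fun A' => ihd _ (M.getElem?_push_upR h A')
    simp only [Term.ren, interp, ihA ξ h, hD, hd, iha ξ h, ihb ξ h, ihp ξ h]
  | cofix A s e r a ihA ihs ihe ihr iha =>
    intro ξ X env env' h
    have hs := fun A' => ihs _ (M.getElem?_push_upR h A')
    have he := fun A' => ihe _ (M.getElem?_push_upR h A')
    have hr := fun A' => ihr _ (M.getElem?_push_upR h A')
    simp only [Term.ren, interp, ihA ξ h, hs, he, hr, iha ξ h]
  | nil t ih₁ | head t ih₁ | tail t ih₁ | extId t ih₁ =>
    intro ξ X env env' h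
    simp only [Term.ren, interp, ih₁ ξ h]
  | refl t₁ t₂ ih₁ ih₂ | ext t₁ t₂ ih₁ ih₂ =>
    intro ξ X env env' h
    simp only [Term.ren, interp, ih₁ ξ h, ih₂ ξ h]
  | idt t₁ t₂ t₃ ih₁ ih₂ ih₃ | stepT t₁ t₂ t₃ ih₁ ih₂ ih₃ | step t₁ t₂ t₃ ih₁ ih₂ ih₃ =>
    intro ξ X env env' h
    simp only [Term.ren, interp, ih₁ ξ h, ih₂ ξ h, ih₃ ξ h]
  | extComp t₁ t₂ t₃ t₄ t₅ ih₁ ih₂ ih₃ ih₄ ih₅ =>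
    intro ξ X env env' h
    simp only [Term.ren, interp, ih₁ ξ h, ih₂ ξ h, ih₃ ξ h, ih₄ ξ h, ih₅ ξ h]

theorem interp_wk (t : Term) {X : C} (env : List (M.Tm X)) (x : M.Tm X) :
    M.interp t.wk X (x :: env) = M.interp t X env :=
  M.interp_ren t _ fun n => by simp

theorem interpTy_wk (A : Term) {X : C} (env : List (M.Tm X)) (x : M.Tm X) :
    M.interpTy A.wk X (x :: env) = M.interpTy A X env := by
  rw [interpTy, interpTy, interp_wk]

/-- The substitution `σ` takes in the environment `env'` the values listed in `env`, in all
contexts over `X`. -/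
def SubstTo (σ : ℕ → Term) {X : C} (env' env : List (M.Tm X)) : Prop :=
  ∀ (n : ℕ) {Y : C} (f : Y ⟶ X),
    M.interp (σ n) Y (env'.map (M.sM f)) = (env[n]?).map (M.sM f)

theorem SubstTo.push {M : CompModel.{u, v, w} C} {σ : ℕ → Term} {X : C} {env' env : List (M.Tm X)}
    (h : M.SubstTo σ env' env) (A : M.Ty X) :
    M.SubstTo (Term.upS σ) (M.push A env') (M.push A env) := by
  intro n Y f
  cases n with
  | zero => rfl
  | succ n =>
    rw [CwF.push, List.map_cons, Term.upS, interp_wk, ← M.map_sM_comp, h n]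
    simp only [CwF.push, List.getElem?_cons_succ, List.getElem?_map, Option.map_map]
    congr 1
    exact funext fun x => M.sM_comp _ _ _

theorem SubstTo.interp_eq {M : CompModel.{u, v, w} C} {σ : ℕ → Term} {X : C}
    {env' env : List (M.Tm X)} (h : M.SubstTo σ env' env) (n : ℕ) :
    M.interp (σ n) X env' = env[n]? := by
  have := h n (𝟙 X)
  rw [M.map_sM_id] at this
  rw [this]
  cases env[n]? with
  | none => rfl
  | some x => exact congrArg some (M.sM_id x)

/-- Interpretation of substituted expressions. -/
theorem interp_sub (t : Term) : ∀ {σ : ℕ → Term} {X : C} {env env' : List (M.Tm X)},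
    M.SubstTo σ env' env → M.interp (t.sub σ) X env' = M.interp t X env := by
  induction t with
  | var n => intro σ X env env' h; exact h.interp_eq n
  | univ | state | event | nat | finTrace | infTrace => intros; rfl
  | pi A B ihA ihB | sig A B ihA ihB =>
    intro σ X env env' h
    have hB := fun A' => ihB (h.push A')
    simp only [Term.sub, interp, ihA h, hB]
  | lam A B t ihA ihB iht =>
    intro σ X env env' h
    have hB := fun A' => ihB (h.push A')
    have ht := fun A' => iht (h.push A')
    simp only [Term.sub, interp, ihA h, hB, ht]
  | app A B a b ihA ihB iha ihb | pair A B a b ihA ihB iha ihb =>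
    intro σ X env env' h
    have hB := fun A' => ihB (h.push A')
    simp only [Term.sub, interp, ihA h, hB, iha h, ihb h]
  | fst A B t ihA ihB iht | snd A B t ihA ihB iht =>
    intro σ X env env' h
    have hB := fun A' => ihB (h.push A')
    simp only [Term.sub, interp, ihA h, hB, iht h]
  | idrec A D d a b p ihA ihD ihd iha ihb ihp =>
    intro σ X env env' h
    have hD := fun A' A₁ A₂ => ihD (((h.push A').push A₁).push A₂)
    have hd := fun A' => ihd (h.push A')
    simp only [Term.sub, interp, ihA h, hD, hd, iha h, ihb h, ihp h]
  | cofix A s e r a ihA ihs ihe ihr iha =>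
    intro σ X env env' h
    have hs := fun A' => ihs (h.push A')
    have he := fun A' => ihe (h.push A')
    have hr := fun A' => ihr (h.push A')
    simp only [Term.sub, interp, ihA h, hs, he, hr, iha h]
  | nil t ih₁ | head t ih₁ | tail t ih₁ | extId t ih₁ =>
    intro σ X env env' h
    simp only [Term.sub, interp, ih₁ h]
  | refl t₁ t₂ ih₁ ih₂ | ext t₁ t₂ ih₁ ih₂ =>
    intro σ X env env' h
    simp only [Term.sub, interp, ih₁ h, ih₂ h]
  | idt t₁ t₂ t₃ ih₁ ih₂ ih₃ | stepT t₁ t₂ t₃ ih₁ ih₂ ih₃ | step t₁ t₂ t₃ ih₁ ih₂ ih₃ =>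
    intro σ X env env' h
    simp only [Term.sub, interp, ih₁ h, ih₂ h, ih₃ h]
  | extComp t₁ t₂ t₃ t₄ t₅ ih₁ ih₂ ih₃ ih₄ ih₅ =>
    intro σ X env env' h
    simp only [Term.sub, interp, ih₁ h, ih₂ h, ih₃ h, ih₄ h, ih₅ h]

theorem substTo_var {X : C} (env : List (M.Tm X)) : M.SubstTo Term.var env env := fun n Y f => by
  rw [interp, List.getElem?_map]

theorem substTo_wk {X : C} (env : List (M.Tm X)) (x : M.Tm X) :
    M.SubstTo (fun n => Term.var (n + 1)) (x :: env) env := fun n Y f => by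
  rw [interp, List.map_cons, List.getElem?_cons_succ, List.getElem?_map]

theorem SubstTo.scons {M : CompModel.{u, v, w} C} {σ : ℕ → Term} {X : C} {env' env : List (M.Tm X)}
    (h : M.SubstTo σ env' env) {a : Term} {x : M.Tm X} (ha : M.interp a X env' = some x) :
    M.SubstTo (Term.scons a σ) env' (x :: env) := by
  intro n Y f
  cases n with
  | zero => exact M.interp_sM a f env' x ha
  | succ n => exact h n f

/-- The value of `t[a/x]`. -/
theorem interp_inst {t a : Term} {X : C} {env : List (M.Tm X)} {A : M.Ty X} {x : M.Tm X}
    {b : M.Tm (M.ext A)} (ha : M.interp a X env = some x) (hx : M.tp x = A)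
    (ht : M.interp t (M.ext A) (M.push A env) = some b) :
    M.interp (t.inst a) X env = some (M.sM (M.sec A x hx) b) := by
  rw [Term.inst, M.interp_sub t ((M.substTo_var env).scons ha), ← M.map_push_sec A x hx]
  exact M.interp_sM t _ _ _ ht

theorem interp_inst₃ {D a b p : Term} {X : C} {env : List (M.Tm X)} {A : M.Ty X} {x y e : M.Tm X}
    {c : M.Tm (M.ext (M.IdT A))} (ha : M.interp a X env = some x)
    (hb : M.interp b X env = some y) (hp : M.interp p X env = some e) (hx : M.tp x = A)
    (hy : M.tp y = A) (he : M.tp e = M.idAt A x y hx hy)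
    (hD : M.interp D (M.ext (M.IdT A))
      (M.push (M.IdT A) (M.push (M.sT (M.p A) A) (M.push A env))) = some c) :
    M.interp (D.inst₃ a b p) X env = some (M.sM (M.idMap A x y e hx hy he) c) := by
  rw [Term.inst₃, M.interp_sub D ((((M.substTo_var env).scons ha).scons hb).scons hp),
    ← M.map_push_idMap hx hy he]
  exact M.interp_sM D _ _ _ hD

theorem interpTy_wk_push {B : Term} {X : C} {env : List (M.Tm X)} (A : M.Ty X) {B' : M.Ty X}
    (h : M.interpTy B X env = some B') :
    M.interpTy B.wk (M.ext A) (M.push A env) = some (M.sT (M.p A) B') := by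
  rw [CwF.push, interpTy_wk]
  exact M.interpTy_sT _ h

theorem interp_wk_push {t : Term} {X : C} {env : List (M.Tm X)} (A : M.Ty X) {v : M.Tm X}
    (h : M.interp t X env = some v) :
    M.interp t.wk (M.ext A) (M.push A env) = some (M.sM (M.p A) v) := by
  rw [CwF.push, interp_wk]
  exact M.interp_sM _ _ _ _ h

theorem interp_motiveRefl {A D : Term} {X : C} {env : List (M.Tm X)} {A' : M.Ty X}
    {c : M.Tm (M.ext (M.IdT A'))} (hA : M.interpTy A X env = some A')
    (hD : M.interp D (M.ext (M.IdT A'))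
      (M.push (M.IdT A') (M.push (M.sT (M.p A') A') (M.push A' env))) = some c) :
    M.interp (Term.motiveRefl A D) (M.ext A') (M.push A' env) = some (M.sM (M.reflMap A') c) := by
  have h₀ : M.interp (.var 0) (M.ext A') (M.push A' env) = some (M.q A') := by rfl
  have hr := interp_refl (M.interpTy_wk_push A' hA) h₀ (M.tp_q A')
  rw [M.refl_generic] at hr
  rw [← M.interp_sM D _ _ _ hD, M.map_push_reflMap]
  exact M.interp_sub D ((((M.substTo_wk (env.map (M.sM (M.p A'))) (M.q A')).scons
    h₀).scons h₀).scons hr)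

end CompModel

namespace CompModel

variable {C : Type u} [Category.{v} C] [HasTerminal C] (M : CompModel.{u, v, w} C)

/-! ## Semantic judgements of the computational layer -/

/-- `t` and `t'` have the same value in the environment `env`, of the type that is the value
of `A`. -/
def EqAt {X : C} (env : List (M.Tm X)) (t t' A : Term) : Prop :=
  ∃ A', M.interpTy A X env = some A' ∧ ∃ v, M.tp v = A' ∧
    M.interp t X env = some v ∧ M.interp t' X env = some v

variable {M} {X : C} {env : List (M.Tm X)}

theorem EqAt.symm {t t' A : Term} (h : M.EqAt env t t' A) : M.EqAt env t' t A := by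
  obtain ⟨A', hA, v, hv, h₁, h₂⟩ := h
  exact ⟨A', hA, v, hv, h₂, h₁⟩

theorem EqAt.trans {t t' t'' A : Term} (h : M.EqAt env t t' A) (h' : M.EqAt env t' t'' A) :
    M.EqAt env t t'' A := by
  obtain ⟨A', hA, v, hv, h₁, h₂⟩ := h
  obtain ⟨-, -, v', -, h₁', h₂'⟩ := h'
  cases h₂.symm.trans h₁'
  exact ⟨A', hA, v, hv, h₁, h₂'⟩

theorem EqAt.of_interpTy {t t' A : Term} {A' : M.Ty X} (h : M.EqAt env t t' A)
    (hA : M.interpTy A X env = some A') :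
    ∃ v, M.tp v = A' ∧ M.interp t X env = some v ∧ M.interp t' X env = some v := by
  obtain ⟨A'', hA', h⟩ := h
  cases hA.symm.trans hA'
  exact h

theorem interpTy_of_interp {A : Term} {a : M.Tm X} {i : ℕ} (h : M.interp A X env = some a)
    (ha : M.Is a (M.U i)) : M.interpTy A X env = some (M.El a) :=
  M.interpTy_eq_some.2 ⟨a, i, h, ha, rfl⟩

theorem interpTy_of_small {A : Term} {A' : M.Ty X} {i : ℕ}
    (hs : ∃ c : M.Tm X, M.Is c (M.U i) ∧ M.El c = A')
    (h : M.interp A X env = M.code (M.cl X (M.U i)) A') :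
    M.interpTy A X env = some A' := by
  obtain ⟨c, hc, hc'⟩ := hs
  rw [M.code_eq hc hc'] at h
  rw [interpTy_of_interp h hc, hc']

variable (M env) in
theorem interpTy_univ (i : ℕ) : M.interpTy (.univ i) X env = some (M.cl X (M.U i)) :=
  interpTy_of_small (M.U_small X i) rfl

variable (M env) in
theorem interpTy_state : M.interpTy .state X env = some (M.cl X M.State) :=
  interpTy_of_small (M.State_small X) rfl

variable (M env) in
theorem interpTy_event : M.interpTy .event X env = some (M.cl X M.Event) :=
  interpTy_of_small (M.Event_small X) rfl

variable (M env) in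
theorem interpTy_finTrace : M.interpTy .finTrace X env = some (M.cl X M.FinT) :=
  interpTy_of_small (M.FinT_small X) rfl

variable (M env) in
theorem interpTy_infTrace : M.interpTy .infTrace X env = some (M.cl X M.InfT) :=
  interpTy_of_small (M.InfT_small X) rfl

theorem eqAt_univ {A A' : Term} {i : ℕ} : M.EqAt env A A' (.univ i) ↔
    ∃ a, M.Is a (M.U i) ∧ M.interp A X env = some a ∧ M.interp A' X env = some a :=
  ⟨fun h => h.of_interpTy (M.interpTy_univ env i), fun h => ⟨_, M.interpTy_univ env i, h⟩⟩

theorem EqAt.interpTy_eq {A A' : Term} {i : ℕ} (h : M.EqAt env A A' (.univ i)) :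
    ∃ T, M.interpTy A X env = some T ∧ M.interpTy A' X env = some T := by
  obtain ⟨a, ha, h₁, h₂⟩ := eqAt_univ.1 h
  exact ⟨_, interpTy_of_interp h₁ ha, interpTy_of_interp h₂ ha⟩

theorem EqAt.conv {t t' A B : Term} {i : ℕ} (h : M.EqAt env t t' A)
    (hAB : M.EqAt env A B (.univ i)) : M.EqAt env t t' B := by
  obtain ⟨T, h₁, h₂⟩ := hAB.interpTy_eq
  exact ⟨T, h₂, h.of_interpTy h₁⟩

theorem eqAt_state {t t' : Term} : M.EqAt env t t' .state ↔
    ∃ v, M.Is v M.State ∧ M.interp t X env = some v ∧ M.interp t' X env = some v :=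
  ⟨fun h => h.of_interpTy (M.interpTy_state env), fun h => ⟨_, M.interpTy_state env, h⟩⟩

theorem eqAt_event {t t' : Term} : M.EqAt env t t' .event ↔
    ∃ v, M.Is v M.Event ∧ M.interp t X env = some v ∧ M.interp t' X env = some v :=
  ⟨fun h => h.of_interpTy (M.interpTy_event env), fun h => ⟨_, M.interpTy_event env, h⟩⟩

theorem eqAt_finTrace {t t' : Term} : M.EqAt env t t' .finTrace ↔
    ∃ v, M.Is v M.FinT ∧ M.interp t X env = some v ∧ M.interp t' X env = some v :=
  ⟨fun h => h.of_interpTy (M.interpTy_finTrace env), fun h => ⟨_, M.interpTy_finTrace env, h⟩⟩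

theorem eqAt_infTrace {t t' : Term} : M.EqAt env t t' .infTrace ↔
    ∃ v, M.Is v M.InfT ∧ M.interp t X env = some v ∧ M.interp t' X env = some v :=
  ⟨fun h => h.of_interpTy (M.interpTy_infTrace env), fun h => ⟨_, M.interpTy_infTrace env, h⟩⟩

theorem eqAt_of_small {A : Term} {A' : M.Ty X} {i : ℕ}
    (hs : ∃ c : M.Tm X, M.Is c (M.U i) ∧ M.El c = A')
    (h : M.interp A X env = M.code (M.cl X (M.U i)) A') : M.EqAt env A A (.univ i) := by
  obtain ⟨c, hc, hc'⟩ := hs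
  rw [M.code_eq hc hc'] at h
  exact eqAt_univ.2 ⟨c, hc, h, h⟩

variable (M env) in
/-- `t` and `t'` have the same value under a binder of type `A`. -/
def BindEqAt (A t t' B : Term) : Prop :=
  ∀ A', M.interpTy A X env = some A' → M.EqAt (M.push A' env) t t' B

theorem interpTy_inst {B a : Term} {A' : M.Ty X} {B' : M.Ty (M.ext A')} {x : M.Tm X}
    (hB : M.interpTy B (M.ext A') (M.push A' env) = some B')
    (ha : M.interp a X env = some x) (hx : M.tp x = A') :
    M.interpTy (B.inst a) X env = some (M.sT (M.sec A' x hx) B') := by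
  obtain ⟨b, i, hb, hi, rfl⟩ := M.interpTy_eq_some.1 hB
  rw [interpTy_of_interp (M.interp_inst ha hx hb) (hi.sub _), M.El_nat _ b i hi]

/-! ### Dependent products and sums -/

section Binders

variable {A A' B B' : Term} {i : ℕ}

theorem EqAt.pi (hA : M.EqAt env A A' (.univ i)) (hB : M.BindEqAt env A B B' (.univ i)) :
    M.EqAt env (.pi A B) (.pi A' B') (.univ i) := by
  obtain ⟨a, ha, h₁, h₂⟩ := eqAt_univ.1 hA
  obtain ⟨b, hb, h₃, h₄⟩ := eqAt_univ.1 (hB _ (interpTy_of_interp h₁ ha))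
  obtain ⟨c, hc, hc'⟩ := M.Pi_small i a b ha hb
  exact eqAt_univ.2 ⟨c, hc, interp_pi h₁ ha rfl h₃ hb hc hc', interp_pi h₂ ha rfl h₄ hb hc hc'⟩

theorem EqAt.sig (hA : M.EqAt env A A' (.univ i)) (hB : M.BindEqAt env A B B' (.univ i)) :
    M.EqAt env (.sig A B) (.sig A' B') (.univ i) := by
  obtain ⟨a, ha, h₁, h₂⟩ := eqAt_univ.1 hA
  obtain ⟨b, hb, h₃, h₄⟩ := eqAt_univ.1 (hB _ (interpTy_of_interp h₁ ha))
  obtain ⟨c, hc, hc'⟩ := M.Sig_small i a b ha hb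
  exact eqAt_univ.2 ⟨c, hc, interp_sig h₁ ha rfl h₃ hb hc hc', interp_sig h₂ ha rfl h₄ hb hc hc'⟩

theorem EqAt.exists_types (hA : M.EqAt env A A' (.univ i))
    (hB : M.BindEqAt env A B B' (.univ i)) :
    ∃ (S : M.Ty X) (T : M.Ty (M.ext S)), M.interpTy A X env = some S ∧
      M.interpTy A' X env = some S ∧ M.interpTy B (M.ext S) (M.push S env) = some T ∧
      M.interpTy B' (M.ext S) (M.push S env) = some T ∧
      M.interpTy (.pi A B) X env = some (M.Pi S T) ∧
      M.interpTy (.sig A B) X env = some (M.Sig S T) := by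
  obtain ⟨a, ha, h₁, h₂⟩ := eqAt_univ.1 hA
  have hS := interpTy_of_interp h₁ ha
  obtain ⟨b, hb, h₃, h₄⟩ := eqAt_univ.1 (hB _ hS)
  obtain ⟨c, hc, hc'⟩ := M.Pi_small i a b ha hb
  obtain ⟨d, hd, hd'⟩ := M.Sig_small i a b ha hb
  refine ⟨_, M.El b, hS, interpTy_of_interp h₂ ha, interpTy_of_interp h₃ hb,
    interpTy_of_interp h₄ hb, ?_, ?_⟩
  · rw [interpTy_of_interp (interp_pi h₁ ha rfl h₃ hb hc hc') hc, hc']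
  · rw [interpTy_of_interp (interp_sig h₁ ha rfl h₃ hb hd hd') hd, hd']

theorem EqAt.lam {t t' : Term} (hA : M.EqAt env A A' (.univ i))
    (hB : M.BindEqAt env A B B' (.univ i)) (ht : M.BindEqAt env A t t' B) :
    M.EqAt env (.lam A B t) (.lam A' B' t') (.pi A B) := by
  obtain ⟨S, T, hS, hS', hT, hT', hP, -⟩ := hA.exists_types hB
  obtain ⟨b, hb, h₁, h₂⟩ := (ht S hS).of_interpTy hT
  exact ⟨_, hP, M.lam S b, by rw [M.tp_lam, hb], interp_lam hS hT h₁ hb,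
    interp_lam hS' hT' h₂ hb⟩

theorem EqAt.app {f f' a a' : Term} (hA : M.EqAt env A A' (.univ i))
    (hB : M.BindEqAt env A B B' (.univ i)) (hf : M.EqAt env f f' (.pi A B))
    (ha : M.EqAt env a a' A) : M.EqAt env (.app A B f a) (.app A' B' f' a') (B.inst a) := by
  obtain ⟨S, T, hS, hS', hT, hT', hP, -⟩ := hA.exists_types hB
  obtain ⟨g, hg, h₁, h₂⟩ := hf.of_interpTy hP
  obtain ⟨x, hx, h₃, h₄⟩ := ha.of_interpTy hS
  exact ⟨_, interpTy_inst hT h₃ hx, _, M.tp_sM_of _ (M.tp_unlam hg),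
    interp_app hS hT h₁ h₃ hg hx, interp_app hS' hT' h₂ h₄ hg hx⟩

theorem EqAt.pair {a a' b b' : Term} (hA : M.EqAt env A A' (.univ i))
    (hB : M.BindEqAt env A B B' (.univ i)) (ha : M.EqAt env a a' A)
    (hb : M.EqAt env b b' (B.inst a)) :
    M.EqAt env (.pair A B a b) (.pair A' B' a' b') (.sig A B) := by
  obtain ⟨S, T, hS, hS', hT, hT', -, hP⟩ := hA.exists_types hB
  obtain ⟨x, hx, h₁, h₂⟩ := ha.of_interpTy hS
  obtain ⟨y, hy, h₃, h₄⟩ := hb.of_interpTy (interpTy_inst hT h₁ hx)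
  exact ⟨_, hP, _, M.tp_mkPair hx hy, interp_pair hS hT h₁ h₃ hx hy,
    interp_pair hS' hT' h₂ h₄ hx hy⟩

theorem EqAt.fst {t t' : Term} (hA : M.EqAt env A A' (.univ i))
    (hB : M.BindEqAt env A B B' (.univ i)) (ht : M.EqAt env t t' (.sig A B)) :
    M.EqAt env (.fst A B t) (.fst A' B' t') A := by
  obtain ⟨S, T, hS, hS', hT, hT', -, hP⟩ := hA.exists_types hB
  obtain ⟨v, hv, h₁, h₂⟩ := ht.of_interpTy hP
  obtain ⟨x, y, hx, hy, rfl⟩ := M.exists_mkPair hv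
  exact ⟨_, hS, x, hx, interp_fst_mkPair hS hT h₁, interp_fst_mkPair hS' hT' h₂⟩

theorem EqAt.snd {t t' : Term} (hA : M.EqAt env A A' (.univ i))
    (hB : M.BindEqAt env A B B' (.univ i)) (ht : M.EqAt env t t' (.sig A B)) :
    M.EqAt env (.snd A B t) (.snd A' B' t') (B.inst (.fst A B t)) := by
  obtain ⟨S, T, hS, hS', hT, hT', -, hP⟩ := hA.exists_types hB
  obtain ⟨v, hv, h₁, h₂⟩ := ht.of_interpTy hP
  obtain ⟨x, y, hx, hy, rfl⟩ := M.exists_mkPair hv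
  exact ⟨_, interpTy_inst hT (interp_fst_mkPair hS hT h₁) hx, y, hy,
    interp_snd_mkPair hS hT h₁, interp_snd_mkPair hS' hT' h₂⟩

theorem EqAt.piBeta {t a : Term} (hA : M.EqAt env A A (.univ i))
    (hB : M.BindEqAt env A B B (.univ i)) (ht : M.BindEqAt env A t t B)
    (ha : M.EqAt env a a A) :
    M.EqAt env (.app A B (.lam A B t) a) (t.inst a) (B.inst a) := by
  obtain ⟨S, T, hS, -, hT, -, hP, -⟩ := hA.exists_types hB
  obtain ⟨b, hb, h₁, -⟩ := (ht S hS).of_interpTy hT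
  obtain ⟨x, hx, h₂, -⟩ := ha.of_interpTy hS
  have hl : M.tp (M.lam S b) = M.Pi S T := by rw [M.tp_lam, hb]
  have h := interp_app hS hT (interp_lam hS hT h₁ hb) h₂ hl hx
  rw [M.unlam_eq hl hb rfl] at h
  exact ⟨_, interpTy_inst hT h₂ hx, _, M.tp_sM_of _ hb, h, M.interp_inst h₂ hx h₁⟩

theorem EqAt.piEta {f : Term} (hA : M.EqAt env A A (.univ i))
    (hB : M.BindEqAt env A B B (.univ i)) (hf : M.EqAt env f f (.pi A B)) :
    M.EqAt env (.lam A B (.app A.wk (B.ren (Term.upR Nat.succ)) f.wk (.var 0))) f (.pi A B) := by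
  obtain ⟨S, T, hS, -, hT, -, hP, -⟩ := hA.exists_types hB
  obtain ⟨g, hg, h₁, -⟩ := hf.of_interpTy hP
  have hg' : M.tp (M.sM (M.p S) g) = M.Pi (M.sT (M.p S) S) (M.sT (M.lift S (M.p S)) T) := by
    rw [M.tp_sM, hg, M.Pi_nat]
  have hT' : M.interpTy (B.ren (Term.upR Nat.succ)) (M.ext (M.sT (M.p S) S))
      (M.push (M.sT (M.p S) S) (M.push S env)) = some (M.sT (M.lift S (M.p S)) T) := by
    rw [← M.interpTy_sT (M.lift S (M.p S)) hT, M.map_push_lift, interpTy, interpTy]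
    congr 1
    exact M.interp_ren B _ (M.getElem?_push_upR (fun n => by simp [CwF.push]) _)
  have h := interp_app (M.interpTy_wk_push S hS) hT' (M.interp_wk_push S h₁)
    (show M.interp (.var 0) (M.ext S) (M.push S env) = some (M.q S) from rfl) hg' (M.tp_q S)
  rw [← M.sM_unlam (M.p S) hg hg', ← M.sM_comp, M.sec_lift, M.pair_p_q, M.sM_id] at h
  have h' := interp_lam hS hT h (M.tp_unlam hg)
  rw [M.lam_unlam] at h'
  exact ⟨_, hP, g, hg, h', h₁⟩

theorem EqAt.fstBeta {a b : Term} (hA : M.EqAt env A A (.univ i))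
    (hB : M.BindEqAt env A B B (.univ i)) (ha : M.EqAt env a a A)
    (hb : M.EqAt env b b (B.inst a)) : M.EqAt env (.fst A B (.pair A B a b)) a A := by
  obtain ⟨S, T, hS, -, hT, -, -, -⟩ := hA.exists_types hB
  obtain ⟨x, hx, h₁, -⟩ := ha.of_interpTy hS
  obtain ⟨y, hy, h₂, -⟩ := hb.of_interpTy (interpTy_inst hT h₁ hx)
  exact ⟨_, hS, x, hx, interp_fst_mkPair hS hT (interp_pair hS hT h₁ h₂ hx hy), h₁⟩

theorem EqAt.sndBeta {a b : Term} (hA : M.EqAt env A A (.univ i))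
    (hB : M.BindEqAt env A B B (.univ i)) (ha : M.EqAt env a a A)
    (hb : M.EqAt env b b (B.inst a)) : M.EqAt env (.snd A B (.pair A B a b)) b (B.inst a) := by
  obtain ⟨S, T, hS, -, hT, -, -, -⟩ := hA.exists_types hB
  obtain ⟨x, hx, h₁, -⟩ := ha.of_interpTy hS
  obtain ⟨y, hy, h₂, -⟩ := hb.of_interpTy (interpTy_inst hT h₁ hx)
  exact ⟨_, interpTy_inst hT h₁ hx, y, hy,
    interp_snd_mkPair hS hT (interp_pair hS hT h₁ h₂ hx hy), h₂⟩

theorem EqAt.sigEta {t : Term} (hA : M.EqAt env A A (.univ i))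
    (hB : M.BindEqAt env A B B (.univ i)) (ht : M.EqAt env t t (.sig A B)) :
    M.EqAt env (.pair A B (.fst A B t) (.snd A B t)) t (.sig A B) := by
  obtain ⟨S, T, hS, -, hT, -, -, hP⟩ := hA.exists_types hB
  obtain ⟨v, hv, h₁, -⟩ := ht.of_interpTy hP
  obtain ⟨x, y, hx, hy, rfl⟩ := M.exists_mkPair hv
  exact ⟨_, hP, _, hv,
    interp_pair hS hT (interp_fst_mkPair hS hT h₁) (interp_snd_mkPair hS hT h₁) hx hy, h₁⟩

end Binders

/-! ### Identity types -/

section Identity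

variable {A A' : Term} {i j : ℕ}

theorem EqAt.idt {a a' b b' : Term} (hA : M.EqAt env A A' (.univ i)) (ha : M.EqAt env a a' A)
    (hb : M.EqAt env b b' A) : M.EqAt env (.idt A a b) (.idt A' a' b') (.univ i) := by
  obtain ⟨S, hS, h₁, h₂⟩ := eqAt_univ.1 hA
  obtain ⟨x, hx, h₃, h₄⟩ := ha.of_interpTy (interpTy_of_interp h₁ hS)
  obtain ⟨y, hy, h₅, h₆⟩ := hb.of_interpTy (interpTy_of_interp h₁ hS)
  obtain ⟨c, hc, hc'⟩ := M.Id_small i S hS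
  have hE : M.El (M.sM (M.sec₂ (M.El S) x y hx hy) c) = M.idAt (M.El S) x y hx hy := by
    rw [← M.El_nat _ c i hc, hc', idAt]
  exact eqAt_univ.2 ⟨_, hc.sub _, interp_idt h₁ h₃ h₅ hS hx hy (hc.sub _) hE,
    interp_idt h₂ h₄ h₆ hS hx hy (hc.sub _) hE⟩

theorem interpTy_idt {a b : Term} {S : M.Ty X} {x y : M.Tm X}
    (hA : M.interpTy A X env = some S) (ha : M.interp a X env = some x)
    (hb : M.interp b X env = some y) (hx : M.tp x = S) (hy : M.tp y = S) :
    M.interpTy (.idt A a b) X env = some (M.idAt S x y hx hy) := by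
  obtain ⟨s, i, h₁, hS, rfl⟩ := M.interpTy_eq_some.1 hA
  obtain ⟨c, hc, hc'⟩ := M.Id_small i s hS
  have hE : M.El (M.sM (M.sec₂ (M.El s) x y hx hy) c) = M.idAt (M.El s) x y hx hy := by
    rw [← M.El_nat _ c i hc, hc', idAt]
  rw [interpTy_of_interp (interp_idt h₁ ha hb hS hx hy (hc.sub _) hE) (hc.sub _), hE]

theorem EqAt.refl {a a' : Term} (hA : M.EqAt env A A' (.univ i)) (ha : M.EqAt env a a' A) :
    M.EqAt env (.refl A a) (.refl A' a') (.idt A a a) := by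
  obtain ⟨S, hS, hS'⟩ := hA.interpTy_eq
  obtain ⟨x, hx, h₁, h₂⟩ := ha.of_interpTy hS
  exact ⟨_, interpTy_idt hS h₁ h₁ hx hx, _, M.tp_sec_rflGen hx, interp_refl hS h₁ hx,
    interp_refl hS' h₂ hx⟩

/-- The value of the type of generic identity proofs. -/
theorem interpTy_idt_generic {S : M.Ty X} (hA : M.interpTy A X env = some S) :
    M.interpTy (.idt A.wk.wk (.var 1) (.var 0)) (M.ext (M.sT (M.p S) S))
      (M.push (M.sT (M.p S) S) (M.push S env)) = some (M.IdT S) := by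
  have hA' := M.interpTy_wk_push (M.sT (M.p S) S) (M.interpTy_wk_push S hA)
  rw [← M.sT_comp] at hA'
  have h₁ : M.tp (M.sM (M.p (M.sT (M.p S) S)) (M.q S)) =
      M.sT (M.p (M.sT (M.p S) S) ≫ M.p S) S := by
    rw [M.tp_sM, M.tp_q, M.sT_comp]
  have h₂ : M.tp (M.q (M.sT (M.p S) S)) = M.sT (M.p (M.sT (M.p S) S) ≫ M.p S) S := by
    rw [M.tp_q, M.sT_comp]
  rw [interpTy_idt hA' (x := M.sM (M.p _) (M.q S)) (y := M.q _) rfl rfl h₁ h₂, M.idAt_generic]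

variable (M env) in
/-- `t` and `t'` have the same value in the context of generic identity proofs of `A`. -/
def IdBindEqAt (A t t' B : Term) : Prop :=
  ∀ S, M.interpTy A X env = some S →
    M.EqAt (M.push (M.IdT S) (M.push (M.sT (M.p S) S) (M.push S env))) t t' B

theorem EqAt.idrec {D D' d d' a a' b b' p p' : Term} (hA : M.EqAt env A A' (.univ i))
    (hD : M.IdBindEqAt env A D D' (.univ j))
    (hd : M.BindEqAt env A d d' (Term.motiveRefl A D)) (ha : M.EqAt env a a' A)
    (hb : M.EqAt env b b' A) (hp : M.EqAt env p p' (.idt A a b)) :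
    M.EqAt env (.idrec A D d a b p) (.idrec A' D' d' a' b' p') (D.inst₃ a b p) := by
  obtain ⟨S, hS, hS'⟩ := hA.interpTy_eq
  obtain ⟨c, hc, hc₁, hc₂⟩ := eqAt_univ.1 (hD S hS)
  have hm := interpTy_of_interp (M.interp_motiveRefl hS hc₁) (hc.sub _)
  rw [← M.El_nat _ c j hc] at hm
  obtain ⟨e, he, he₁, he₂⟩ := (hd S hS).of_interpTy hm
  obtain ⟨x, hx, hx₁, hx₂⟩ := ha.of_interpTy hS
  obtain ⟨y, hy, hy₁, hy₂⟩ := hb.of_interpTy hS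
  obtain ⟨r, hr, hr₁, hr₂⟩ := hp.of_interpTy (interpTy_idt hS hx₁ hy₁ hx hy)
  have hT := interpTy_of_interp (M.interp_inst₃ hx₁ hy₁ hr₁ hx hy hr hc₁) (hc.sub _)
  rw [← M.El_nat _ c j hc] at hT
  exact ⟨_, hT, _, M.tp_sM_of _ (M.tp_J S (M.El c) e he),
    interp_idrec hS (interpTy_of_interp hc₁ hc) he₁ hx₁ hy₁ hr₁ he hx hy hr,
    interp_idrec hS' (interpTy_of_interp hc₂ hc) he₂ hx₂ hy₂ hr₂ he hx hy hr⟩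

theorem EqAt.idBeta {D d a : Term} (hA : M.EqAt env A A (.univ i))
    (hD : M.IdBindEqAt env A D D (.univ j))
    (hd : M.BindEqAt env A d d (Term.motiveRefl A D)) (ha : M.EqAt env a a A) :
    M.EqAt env (.idrec A D d a a (.refl A a)) (d.inst a) (D.inst₃ a a (.refl A a)) := by
  obtain ⟨S, hS, -⟩ := hA.interpTy_eq
  obtain ⟨c, hc, hc₁, -⟩ := eqAt_univ.1 (hD S hS)
  have hm := interpTy_of_interp (M.interp_motiveRefl hS hc₁) (hc.sub _)
  rw [← M.El_nat _ c j hc] at hm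
  obtain ⟨e, he, he₁, -⟩ := (hd S hS).of_interpTy hm
  obtain ⟨x, hx, hx₁, -⟩ := ha.of_interpTy hS
  have hr := interp_refl hS hx₁ hx
  have hr' := M.tp_sec_rflGen hx
  have hT := interpTy_of_interp (M.interp_inst₃ hx₁ hx₁ hr hx hx hr' hc₁) (hc.sub _)
  rw [← M.El_nat _ c j hc] at hT
  have h := interp_idrec hS (interpTy_of_interp hc₁ hc) he₁ hx₁ hx₁ hr he hx hx hr'
  have hJ : M.sM (M.reflMap S) (M.J S (M.El c) e he) = e := M.J_beta S (M.El c) e he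
  rw [← M.sec_reflMap, M.sM_comp, hJ] at h
  refine ⟨_, hT, _, ?_, h, M.interp_inst hx₁ hx he₁⟩
  rw [M.tp_sM, he, ← M.sT_comp, M.sec_reflMap]

end Identity

/-! ### Traces -/

section Traces

theorem EqAt.stepT {s s' e e' t t' : Term} (hs : M.EqAt env s s' .state)
    (he : M.EqAt env e e' .event) (ht : M.EqAt env t t' .state) :
    M.EqAt env (.stepT s e t) (.stepT s' e' t') (.univ 0) := by
  obtain ⟨x, hx, hx₁, hx₂⟩ := eqAt_state.1 hs
  obtain ⟨y, hy, hy₁, hy₂⟩ := eqAt_event.1 he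
  obtain ⟨z, hz, hz₁, hz₂⟩ := eqAt_state.1 ht
  obtain ⟨c, hc, hc'⟩ := M.StepT_small x y z hx hy hz
  exact eqAt_univ.2 ⟨c, hc, interp_stepT hx₁ hy₁ hz₁ hx hy hz hc hc',
    interp_stepT hx₂ hy₂ hz₂ hx hy hz hc hc'⟩

theorem EqAt.nil {s s' : Term} (hs : M.EqAt env s s' .state) :
    M.EqAt env (.nil s) (.nil s') .finTrace := by
  obtain ⟨x, hx, hx₁, hx₂⟩ := eqAt_state.1 hs
  exact eqAt_finTrace.2 ⟨_, M.nil_is x hx, interp_nil hx₁ hx, interp_nil hx₂ hx⟩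

theorem EqAt.step {τ τ' e e' s s' : Term} (hτ : M.EqAt env τ τ' .finTrace)
    (he : M.EqAt env e e' .event) (hs : M.EqAt env s s' .state) :
    M.EqAt env (.step τ e s) (.step τ' e' s') .finTrace := by
  obtain ⟨t, ht, ht₁, ht₂⟩ := eqAt_finTrace.1 hτ
  obtain ⟨y, hy, hy₁, hy₂⟩ := eqAt_event.1 he
  obtain ⟨x, hx, hx₁, hx₂⟩ := eqAt_state.1 hs
  exact eqAt_finTrace.2 ⟨_, M.step_is t y x ht hy hx, interp_step ht₁ hy₁ hx₁ ht hy hx,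
    interp_step ht₂ hy₂ hx₂ ht hy hx⟩

theorem EqAt.head {π π' : Term} (h : M.EqAt env π π' .infTrace) :
    M.EqAt env (.head π) (.head π') .state := by
  obtain ⟨x, hx, hx₁, hx₂⟩ := eqAt_infTrace.1 h
  exact eqAt_state.2 ⟨_, M.head_is x hx, interp_head hx₁ hx, interp_head hx₂ hx⟩

variable (M env) in
theorem interpTy_eventInf : M.interpTy Term.eventInf X env =
    some (M.Sig (M.cl X M.Event) (M.cl _ M.InfT)) := by
  obtain ⟨a, ha, ha'⟩ := M.Event_small X
  obtain ⟨b, hb, hb'⟩ := M.InfT_small (M.ext (M.El a))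
  obtain ⟨c, hc, hc'⟩ := M.Sig_small 0 a b ha hb
  have h := interpTy_of_interp (interp_sig (A := .event) (B := .infTrace) (env := env)
    (M.code_eq ha ha') ha rfl (M.code_eq hb hb') hb hc hc') hc
  rw [hc', hb', ha'] at h
  exact h

theorem tp_tail {π : M.Tm X} (h : M.Is π M.InfT) :
    M.tp (M.tail π h) = M.Sig (M.cl X M.Event) (M.cl _ M.InfT) :=
  M.tp_mkPair (M.evt_is π h) _

theorem EqAt.tail {π π' : Term} (h : M.EqAt env π π' .infTrace) :
    M.EqAt env (.tail π) (.tail π') Term.eventInf := by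
  obtain ⟨x, hx, hx₁, hx₂⟩ := eqAt_infTrace.1 h
  exact ⟨_, M.interpTy_eventInf env, _, tp_tail hx, interp_tail hx₁ hx, interp_tail hx₂ hx⟩

section Cofix

variable {A A' s s' e e' r r' a a' : Term} {i : ℕ}

theorem EqAt.cofix (hA : M.EqAt env A A' (.univ i)) (hs : M.BindEqAt env A s s' .state)
    (he : M.BindEqAt env A e e' .event) (hr : M.BindEqAt env A r r' A.wk)
    (ha : M.EqAt env a a' A) :
    M.EqAt env (.cofix A s e r a) (.cofix A' s' e' r' a') .infTrace := by
  obtain ⟨S, hS, hS'⟩ := hA.interpTy_eq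
  obtain ⟨x, hx, hx₁, hx₂⟩ := eqAt_state.1 (hs S hS)
  obtain ⟨y, hy, hy₁, hy₂⟩ := eqAt_event.1 (he S hS)
  obtain ⟨z, hz, hz₁, hz₂⟩ := (hr S hS).of_interpTy (M.interpTy_wk_push S hS)
  obtain ⟨t, ht, ht₁, ht₂⟩ := ha.of_interpTy hS
  exact eqAt_infTrace.2 ⟨_, (M.corec_is hx hy hz).sub _,
    interp_cofix hS hx₁ hy₁ hz₁ ht₁ hx hy hz ht, interp_cofix hS' hx₂ hy₂ hz₂ ht₂ hx hy hz ht⟩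

theorem EqAt.headCofix (hA : M.EqAt env A A (.univ i)) (hs : M.BindEqAt env A s s .state)
    (he : M.BindEqAt env A e e .event) (hr : M.BindEqAt env A r r A.wk)
    (ha : M.EqAt env a a A) : M.EqAt env (.head (.cofix A s e r a)) (s.inst a) .state := by
  obtain ⟨S, hS, -⟩ := hA.interpTy_eq
  obtain ⟨x, hx, hx₁, -⟩ := eqAt_state.1 (hs S hS)
  obtain ⟨y, hy, hy₁, -⟩ := eqAt_event.1 (he S hS)
  obtain ⟨z, hz, hz₁, -⟩ := (hr S hS).of_interpTy (M.interpTy_wk_push S hS)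
  obtain ⟨t, ht, ht₁, -⟩ := ha.of_interpTy hS
  have hc := M.corec_is hx hy hz
  have h := interp_head (interp_cofix hS hx₁ hy₁ hz₁ ht₁ hx hy hz ht) (hc.sub _)
  rw [← M.head_nat _ _ hc, M.head_corec] at h
  exact eqAt_state.2 ⟨_, hx.sub _, h, M.interp_inst ht₁ ht hx₁⟩

theorem EqAt.tailCofix (hA : M.EqAt env A A (.univ i)) (hs : M.BindEqAt env A s s .state)
    (he : M.BindEqAt env A e e .event) (hr : M.BindEqAt env A r r A.wk)
    (ha : M.EqAt env a a A) :
    M.EqAt env (.tail (.cofix A s e r a))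
      (.pair .event .infTrace (e.inst a) (.cofix A s e r (r.inst a))) Term.eventInf := by
  obtain ⟨S, hS, -⟩ := hA.interpTy_eq
  obtain ⟨x, hx, hx₁, -⟩ := eqAt_state.1 (hs S hS)
  obtain ⟨y, hy, hy₁, -⟩ := eqAt_event.1 (he S hS)
  obtain ⟨z, hz, hz₁, -⟩ := (hr S hS).of_interpTy (M.interpTy_wk_push S hS)
  obtain ⟨t, ht, ht₁, -⟩ := ha.of_interpTy hS
  have hc := M.corec_is hx hy hz
  have hz' : M.tp (M.sM (M.sec S t ht) z) = S := by rw [M.tp_sM, hz, M.sT_sec_p]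
  refine ⟨_, M.interpTy_eventInf env, _, tp_tail (hc.sub _),
    interp_tail (interp_cofix hS hx₁ hy₁ hz₁ ht₁ hx hy hz ht) (hc.sub _), ?_⟩
  have h := interp_cofix hS hx₁ hy₁ hz₁ (M.interp_inst ht₁ ht hz₁) hx hy hz hz'
  refine (interp_pair (M.interpTy_event env) (M.interpTy_infTrace _)
    (M.interp_inst ht₁ ht hy₁) h (hy.sub _) ((hc.sub _).trans (M.sT_cl _ _).symm)).trans ?_
  refine congrArg some (M.mkPair_congr rfl HEq.rfl ?_ ?_ _ _ _ _)
  · rw [← M.evt_nat _ _ hc, M.evt_corec]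
  · rw [← M.rest_nat _ _ hc, M.rest_corec, ← M.sM_comp, M.sec_pair_p hz ht hz']

end Cofix

theorem EqAt.ext {τ₁ τ₁' τ₂ τ₂' : Term} (h₁ : M.EqAt env τ₁ τ₁' .finTrace)
    (h₂ : M.EqAt env τ₂ τ₂' .finTrace) : M.EqAt env (.ext τ₁ τ₂) (.ext τ₁' τ₂') (.univ 0) := by
  obtain ⟨x, hx, hx₁, hx₂⟩ := eqAt_finTrace.1 h₁
  obtain ⟨y, hy, hy₁, hy₂⟩ := eqAt_finTrace.1 h₂
  obtain ⟨c, hc, hc'⟩ := M.Ext_small x y hx hy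
  exact eqAt_univ.2 ⟨c, hc, interp_ext hx₁ hy₁ hx hy hc hc', interp_ext hx₂ hy₂ hx hy hc hc'⟩

theorem interpTy_ext {τ₁ τ₂ : Term} {x y : M.Tm X} (h₁ : M.interp τ₁ X env = some x)
    (h₂ : M.interp τ₂ X env = some y) (hx : M.Is x M.FinT) (hy : M.Is y M.FinT) :
    M.interpTy (.ext τ₁ τ₂) X env = some (M.Ext x y) := by
  obtain ⟨c, hc, hc'⟩ := M.Ext_small x y hx hy
  rw [interpTy_of_interp (interp_ext h₁ h₂ hx hy hc hc') hc, hc']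

theorem EqAt.extId {τ τ' : Term} (h : M.EqAt env τ τ' .finTrace) :
    M.EqAt env (.extId τ) (.extId τ') (.ext τ τ) := by
  obtain ⟨x, hx, hx₁, hx₂⟩ := eqAt_finTrace.1 h
  exact ⟨_, interpTy_ext hx₁ hx₁ hx hx, _, M.tp_eid x hx, interp_extId hx₁ hx,
    interp_extId hx₂ hx⟩

theorem EqAt.extComp {τ₁ τ₁' τ₂ τ₂' τ₃ τ₃' ε₁ ε₁' ε₂ ε₂' : Term}
    (h₁ : M.EqAt env τ₁ τ₁' .finTrace) (h₂ : M.EqAt env τ₂ τ₂' .finTrace)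
    (h₃ : M.EqAt env τ₃ τ₃' .finTrace) (hε₁ : M.EqAt env ε₁ ε₁' (.ext τ₁ τ₂))
    (hε₂ : M.EqAt env ε₂ ε₂' (.ext τ₂ τ₃)) :
    M.EqAt env (.extComp τ₁ τ₂ τ₃ ε₁ ε₂) (.extComp τ₁' τ₂' τ₃' ε₁' ε₂') (.ext τ₁ τ₃) := by
  obtain ⟨x, hx, hx₁, hx₂⟩ := eqAt_finTrace.1 h₁
  obtain ⟨y, hy, hy₁, hy₂⟩ := eqAt_finTrace.1 h₂
  obtain ⟨z, hz, hz₁, hz₂⟩ := eqAt_finTrace.1 h₃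
  obtain ⟨e, he, he₁, he₂⟩ := hε₁.of_interpTy (interpTy_ext hx₁ hy₁ hx hy)
  obtain ⟨d, hd, hd₁, hd₂⟩ := hε₂.of_interpTy (interpTy_ext hy₁ hz₁ hy hz)
  exact ⟨_, interpTy_ext hx₁ hz₁ hx hz, _, M.tp_ecomp x y z e d hx hy hz he hd,
    interp_extComp hx₁ hy₁ hz₁ he₁ hd₁ hx hy hz he hd,
    interp_extComp hx₂ hy₂ hz₂ he₂ hd₂ hx hy hz he hd⟩

end Traces

/-! ## Soundness of the computational layer -/

theorem interpCtx_cons {Γ : List Term} {A : Term} {A' : M.Ty X}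
    (hΓ : M.interpCtx Γ = some ⟨X, env⟩) (hA : M.interpTy A X env = some A') :
    M.interpCtx (A :: Γ) = some ⟨M.ext A', M.push A' env⟩ := by
  simp only [interpCtx, hΓ, Option.bind_some, hA, Option.map_some]

theorem exists_of_interpCtx_cons {Γ : List Term} {A : Term}
    {S : Σ X : C, List (M.Tm X)} (h : M.interpCtx (A :: Γ) = some S) :
    ∃ (X : C) (env : List (M.Tm X)) (A' : M.Ty X), M.interpCtx Γ = some ⟨X, env⟩ ∧
      M.interpTy A X env = some A' ∧ S = ⟨M.ext A', M.push A' env⟩ := by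
  simp only [interpCtx, Option.bind_eq_some_iff, Option.map_eq_some_iff] at h
  obtain ⟨⟨X, env⟩, hΓ, A', hA, rfl⟩ := h
  exact ⟨X, env, A', hΓ, hA, rfl⟩

variable (M) in
/-- Semantic validity of `Γ ⊢ t ≡ t' : A`. -/
def ValidEq (Γ : List Term) (t t' A : Term) : Prop :=
  ∃ (X : C) (env : List (M.Tm X)), M.interpCtx Γ = some ⟨X, env⟩ ∧ M.EqAt env t t' A

theorem ValidEq.eqAt {Γ : List Term} {t t' A : Term} (h : M.ValidEq Γ t t' A)
    (hΓ : M.interpCtx Γ = some ⟨X, env⟩) : M.EqAt env t t' A := by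
  obtain ⟨X', env', hΓ', h⟩ := h
  cases hΓ.symm.trans hΓ'
  exact h

theorem ValidEq.bindEqAt {Γ : List Term} {A t t' B : Term} (h : M.ValidEq (A :: Γ) t t' B)
    (hΓ : M.interpCtx Γ = some ⟨X, env⟩) : M.BindEqAt env A t t' B :=
  fun _ hA => h.eqAt (interpCtx_cons hΓ hA)

theorem ValidEq.idBindEqAt {Γ : List Term} {A t t' B : Term}
    (h : M.ValidEq (.idt A.wk.wk (.var 1) (.var 0) :: A.wk :: A :: Γ) t t' B)
    (hΓ : M.interpCtx Γ = some ⟨X, env⟩) : M.IdBindEqAt env A t t' B :=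
  fun S hA => h.eqAt (interpCtx_cons (interpCtx_cons (interpCtx_cons hΓ hA)
    (M.interpTy_wk_push S hA)) (interpTy_idt_generic hA))

theorem interpTy_ren {A : Term} {ξ : ℕ → ℕ} {env' : List (M.Tm X)}
    (h : ∀ n, env'[ξ n]? = env[n]?) : M.interpTy (A.ren ξ) X env' = M.interpTy A X env := by
  rw [interpTy, interpTy, M.interp_ren A ξ h]

theorem eqAt_var {Γ : List Term} {n : ℕ} {A : Term} (hA : Γ[n]? = some A) :
    ∀ {X : C} {env : List (M.Tm X)}, M.interpCtx Γ = some ⟨X, env⟩ →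
      M.EqAt env (.var n) (.var n) (A.ren fun k => k + (n + 1)) := by
  induction Γ generalizing n with
  | nil => simp at hA
  | cons B Γ ih =>
    intro X env hΓ
    obtain ⟨Y, env, B', hΓ', hB, h⟩ := exists_of_interpCtx_cons hΓ
    cases h
    cases n with
    | zero =>
      cases hA
      exact ⟨_, M.interpTy_wk_push B' hB, _, M.tp_q B', rfl, rfl⟩
    | succ n =>
      obtain ⟨T, hT, v, hv, h, -⟩ := ih hA hΓ'
      have h' : M.interp (.var (n + 1)) (M.ext B') (M.push B' env) = some (M.sM (M.p B') v) :=
        M.interp_wk_push B' h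
      refine ⟨_, ?_, _, M.tp_sM_of (M.p B') hv, h', h'⟩
      rw [← M.interpTy_sT (M.p B') hT, interpTy_ren (env := (env.map (M.sM (M.p B'))).drop (n + 1)),
        interpTy_ren (env := (env.map (M.sM (M.p B'))).drop (n + 1))]
      · intro k; rw [List.getElem?_drop, add_comm]
      · intro k
        rw [List.getElem?_drop, CwF.push, ← add_assoc, List.getElem?_cons_succ, add_comm]

variable (M)

mutual

theorem interpCtx_of_wfCtx : ∀ {Γ : List Term}, WfCtx Γ →
    ∃ (X : C) (env : List (M.Tm X)), M.interpCtx Γ = some ⟨X, env⟩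
  | _, .nil => ⟨_, _, rfl⟩
  | _, .cons _ hA => by
    obtain ⟨X, env, hΓ, h⟩ := validEq_of_hasTy hA
    obtain ⟨T, hT, -⟩ := h.interpTy_eq
    exact ⟨_, _, interpCtx_cons hΓ hT⟩

theorem validEq_of_hasTy : ∀ {Γ : List Term} {t A : Term}, HasTy Γ t A → M.ValidEq Γ t t A
  | _, _, _, .var hΓ hA => by
    obtain ⟨X, env, h⟩ := interpCtx_of_wfCtx hΓ
    exact ⟨X, env, h, eqAt_var hA h⟩
  | _, _, _, .conv ht hAB => by
    obtain ⟨X, env, hΓ, h⟩ := validEq_of_hasTy ht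
    exact ⟨X, env, hΓ, h.conv ((validEq_of_defEq hAB).eqAt hΓ)⟩
  | _, _, _, .univ hΓ => by
    obtain ⟨X, env, h⟩ := interpCtx_of_wfCtx hΓ
    exact ⟨X, env, h, eqAt_of_small (M.U_small X _) rfl⟩
  | _, _, _, .pi hA hB => by
    obtain ⟨X, env, hΓ, h⟩ := validEq_of_hasTy hA
    exact ⟨X, env, hΓ, h.pi ((validEq_of_hasTy hB).bindEqAt hΓ)⟩
  | _, _, _, .lam hA hB ht => by
    obtain ⟨X, env, hΓ, h⟩ := validEq_of_hasTy hA
    exact ⟨X, env, hΓ, h.lam ((validEq_of_hasTy hB).bindEqAt hΓ)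
      ((validEq_of_hasTy ht).bindEqAt hΓ)⟩
  | _, _, _, .app hA hB hf ha => by
    obtain ⟨X, env, hΓ, h⟩ := validEq_of_hasTy hA
    exact ⟨X, env, hΓ, h.app ((validEq_of_hasTy hB).bindEqAt hΓ)
      ((validEq_of_hasTy hf).eqAt hΓ) ((validEq_of_hasTy ha).eqAt hΓ)⟩
  | _, _, _, .sig hA hB => by
    obtain ⟨X, env, hΓ, h⟩ := validEq_of_hasTy hA
    exact ⟨X, env, hΓ, h.sig ((validEq_of_hasTy hB).bindEqAt hΓ)⟩
  | _, _, _, .pair hA hB ha hb => by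
    obtain ⟨X, env, hΓ, h⟩ := validEq_of_hasTy hA
    exact ⟨X, env, hΓ, h.pair ((validEq_of_hasTy hB).bindEqAt hΓ)
      ((validEq_of_hasTy ha).eqAt hΓ) ((validEq_of_hasTy hb).eqAt hΓ)⟩
  | _, _, _, .fst hA hB ht => by
    obtain ⟨X, env, hΓ, h⟩ := validEq_of_hasTy hA
    exact ⟨X, env, hΓ, h.fst ((validEq_of_hasTy hB).bindEqAt hΓ)
      ((validEq_of_hasTy ht).eqAt hΓ)⟩
  | _, _, _, .snd hA hB ht => by
    obtain ⟨X, env, hΓ, h⟩ := validEq_of_hasTy hA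
    exact ⟨X, env, hΓ, h.snd ((validEq_of_hasTy hB).bindEqAt hΓ)
      ((validEq_of_hasTy ht).eqAt hΓ)⟩
  | _, _, _, .idt hA ha hb => by
    obtain ⟨X, env, hΓ, h⟩ := validEq_of_hasTy hA
    exact ⟨X, env, hΓ, h.idt ((validEq_of_hasTy ha).eqAt hΓ) ((validEq_of_hasTy hb).eqAt hΓ)⟩
  | _, _, _, .refl hA ha => by
    obtain ⟨X, env, hΓ, h⟩ := validEq_of_hasTy hA
    exact ⟨X, env, hΓ, h.refl ((validEq_of_hasTy ha).eqAt hΓ)⟩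
  | _, _, _, .idrec hA hD hd ha hb hp => by
    obtain ⟨X, env, hΓ, h⟩ := validEq_of_hasTy hA
    exact ⟨X, env, hΓ, h.idrec ((validEq_of_hasTy hD).idBindEqAt hΓ)
      ((validEq_of_hasTy hd).bindEqAt hΓ) ((validEq_of_hasTy ha).eqAt hΓ)
      ((validEq_of_hasTy hb).eqAt hΓ) ((validEq_of_hasTy hp).eqAt hΓ)⟩
  | _, _, _, .state hΓ => by
    obtain ⟨X, env, h⟩ := interpCtx_of_wfCtx hΓ
    exact ⟨X, env, h, eqAt_of_small (M.State_small X) rfl⟩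
  | _, _, _, .event hΓ => by
    obtain ⟨X, env, h⟩ := interpCtx_of_wfCtx hΓ
    exact ⟨X, env, h, eqAt_of_small (M.Event_small X) rfl⟩
  | _, _, _, .nat hΓ => by
    obtain ⟨X, env, h⟩ := interpCtx_of_wfCtx hΓ
    exact ⟨X, env, h, eqAt_of_small (M.NatT_small X) rfl⟩
  | _, _, _, .stepT hs he ht => by
    obtain ⟨X, env, hΓ, h⟩ := validEq_of_hasTy hs
    exact ⟨X, env, hΓ, h.stepT ((validEq_of_hasTy he).eqAt hΓ) ((validEq_of_hasTy ht).eqAt hΓ)⟩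
  | _, _, _, .finTrace hΓ => by
    obtain ⟨X, env, h⟩ := interpCtx_of_wfCtx hΓ
    exact ⟨X, env, h, eqAt_of_small (M.FinT_small X) rfl⟩
  | _, _, _, .nil hs => by
    obtain ⟨X, env, hΓ, h⟩ := validEq_of_hasTy hs
    exact ⟨X, env, hΓ, h.nil⟩
  | _, _, _, .step hτ he hs => by
    obtain ⟨X, env, hΓ, h⟩ := validEq_of_hasTy hτ
    exact ⟨X, env, hΓ, h.step ((validEq_of_hasTy he).eqAt hΓ) ((validEq_of_hasTy hs).eqAt hΓ)⟩
  | _, _, _, .infTrace hΓ => by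
    obtain ⟨X, env, h⟩ := interpCtx_of_wfCtx hΓ
    exact ⟨X, env, h, eqAt_of_small (M.InfT_small X) rfl⟩
  | _, _, _, .head hπ => by
    obtain ⟨X, env, hΓ, h⟩ := validEq_of_hasTy hπ
    exact ⟨X, env, hΓ, h.head⟩
  | _, _, _, .tail hπ => by
    obtain ⟨X, env, hΓ, h⟩ := validEq_of_hasTy hπ
    exact ⟨X, env, hΓ, h.tail⟩
  | _, _, _, .cofix hA hs he hr ha => by
    obtain ⟨X, env, hΓ, h⟩ := validEq_of_hasTy hA
    exact ⟨X, env, hΓ, h.cofix ((validEq_of_hasTy hs).bindEqAt hΓ)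
      ((validEq_of_hasTy he).bindEqAt hΓ) ((validEq_of_hasTy hr).bindEqAt hΓ)
      ((validEq_of_hasTy ha).eqAt hΓ)⟩
  | _, _, _, .ext h₁ h₂ => by
    obtain ⟨X, env, hΓ, h⟩ := validEq_of_hasTy h₁
    exact ⟨X, env, hΓ, h.ext ((validEq_of_hasTy h₂).eqAt hΓ)⟩
  | _, _, _, .extId h₁ => by
    obtain ⟨X, env, hΓ, h⟩ := validEq_of_hasTy h₁
    exact ⟨X, env, hΓ, h.extId⟩
  | _, _, _, .extComp h₁ h₂ h₃ h₄ h₅ => by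
    obtain ⟨X, env, hΓ, h⟩ := validEq_of_hasTy h₁
    exact ⟨X, env, hΓ, h.extComp ((validEq_of_hasTy h₂).eqAt hΓ) ((validEq_of_hasTy h₃).eqAt hΓ)
      ((validEq_of_hasTy h₄).eqAt hΓ) ((validEq_of_hasTy h₅).eqAt hΓ)⟩

theorem validEq_of_defEq : ∀ {Γ : List Term} {t t' A : Term}, DefEq Γ t t' A → M.ValidEq Γ t t' A
  | _, _, _, _, .rfl h => validEq_of_hasTy h
  | _, _, _, _, .symm h => by
    obtain ⟨X, env, hΓ, h⟩ := validEq_of_defEq h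
    exact ⟨X, env, hΓ, h.symm⟩
  | _, _, _, _, .trans h h' => by
    obtain ⟨X, env, hΓ, h⟩ := validEq_of_defEq h
    exact ⟨X, env, hΓ, h.trans ((validEq_of_defEq h').eqAt hΓ)⟩
  | _, _, _, _, .conv h h' => by
    obtain ⟨X, env, hΓ, h⟩ := validEq_of_defEq h
    exact ⟨X, env, hΓ, h.conv ((validEq_of_defEq h').eqAt hΓ)⟩
  | _, _, _, _, .piBeta hA hB ht ha => by
    obtain ⟨X, env, hΓ, h⟩ := validEq_of_hasTy hA
    exact ⟨X, env, hΓ, h.piBeta ((validEq_of_hasTy hB).bindEqAt hΓ)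
      ((validEq_of_hasTy ht).bindEqAt hΓ) ((validEq_of_hasTy ha).eqAt hΓ)⟩
  | _, _, _, _, .piEta hA hB hf => by
    obtain ⟨X, env, hΓ, h⟩ := validEq_of_hasTy hA
    exact ⟨X, env, hΓ, h.piEta ((validEq_of_hasTy hB).bindEqAt hΓ)
      ((validEq_of_hasTy hf).eqAt hΓ)⟩
  | _, _, _, _, .fstBeta hA hB ha hb => by
    obtain ⟨X, env, hΓ, h⟩ := validEq_of_hasTy hA
    exact ⟨X, env, hΓ, h.fstBeta ((validEq_of_hasTy hB).bindEqAt hΓ)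
      ((validEq_of_hasTy ha).eqAt hΓ) ((validEq_of_hasTy hb).eqAt hΓ)⟩
  | _, _, _, _, .sndBeta hA hB ha hb => by
    obtain ⟨X, env, hΓ, h⟩ := validEq_of_hasTy hA
    exact ⟨X, env, hΓ, h.sndBeta ((validEq_of_hasTy hB).bindEqAt hΓ)
      ((validEq_of_hasTy ha).eqAt hΓ) ((validEq_of_hasTy hb).eqAt hΓ)⟩
  | _, _, _, _, .sigEta hA hB ht => by
    obtain ⟨X, env, hΓ, h⟩ := validEq_of_hasTy hA
    exact ⟨X, env, hΓ, h.sigEta ((validEq_of_hasTy hB).bindEqAt hΓ)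
      ((validEq_of_hasTy ht).eqAt hΓ)⟩
  | _, _, _, _, .idBeta hA hD hd ha => by
    obtain ⟨X, env, hΓ, h⟩ := validEq_of_hasTy hA
    exact ⟨X, env, hΓ, h.idBeta ((validEq_of_hasTy hD).idBindEqAt hΓ)
      ((validEq_of_hasTy hd).bindEqAt hΓ) ((validEq_of_hasTy ha).eqAt hΓ)⟩
  | _, _, _, _, .headCofix hA hs he hr ha => by
    obtain ⟨X, env, hΓ, h⟩ := validEq_of_hasTy hA
    exact ⟨X, env, hΓ, h.headCofix ((validEq_of_hasTy hs).bindEqAt hΓ)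
      ((validEq_of_hasTy he).bindEqAt hΓ) ((validEq_of_hasTy hr).bindEqAt hΓ)
      ((validEq_of_hasTy ha).eqAt hΓ)⟩
  | _, _, _, _, .tailCofix hA hs he hr ha => by
    obtain ⟨X, env, hΓ, h⟩ := validEq_of_hasTy hA
    exact ⟨X, env, hΓ, h.tailCofix ((validEq_of_hasTy hs).bindEqAt hΓ)
      ((validEq_of_hasTy he).bindEqAt hΓ) ((validEq_of_hasTy hr).bindEqAt hΓ)
      ((validEq_of_hasTy ha).eqAt hΓ)⟩
  | _, _, _, _, .pi hA hB => by
    obtain ⟨X, env, hΓ, h⟩ := validEq_of_defEq hA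
    exact ⟨X, env, hΓ, h.pi ((validEq_of_defEq hB).bindEqAt hΓ)⟩
  | _, _, _, _, .lam hA hB ht => by
    obtain ⟨X, env, hΓ, h⟩ := validEq_of_defEq hA
    exact ⟨X, env, hΓ, h.lam ((validEq_of_defEq hB).bindEqAt hΓ)
      ((validEq_of_defEq ht).bindEqAt hΓ)⟩
  | _, _, _, _, .app hA hB hf ha => by
    obtain ⟨X, env, hΓ, h⟩ := validEq_of_defEq hA
    exact ⟨X, env, hΓ, h.app ((validEq_of_defEq hB).bindEqAt hΓ)
      ((validEq_of_defEq hf).eqAt hΓ) ((validEq_of_defEq ha).eqAt hΓ)⟩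
  | _, _, _, _, .sig hA hB => by
    obtain ⟨X, env, hΓ, h⟩ := validEq_of_defEq hA
    exact ⟨X, env, hΓ, h.sig ((validEq_of_defEq hB).bindEqAt hΓ)⟩
  | _, _, _, _, .pair hA hB ha hb => by
    obtain ⟨X, env, hΓ, h⟩ := validEq_of_defEq hA
    exact ⟨X, env, hΓ, h.pair ((validEq_of_defEq hB).bindEqAt hΓ)
      ((validEq_of_defEq ha).eqAt hΓ) ((validEq_of_defEq hb).eqAt hΓ)⟩
  | _, _, _, _, .fst hA hB ht => by
    obtain ⟨X, env, hΓ, h⟩ := validEq_of_defEq hA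
    exact ⟨X, env, hΓ, h.fst ((validEq_of_defEq hB).bindEqAt hΓ)
      ((validEq_of_defEq ht).eqAt hΓ)⟩
  | _, _, _, _, .snd hA hB ht => by
    obtain ⟨X, env, hΓ, h⟩ := validEq_of_defEq hA
    exact ⟨X, env, hΓ, h.snd ((validEq_of_defEq hB).bindEqAt hΓ)
      ((validEq_of_defEq ht).eqAt hΓ)⟩
  | _, _, _, _, .idt hA ha hb => by
    obtain ⟨X, env, hΓ, h⟩ := validEq_of_defEq hA
    exact ⟨X, env, hΓ, h.idt ((validEq_of_defEq ha).eqAt hΓ) ((validEq_of_defEq hb).eqAt hΓ)⟩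
  | _, _, _, _, .refl hA ha => by
    obtain ⟨X, env, hΓ, h⟩ := validEq_of_defEq hA
    exact ⟨X, env, hΓ, h.refl ((validEq_of_defEq ha).eqAt hΓ)⟩
  | _, _, _, _, .idrec hA hD hd ha hb hp => by
    obtain ⟨X, env, hΓ, h⟩ := validEq_of_defEq hA
    exact ⟨X, env, hΓ, h.idrec ((validEq_of_defEq hD).idBindEqAt hΓ)
      ((validEq_of_defEq hd).bindEqAt hΓ) ((validEq_of_defEq ha).eqAt hΓ)
      ((validEq_of_defEq hb).eqAt hΓ) ((validEq_of_defEq hp).eqAt hΓ)⟩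
  | _, _, _, _, .stepT hs he ht => by
    obtain ⟨X, env, hΓ, h⟩ := validEq_of_defEq hs
    exact ⟨X, env, hΓ, h.stepT ((validEq_of_defEq he).eqAt hΓ) ((validEq_of_defEq ht).eqAt hΓ)⟩
  | _, _, _, _, .nil hs => by
    obtain ⟨X, env, hΓ, h⟩ := validEq_of_defEq hs
    exact ⟨X, env, hΓ, h.nil⟩
  | _, _, _, _, .step hτ he hs => by
    obtain ⟨X, env, hΓ, h⟩ := validEq_of_defEq hτ
    exact ⟨X, env, hΓ, h.step ((validEq_of_defEq he).eqAt hΓ) ((validEq_of_defEq hs).eqAt hΓ)⟩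
  | _, _, _, _, .head hπ => by
    obtain ⟨X, env, hΓ, h⟩ := validEq_of_defEq hπ
    exact ⟨X, env, hΓ, h.head⟩
  | _, _, _, _, .tail hπ => by
    obtain ⟨X, env, hΓ, h⟩ := validEq_of_defEq hπ
    exact ⟨X, env, hΓ, h.tail⟩
  | _, _, _, _, .cofix hA hs he hr ha => by
    obtain ⟨X, env, hΓ, h⟩ := validEq_of_defEq hA
    exact ⟨X, env, hΓ, h.cofix ((validEq_of_defEq hs).bindEqAt hΓ)
      ((validEq_of_defEq he).bindEqAt hΓ) ((validEq_of_defEq hr).bindEqAt hΓ)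
      ((validEq_of_defEq ha).eqAt hΓ)⟩
  | _, _, _, _, .ext h₁ h₂ => by
    obtain ⟨X, env, hΓ, h⟩ := validEq_of_defEq h₁
    exact ⟨X, env, hΓ, h.ext ((validEq_of_defEq h₂).eqAt hΓ)⟩
  | _, _, _, _, .extId h₁ => by
    obtain ⟨X, env, hΓ, h⟩ := validEq_of_defEq h₁
    exact ⟨X, env, hΓ, h.extId⟩
  | _, _, _, _, .extComp h₁ h₂ h₃ h₄ h₅ => by
    obtain ⟨X, env, hΓ, h⟩ := validEq_of_defEq h₁
    exact ⟨X, env, hΓ, h.extComp ((validEq_of_defEq h₂).eqAt hΓ) ((validEq_of_defEq h₃).eqAt hΓ)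
      ((validEq_of_defEq h₄).eqAt hΓ) ((validEq_of_defEq h₅).eqAt hΓ)⟩

end

end CompModel

/-! ## Inverse images of propositions -/

section PropL

variable {C : Type u} [Category.{v} C] [HasFiniteLimits C] {X Y Z : C}

theorem pb_id (P : PropL X) : pb (𝟙 X) P = P := Subobject.pullback_id P

theorem pb_comp (g : Z ⟶ Y) (f : Y ⟶ X) (P : PropL X) : pb (g ≫ f) P = pb g (pb f P) :=
  Subobject.pullback_comp g f P

theorem pb_mono (f : Y ⟶ X) {P Q : PropL X} (h : P ≤ Q) : pb f P ≤ pb f Q :=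
  (Subobject.pullback f).monotone h

theorem map_pb_id (ρ : List (PropL X)) : ρ.map (pb (𝟙 X)) = ρ := by
  conv_rhs => rw [← List.map_id ρ]
  exact List.map_congr_left fun P _ => pb_id P

theorem map_pb_comp (g : Z ⟶ Y) (f : Y ⟶ X) (ρ : List (PropL X)) :
    ρ.map (pb (g ≫ f)) = (ρ.map (pb f)).map (pb g) := by
  rw [List.map_map]
  exact List.map_congr_left fun P _ => pb_comp g f P

/-- The lists `ρ` and `ρ'` agree except at the position `k`, where `ρ` is at most `ρ'`. -/
def LeAt (k : ℕ) (ρ ρ' : List (PropL X)) : Prop :=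
  (∀ j, j ≠ k → ρ[j]? = ρ'[j]?) ∧ ∀ Q Q', ρ[k]? = some Q → ρ'[k]? = some Q' → Q ≤ Q'

theorem LeAt.map_pb {k : ℕ} {ρ ρ' : List (PropL X)} (h : LeAt k ρ ρ') (f : Y ⟶ X) :
    LeAt k (ρ.map (pb f)) (ρ'.map (pb f)) := by
  refine ⟨fun j hj => by rw [List.getElem?_map, List.getElem?_map, h.1 j hj], fun Q Q' hQ hQ' => ?_⟩
  rw [List.getElem?_map, Option.map_eq_some_iff] at hQ hQ'
  obtain ⟨R, hR, rfl⟩ := hQ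
  obtain ⟨R', hR', rfl⟩ := hQ'
  exact pb_mono f (h.2 _ _ hR hR')

theorem LeAt.cons {k : ℕ} {ρ ρ' : List (PropL X)} (h : LeAt k ρ ρ') (Q : PropL X) :
    LeAt (k + 1) (Q :: ρ) (Q :: ρ') := by
  refine ⟨fun j hj => ?_, fun R R' => h.2 R R'⟩
  cases j with
  | zero => rfl
  | succ j => exact h.1 j (by omega)

theorem leAt_zero_cons {Q Q' : PropL X} (h : Q ≤ Q') (ρ : List (PropL X)) :
    LeAt 0 (Q :: ρ) (Q' :: ρ) := by
  refine ⟨fun j hj => ?_, ?_⟩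
  · cases j with
    | zero => exact absurd rfl hj
    | succ j => rfl
  · rintro _ _ ⟨⟩ ⟨⟩
    exact h

end PropL

namespace Model

variable {C : Type u} [Category.{v} C] [HasFiniteLimits C] [HasLimitsOfShape ℕᵒᵖ C]
  {Tf : Type z} [SmallCategory Tf] (M : Model.{u, v, w, z} C Tf)

/-! ## Fixed points -/

variable {M}

theorem IsLfp.unique {X : C} {F : PropL X → Option (PropL X)} {m m' : PropL X} (h : IsLfp F m)
    (h' : IsLfp F m') : m = m' :=
  le_antisymm (h.2 _ _ h'.1 le_rfl) (h'.2 _ _ h.1 le_rfl)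

theorem IsGfp.unique {X : C} {F : PropL X → Option (PropL X)} {m m' : PropL X} (h : IsGfp F m)
    (h' : IsGfp F m') : m = m' :=
  le_antisymm (h'.2 _ _ h.1 le_rfl) (h.2 _ _ h'.1 le_rfl)

theorem interpP_mu_eq_some {P : Prp} {X : C} {env : List (M.Tm X)} {ρ : List (PropL X)}
    {m : PropL X} : M.interpP (.mu P) X env ρ = some m ↔
      IsLfp (fun Q => M.interpP P X env (Q :: ρ)) m := by
  rw [interpP]
  constructor
  · intro h
    split_ifs at h with h'
    cases h
    exact h'.choose_spec
  · intro h
    have h' : ∃ m, IsLfp (fun Q => M.interpP P X env (Q :: ρ)) m := ⟨m, h⟩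
    rw [dif_pos h', h'.choose_spec.unique h]

theorem interpP_nu_eq_some {P : Prp} {X : C} {env : List (M.Tm X)} {ρ : List (PropL X)}
    {m : PropL X} : M.interpP (.nu P) X env ρ = some m ↔
      IsGfp (fun Q => M.interpP P X env (Q :: ρ)) m := by
  rw [interpP]
  constructor
  · intro h
    split_ifs at h with h'
    cases h
    exact h'.choose_spec
  · intro h
    have h' : ∃ m, IsGfp (fun Q => M.interpP P X env (Q :: ρ)) m := ⟨m, h⟩
    rw [dif_pos h', h'.choose_spec.unique h]

theorem interpP_mu_congr {P P' : Prp} {X : C} {env env' : List (M.Tm X)} {ρ ρ' : List (PropL X)}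
    (h : ∀ Q, M.interpP P X env (Q :: ρ) = M.interpP P' X env' (Q :: ρ')) :
    M.interpP (.mu P) X env ρ = M.interpP (.mu P') X env' ρ' :=
  Option.ext fun m => by rw [interpP_mu_eq_some, interpP_mu_eq_some, funext h]

theorem interpP_nu_congr {P P' : Prp} {X : C} {env env' : List (M.Tm X)} {ρ ρ' : List (PropL X)}
    (h : ∀ Q, M.interpP P X env (Q :: ρ) = M.interpP P' X env' (Q :: ρ')) :
    M.interpP (.nu P) X env ρ = M.interpP (.nu P') X env' ρ' :=
  Option.ext fun m => by rw [interpP_nu_eq_some, interpP_nu_eq_some, funext h]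

variable (M)

/-! ## Renaming and substitution in propositions -/

theorem getElem?_cons_upR {α : Type*} {ξ : ℕ → ℕ} {l l' : List α} (h : ∀ k, l'[ξ k]? = l[k]?)
    (a : α) (k : ℕ) : (a :: l')[Term.upR ξ k]? = (a :: l)[k]? := by
  cases k with
  | zero => rfl
  | succ k => exact h k

theorem interpP_pren (P : Prp) : ∀ (ξ : ℕ → ℕ) {X : C} {env : List (M.Tm X)}
    {ρ ρ' : List (PropL X)}, (∀ k, ρ'[ξ k]? = ρ[k]?) →
      M.interpP (P.pren ξ) X env ρ' = M.interpP P X env ρ := by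
  induction P with
  | pvar k => intro ξ X env ρ ρ' h; exact h k
  | top | bot => intros; rfl
  | and P Q ihP ihQ | or P Q ihP ihQ | imp P Q ihP ihQ =>
    intro ξ X env ρ ρ' h
    simp only [Prp.pren, interpP, ihP ξ h, ihQ ξ h]
  | all A P ih | ex A P ih =>
    intro ξ X env ρ ρ' h
    have hP : ∀ A', M.interpP (P.pren ξ) (M.ext A') (M.push A' env) (ρ'.map (pb (M.p A'))) =
        M.interpP P (M.ext A') (M.push A' env) (ρ.map (pb (M.p A'))) :=
      fun A' => ih ξ fun k => by rw [List.getElem?_map, List.getElem?_map, h]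
    simp only [Prp.pren, interpP, hP]
  | mu P ih =>
    intro ξ X env ρ ρ' h
    exact interpP_mu_congr fun Q => ih _ (getElem?_cons_upR h Q)
  | nu P ih =>
    intro ξ X env ρ ρ' h
    exact interpP_nu_congr fun Q => ih _ (getElem?_cons_upR h Q)

theorem interpP_tren (P : Prp) : ∀ (ξ : ℕ → ℕ) {X : C} {env env' : List (M.Tm X)}
    {ρ : List (PropL X)}, (∀ n, env'[ξ n]? = env[n]?) →
      M.interpP (P.tren ξ) X env' ρ = M.interpP P X env ρ := by
  induction P with
  | pvar k => intros; rfl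
  | top | bot => intros; rfl
  | and P Q ihP ihQ | or P Q ihP ihQ | imp P Q ihP ihQ =>
    intro ξ X env env' ρ h
    simp only [Prp.tren, interpP, ihP ξ h, ihQ ξ h]
  | all A P ih | ex A P ih =>
    intro ξ X env env' ρ h
    have hP := fun A' => ih (Term.upR ξ) (ρ := ρ.map (pb (M.p A'))) (M.getElem?_push_upR h A')
    simp only [Prp.tren, interpP, hP, CompModel.interpTy_ren h]
  | mu P ih =>
    intro ξ X env env' ρ h
    exact interpP_mu_congr fun Q => ih ξ h
  | nu P ih =>
    intro ξ X env env' ρ h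
    exact interpP_nu_congr fun Q => ih ξ h

/-- The substitution `σ` takes, with the values `ρ'` of the propositional variables, the values
listed in `ρ`, in all contexts over `X`. -/
def PSubstTo (σ : ℕ → Prp) {X : C} (env : List (M.Tm X)) (ρ' ρ : List (PropL X)) : Prop :=
  ∀ (k : ℕ) {Y : C} (f : Y ⟶ X),
    M.interpP (σ k) Y (env.map (M.sM f)) (ρ'.map (pb f)) = (ρ[k]?).map (pb f)

variable {M}

theorem PSubstTo.interpP_eq {σ : ℕ → Prp} {X : C} {env : List (M.Tm X)} {ρ' ρ : List (PropL X)}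
    (h : M.PSubstTo σ env ρ' ρ) (k : ℕ) : M.interpP (σ k) X env ρ' = ρ[k]? := by
  have := h k (𝟙 X)
  rw [M.map_sM_id, map_pb_id] at this
  rw [this]
  cases ρ[k]? with
  | none => rfl
  | some Q => exact congrArg some (pb_id Q)

theorem PSubstTo.push {σ : ℕ → Prp} {X : C} {env : List (M.Tm X)} {ρ' ρ : List (PropL X)}
    (h : M.PSubstTo σ env ρ' ρ) (A : M.Ty X) :
    M.PSubstTo (fun k => (σ k).tren Nat.succ) (M.push A env) (ρ'.map (pb (M.p A)))
      (ρ.map (pb (M.p A))) := by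
  intro k Y f
  rw [M.interpP_tren (σ k) Nat.succ (env := env.map (M.sM (f ≫ M.p A))), ← map_pb_comp, h k,
    List.getElem?_map, Option.map_map]
  · congr 1
    exact funext fun Q => pb_comp _ _ _
  · intro n
    rw [M.map_sM_comp, CwF.push, List.map_cons, Nat.succ_eq_add_one, List.getElem?_cons_succ]

theorem PSubstTo.up {σ : ℕ → Prp} {X : C} {env : List (M.Tm X)} {ρ' ρ : List (PropL X)}
    (h : M.PSubstTo σ env ρ' ρ) (Q : PropL X) :
    M.PSubstTo (Prp.upP σ) env (Q :: ρ') (Q :: ρ) := by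
  intro k Y f
  cases k with
  | zero => rfl
  | succ k =>
    refine Eq.trans ?_ (h k f)
    exact M.interpP_pren (σ k) Nat.succ fun k => by simp

variable (M)

theorem interpP_psub (P : Prp) : ∀ {σ : ℕ → Prp} {X : C} {env : List (M.Tm X)}
    {ρ ρ' : List (PropL X)}, M.PSubstTo σ env ρ' ρ →
      M.interpP (P.psub σ) X env ρ' = M.interpP P X env ρ := by
  induction P with
  | pvar k => intro σ X env ρ ρ' h; exact h.interpP_eq k
  | top | bot => intros; rfl
  | and P Q ihP ihQ | or P Q ihP ihQ | imp P Q ihP ihQ =>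
    intro σ X env ρ ρ' h
    simp only [Prp.psub, interpP, ihP h, ihQ h]
  | all A P ih | ex A P ih =>
    intro σ X env ρ ρ' h
    have hP := fun A' => ih (h.push A')
    simp only [Prp.psub, interpP, hP]
  | mu P ih =>
    intro σ X env ρ ρ' h
    exact interpP_mu_congr fun Q => ih (h.up Q)
  | nu P ih =>
    intro σ X env ρ ρ' h
    exact interpP_nu_congr fun Q => ih (h.up Q)

variable {M}


/-! ## Stable propositions -/

variable (M) in
/-- In all contexts over `X`, the proposition `P` has a value for all values of the `n`
propositional variables; this value is natural in the context, and monotone (antitone) in the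
variables that occur only positively (negatively). -/
structure Stable (P : Prp) {X : C} (env : List (M.Tm X)) (n : ℕ) : Prop where
  defined : ∀ {Y : C} (f : Y ⟶ X) (ρ : List (PropL Y)), ρ.length = n →
    ∃ Q, M.interpP P Y (env.map (M.sM f)) ρ = some Q
  nat : ∀ {Y Z : C} (g : Z ⟶ Y) (f : Y ⟶ X) (ρ : List (PropL Y)) (Q : PropL Y), ρ.length = n →
    M.interpP P Y (env.map (M.sM f)) ρ = some Q →
    M.interpP P Z (env.map (M.sM (g ≫ f))) (ρ.map (pb g)) = some (pb g Q)
  mono : ∀ {Y : C} (f : Y ⟶ X) (ρ ρ' : List (PropL Y)) (Q Q' : PropL Y) (k : ℕ),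
    ρ.length = n → ρ'.length = n → LeAt k ρ ρ' →
    M.interpP P Y (env.map (M.sM f)) ρ = some Q → M.interpP P Y (env.map (M.sM f)) ρ' = some Q' →
    (P.Occ true k → Q ≤ Q') ∧ (P.Occ false k → Q' ≤ Q)

section Stable

variable {X : C} {env : List (M.Tm X)} {n : ℕ}

theorem stable_pvar {k : ℕ} (hk : k < n) : M.Stable (.pvar k) env n where
  defined f ρ hρ := ⟨ρ[k], List.getElem?_eq_getElem (hρ ▸ hk)⟩
  nat g f ρ Q hρ h := by
    simp only [interpP] at h ⊢
    rw [List.getElem?_map, h, Option.map_some]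
  mono f ρ ρ' Q Q' j hρ hρ' hle h h' := by
    simp only [interpP] at h h'
    by_cases hj : k = j
    · subst hj
      exact ⟨fun _ => hle.2 _ _ h h', fun ho => by simp [Prp.Occ] at ho⟩
    · have := hle.1 k hj
      rw [h, h'] at this
      cases this
      exact ⟨fun _ => le_rfl, fun _ => le_rfl⟩

theorem stable_top : M.Stable .top env n where
  defined f ρ hρ := ⟨_, rfl⟩
  nat g f ρ Q hρ h := by
    cases h
    exact congrArg some (Subobject.pullback_top g).symm
  mono f ρ ρ' Q Q' j hρ hρ' hle h h' := by
    cases h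
    cases h'
    exact ⟨fun _ => le_rfl, fun _ => le_rfl⟩

theorem stable_bot : M.Stable .bot env n where
  defined f ρ hρ := ⟨_, rfl⟩
  nat g f ρ Q hρ h := by
    cases h
    exact congrArg some (M.pb_bot g).symm
  mono f ρ ρ' Q Q' j hρ hρ' hle h h' := by
    cases h
    cases h'
    exact ⟨fun _ => le_rfl, fun _ => le_rfl⟩

variable {P P' : Prp}

theorem Stable.and (hP : M.Stable P env n) (hQ : M.Stable P' env n) :
    M.Stable (.and P P') env n where
  defined f ρ hρ := by
    obtain ⟨R, hR⟩ := hP.defined f ρ hρ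
    obtain ⟨R', hR'⟩ := hQ.defined f ρ hρ
    exact ⟨R ⊓ R', by simp only [interpP, hR, hR', Option.bind_some, Option.map_some]⟩
  nat g f ρ Q hρ h := by
    simp only [interpP, Option.bind_eq_some_iff, Option.map_eq_some_iff] at h
    obtain ⟨R, hR, R', hR', rfl⟩ := h
    simp only [interpP, hP.nat g f ρ R hρ hR, hQ.nat g f ρ R' hρ hR', Option.bind_some,
      Option.map_some, Subobject.inf_pullback]
  mono f ρ ρ' Q Q' k hρ hρ' hle h h' := by
    simp only [interpP, Option.bind_eq_some_iff, Option.map_eq_some_iff] at h h'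
    obtain ⟨R, hR, S, hS, rfl⟩ := h
    obtain ⟨R', hR', S', hS', rfl⟩ := h'
    obtain ⟨h₁, h₂⟩ := hP.mono f ρ ρ' _ _ k hρ hρ' hle hR hR'
    obtain ⟨h₃, h₄⟩ := hQ.mono f ρ ρ' _ _ k hρ hρ' hle hS hS'
    exact ⟨fun ho => inf_le_inf (h₁ ho.1) (h₃ ho.2), fun ho => inf_le_inf (h₂ ho.1) (h₄ ho.2)⟩

variable (M) in
theorem sup_le_sup {R R' S S' : PropL X} (h : R ≤ R') (h' : S ≤ S') :
    M.sup R S ≤ M.sup R' S' := by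
  have := (M.sup_le R' S' _).1 le_rfl
  exact (M.sup_le _ _ _).2 ⟨h.trans this.1, h'.trans this.2⟩

variable (M) in
theorem imp_le_imp {R R' S S' : PropL X} (h : R' ≤ R) (h' : S ≤ S') :
    M.imp R S ≤ M.imp R' S' :=
  (M.le_imp _ _ _).2 ((inf_le_inf le_rfl h).trans (((M.le_imp _ _ _).1 le_rfl).trans h'))

variable (M) in
theorem all_le_all (A : M.Ty X) {R R' : PropL (M.ext A)} (h : R ≤ R') :
    M.all A R ≤ M.all A R' :=
  (M.le_all _ _ _).2 (((M.le_all _ _ _).1 le_rfl).trans h)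

variable (M) in
theorem ex_le_ex (A : M.Ty X) {R R' : PropL (M.ext A)} (h : R ≤ R') :
    M.ex A R ≤ M.ex A R' :=
  (M.ex_le _ _ _).2 (h.trans ((M.ex_le _ _ _).1 le_rfl))

theorem Stable.or (hP : M.Stable P env n) (hQ : M.Stable P' env n) :
    M.Stable (.or P P') env n where
  defined f ρ hρ := by
    obtain ⟨R, hR⟩ := hP.defined f ρ hρ
    obtain ⟨R', hR'⟩ := hQ.defined f ρ hρ
    exact ⟨M.sup R R', by simp only [interpP, hR, hR', Option.bind_some, Option.map_some]⟩
  nat g f ρ Q hρ h := by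
    simp only [interpP, Option.bind_eq_some_iff, Option.map_eq_some_iff] at h
    obtain ⟨R, hR, R', hR', rfl⟩ := h
    simp only [interpP, hP.nat g f ρ R hρ hR, hQ.nat g f ρ R' hρ hR', Option.bind_some,
      Option.map_some, M.pb_sup]
  mono f ρ ρ' Q Q' k hρ hρ' hle h h' := by
    simp only [interpP, Option.bind_eq_some_iff, Option.map_eq_some_iff] at h h'
    obtain ⟨R, hR, S, hS, rfl⟩ := h
    obtain ⟨R', hR', S', hS', rfl⟩ := h'
    obtain ⟨h₁, h₂⟩ := hP.mono f ρ ρ' _ _ k hρ hρ' hle hR hR'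
    obtain ⟨h₃, h₄⟩ := hQ.mono f ρ ρ' _ _ k hρ hρ' hle hS hS'
    exact ⟨fun ho => M.sup_le_sup (h₁ ho.1) (h₃ ho.2),
      fun ho => M.sup_le_sup (h₂ ho.1) (h₄ ho.2)⟩

theorem Stable.imp (hP : M.Stable P env n) (hQ : M.Stable P' env n) :
    M.Stable (.imp P P') env n where
  defined f ρ hρ := by
    obtain ⟨R, hR⟩ := hP.defined f ρ hρ
    obtain ⟨R', hR'⟩ := hQ.defined f ρ hρ
    exact ⟨M.imp R R', by simp only [interpP, hR, hR', Option.bind_some, Option.map_some]⟩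
  nat g f ρ Q hρ h := by
    simp only [interpP, Option.bind_eq_some_iff, Option.map_eq_some_iff] at h
    obtain ⟨R, hR, R', hR', rfl⟩ := h
    simp only [interpP, hP.nat g f ρ R hρ hR, hQ.nat g f ρ R' hρ hR', Option.bind_some,
      Option.map_some, M.pb_imp]
  mono f ρ ρ' Q Q' k hρ hρ' hle h h' := by
    simp only [interpP, Option.bind_eq_some_iff, Option.map_eq_some_iff] at h h'
    obtain ⟨R, hR, S, hS, rfl⟩ := h
    obtain ⟨R', hR', S', hS', rfl⟩ := h'
    obtain ⟨h₁, h₂⟩ := hP.mono f ρ ρ' _ _ k hρ hρ' hle hR hR'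
    obtain ⟨h₃, h₄⟩ := hQ.mono f ρ ρ' _ _ k hρ hρ' hle hS hS'
    exact ⟨fun ho => M.imp_le_imp (h₂ ho.1) (h₃ ho.2),
      fun ho => M.imp_le_imp (h₁ ho.1) (h₄ ho.2)⟩

section Quantifiers

variable {A : Term} {A' : M.Ty X}

/-- Interpretation under a binder, in a context over `X`. -/
theorem Stable.nat_push (hP : M.Stable P (M.push A' env) n) {Y Z : C} (g : Z ⟶ Y) (f : Y ⟶ X)
    (ρ : List (PropL Y)) (Q : PropL (M.ext (M.sT f A'))) (hρ : ρ.length = n)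
    (h : M.interpP P (M.ext (M.sT f A')) (M.push (M.sT f A') (env.map (M.sM f)))
      (ρ.map (pb (M.p _))) = some Q) :
    M.interpP P (M.ext (M.sT g (M.sT f A'))) (M.push (M.sT g (M.sT f A'))
      (env.map (M.sM (g ≫ f)))) ((ρ.map (pb g)).map (pb (M.p _))) =
        some (pb (M.lift (M.sT f A') g) Q) := by
  rw [← M.map_push_lift] at h
  have := hP.nat (M.lift (M.sT f A') g) (M.lift A' f) _ Q ((List.length_map _).trans hρ) h
  rwa [M.map_sM_comp, M.map_push_lift, M.map_push_lift, ← M.map_sM_comp, ← map_pb_comp, M.lift_p,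
    map_pb_comp] at this

theorem Stable.defined_push (hP : M.Stable P (M.push A' env) n) {Y : C} (f : Y ⟶ X)
    (ρ : List (PropL Y)) (hρ : ρ.length = n) :
    ∃ Q, M.interpP P (M.ext (M.sT f A')) (M.push (M.sT f A') (env.map (M.sM f)))
      (ρ.map (pb (M.p _))) = some Q := by
  rw [← M.map_push_lift]
  exact hP.defined _ _ ((List.length_map _).trans hρ)

theorem Stable.mono_push (hP : M.Stable P (M.push A' env) n) {Y : C} (f : Y ⟶ X)
    (ρ ρ' : List (PropL Y)) (Q Q' : PropL (M.ext (M.sT f A'))) (k : ℕ) (hρ : ρ.length = n)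
    (hρ' : ρ'.length = n) (hle : LeAt k ρ ρ')
    (h : M.interpP P (M.ext (M.sT f A')) (M.push (M.sT f A') (env.map (M.sM f)))
      (ρ.map (pb (M.p _))) = some Q)
    (h' : M.interpP P (M.ext (M.sT f A')) (M.push (M.sT f A') (env.map (M.sM f)))
      (ρ'.map (pb (M.p _))) = some Q') :
    (P.Occ true k → Q ≤ Q') ∧ (P.Occ false k → Q' ≤ Q) := by
  rw [← M.map_push_lift] at h h'
  exact hP.mono _ _ _ _ _ k ((List.length_map _).trans hρ) ((List.length_map _).trans hρ')
    (hle.map_pb _) h h'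

theorem Stable.all (hA : M.interpTy A X env = some A') (hP : M.Stable P (M.push A' env) n) :
    M.Stable (.all A P) env n where
  defined f ρ hρ := by
    obtain ⟨R, hR⟩ := hP.defined_push f ρ hρ
    exact ⟨M.all _ R, by
      simp only [interpP, M.interpTy_sT f hA, hR, Option.bind_some, Option.map_some]⟩
  nat g f ρ Q hρ h := by
    simp only [interpP, M.interpTy_sT f hA, Option.bind_some, Option.map_eq_some_iff] at h
    obtain ⟨R, hR, rfl⟩ := h
    simp only [interpP, M.interpTy_sT (g ≫ f) hA, M.sT_comp, Option.bind_some,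
      hP.nat_push g f ρ R hρ hR, Option.map_some, M.pb_all]
  mono f ρ ρ' Q Q' k hρ hρ' hle h h' := by
    simp only [interpP, M.interpTy_sT f hA, Option.bind_some, Option.map_eq_some_iff] at h h'
    obtain ⟨R, hR, rfl⟩ := h
    obtain ⟨R', hR', rfl⟩ := h'
    obtain ⟨h₁, h₂⟩ := hP.mono_push f ρ ρ' _ _ k hρ hρ' hle hR hR'
    exact ⟨fun ho => M.all_le_all _ (h₁ ho), fun ho => M.all_le_all _ (h₂ ho)⟩

theorem Stable.ex (hA : M.interpTy A X env = some A') (hP : M.Stable P (M.push A' env) n) :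
    M.Stable (.ex A P) env n where
  defined f ρ hρ := by
    obtain ⟨R, hR⟩ := hP.defined_push f ρ hρ
    exact ⟨M.ex _ R, by
      simp only [interpP, M.interpTy_sT f hA, hR, Option.bind_some, Option.map_some]⟩
  nat g f ρ Q hρ h := by
    simp only [interpP, M.interpTy_sT f hA, Option.bind_some, Option.map_eq_some_iff] at h
    obtain ⟨R, hR, rfl⟩ := h
    simp only [interpP, M.interpTy_sT (g ≫ f) hA, M.sT_comp, Option.bind_some,
      hP.nat_push g f ρ R hρ hR, Option.map_some, M.pb_ex]
  mono f ρ ρ' Q Q' k hρ hρ' hle h h' := by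
    simp only [interpP, M.interpTy_sT f hA, Option.bind_some, Option.map_eq_some_iff] at h h'
    obtain ⟨R, hR, rfl⟩ := h
    obtain ⟨R', hR', rfl⟩ := h'
    obtain ⟨h₁, h₂⟩ := hP.mono_push f ρ ρ' _ _ k hρ hρ' hle hR hR'
    exact ⟨fun ho => M.ex_le_ex _ (h₁ ho), fun ho => M.ex_le_ex _ (h₂ ho)⟩

end Quantifiers

section FixedPoints

variable (hP : M.Stable P env (n + 1)) (ho : P.Occ true 0) {Y : C} (f : Y ⟶ X)
  (ρ : List (PropL Y)) (hρ : ρ.length = n)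

/-- The operator on propositions given by a stable proposition with a positive variable. -/
def Stable.op : StableOp Y where
  app {Z} g Q := (hP.defined (g ≫ f) (Q :: ρ.map (pb g)) (by simp [hρ])).choose
  nat {Z Z'} g g' Q := by
    have h := (hP.defined (g' ≫ f) (Q :: ρ.map (pb g')) (by simp [hρ])).choose_spec
    have h' := (hP.defined ((g ≫ g') ≫ f) (pb g Q :: ρ.map (pb (g ≫ g')))
      (by simp [hρ])).choose_spec
    have hn := hP.nat g (g' ≫ f) _ _ (by simp [hρ]) h
    rw [List.map_cons, ← map_pb_comp, ← Category.assoc] at hn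
    exact Option.some_injective _ (hn.symm.trans h')
  mono {Z} g Q Q' hQ :=
    (hP.mono (g ≫ f) _ _ _ _ 0 (by simp [hρ]) (by simp [hρ]) (leAt_zero_cons hQ _)
      (hP.defined (g ≫ f) (Q :: ρ.map (pb g)) (by simp [hρ])).choose_spec
      (hP.defined (g ≫ f) (Q' :: ρ.map (pb g)) (by simp [hρ])).choose_spec).1 ho

theorem Stable.interpP_op {Z : C} (g : Z ⟶ Y) (Q : PropL Z) :
    M.interpP P Z (env.map (M.sM (g ≫ f))) (Q :: ρ.map (pb g)) =
      some ((hP.op ho f ρ hρ).app g Q) :=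
  (hP.defined (g ≫ f) (Q :: ρ.map (pb g)) (by simp [hρ])).choose_spec

variable (M) in
theorem mu_eq (F : StableOp Y) : F.app (𝟙 Y) (M.mu F) = M.mu F := by
  refine le_antisymm (M.mu_fold F) ?_
  have := M.mu_least F (𝟙 Y) _ (F.mono (𝟙 Y) (M.mu_fold F))
  rwa [pb_id] at this

variable (M) in
theorem nu_eq (F : StableOp Y) : F.app (𝟙 Y) (M.nu F) = M.nu F := by
  refine le_antisymm ?_ (M.nu_out F)
  have := M.nu_greatest F (𝟙 Y) _ (F.mono (𝟙 Y) (M.nu_out F))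
  rwa [pb_id] at this

theorem Stable.isLfp {Z : C} (g : Z ⟶ Y) :
    IsLfp (fun Q => M.interpP P Z (env.map (M.sM (g ≫ f))) (Q :: ρ.map (pb g)))
      (pb g (M.mu (hP.op ho f ρ hρ))) := by
  constructor
  · have h := (hP.op ho f ρ hρ).nat g (𝟙 Y) (M.mu (hP.op ho f ρ hρ))
    rw [M.mu_eq, Category.comp_id] at h
    exact (hP.interpP_op ho f ρ hρ g _).trans (congrArg some h.symm)
  · intro Q Q' h hle
    cases (hP.interpP_op ho f ρ hρ g Q).symm.trans h
    exact M.mu_least _ g Q hle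

theorem Stable.isGfp {Z : C} (g : Z ⟶ Y) :
    IsGfp (fun Q => M.interpP P Z (env.map (M.sM (g ≫ f))) (Q :: ρ.map (pb g)))
      (pb g (M.nu (hP.op ho f ρ hρ))) := by
  constructor
  · have h := (hP.op ho f ρ hρ).nat g (𝟙 Y) (M.nu (hP.op ho f ρ hρ))
    rw [M.nu_eq, Category.comp_id] at h
    exact (hP.interpP_op ho f ρ hρ g _).trans (congrArg some h.symm)
  · intro Q Q' h hle
    cases (hP.interpP_op ho f ρ hρ g Q).symm.trans h
    exact M.nu_greatest _ g Q hle

theorem Stable.interpP_mu {Z : C} (g : Z ⟶ Y) :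
    M.interpP (.mu P) Z (env.map (M.sM (g ≫ f))) (ρ.map (pb g)) =
      some (pb g (M.mu (hP.op ho f ρ hρ))) :=
  interpP_mu_eq_some.2 (hP.isLfp ho f ρ hρ g)

theorem Stable.interpP_nu {Z : C} (g : Z ⟶ Y) :
    M.interpP (.nu P) Z (env.map (M.sM (g ≫ f))) (ρ.map (pb g)) =
      some (pb g (M.nu (hP.op ho f ρ hρ))) :=
  interpP_nu_eq_some.2 (hP.isGfp ho f ρ hρ g)

theorem Stable.mu (hP : M.Stable P env (n + 1)) (ho : P.Occ true 0) :
    M.Stable (.mu P) env n where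
  defined f ρ hρ := by
    have h := hP.interpP_mu ho f ρ hρ (𝟙 _)
    rw [Category.id_comp, map_pb_id] at h
    exact ⟨_, h⟩
  nat g f ρ Q hρ h := by
    have h' := hP.interpP_mu ho f ρ hρ (𝟙 _)
    rw [Category.id_comp, map_pb_id, pb_id, h] at h'
    cases h'
    exact hP.interpP_mu ho f ρ hρ g
  mono f ρ ρ' Q Q' k hρ hρ' hle h h' := by
    rw [interpP_mu_eq_some] at h h'
    constructor
    · intro hk
      obtain ⟨R, hR⟩ := hP.defined f (Q' :: ρ) (by simp [hρ])
      exact h.2 _ _ hR ((hP.mono f _ _ _ _ (k + 1) (by simp [hρ]) (by simp [hρ']) (hle.cons Q')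
        hR h'.1).1 hk)
    · intro hk
      obtain ⟨R, hR⟩ := hP.defined f (Q :: ρ') (by simp [hρ'])
      exact h'.2 _ _ hR ((hP.mono f _ _ _ _ (k + 1) (by simp [hρ]) (by simp [hρ']) (hle.cons Q)
        h.1 hR).2 hk)

theorem Stable.nu (hP : M.Stable P env (n + 1)) (ho : P.Occ true 0) :
    M.Stable (.nu P) env n where
  defined f ρ hρ := by
    have h := hP.interpP_nu ho f ρ hρ (𝟙 _)
    rw [Category.id_comp, map_pb_id] at h
    exact ⟨_, h⟩
  nat g f ρ Q hρ h := by
    have h' := hP.interpP_nu ho f ρ hρ (𝟙 _)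
    rw [Category.id_comp, map_pb_id, pb_id, h] at h'
    cases h'
    exact hP.interpP_nu ho f ρ hρ g
  mono f ρ ρ' Q Q' k hρ hρ' hle h h' := by
    rw [interpP_nu_eq_some] at h h'
    constructor
    · intro hk
      obtain ⟨R, hR⟩ := hP.defined f (Q :: ρ') (by simp [hρ'])
      exact h'.2 _ _ hR ((hP.mono f _ _ _ _ (k + 1) (by simp [hρ]) (by simp [hρ']) (hle.cons Q)
        h.1 hR).1 hk)
    · intro hk
      obtain ⟨R, hR⟩ := hP.defined f (Q' :: ρ) (by simp [hρ])
      exact h.2 _ _ hR ((hP.mono f _ _ _ _ (k + 1) (by simp [hρ]) (by simp [hρ']) (hle.cons Q')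
        hR h'.1).2 hk)

end FixedPoints

theorem Stable.interpP_eq_some (hP : M.Stable P env n) (ρ : List (PropL X)) (hρ : ρ.length = n) :
    ∃ Q, M.interpP P X env ρ = some Q := by
  have := hP.defined (𝟙 X) ρ hρ
  rwa [M.map_sM_id] at this

/-- The value of `P(Q)`. -/
theorem Stable.interpP_pinst {Q : Prp} (hQ : M.Stable Q env n) {ρ : List (PropL X)}
    (hρ : ρ.length = n) {R : PropL X} (hR : M.interpP Q X env ρ = some R) :
    M.interpP (P.pinst Q) X env ρ = M.interpP P X env (R :: ρ) := by
  refine M.interpP_psub P fun k Y f => ?_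
  cases k with
  | zero =>
    have h := hQ.nat f (𝟙 X) ρ R hρ (by rwa [M.map_sM_id])
    rwa [Category.comp_id] at h
  | succ k => exact List.getElem?_map

theorem Stable.interpP_pinst_mu (hP : M.Stable P env (n + 1)) (ho : P.Occ true 0)
    {ρ : List (PropL X)} (hρ : ρ.length = n) :
    ∃ R, M.interpP (.mu P) X env ρ = some R ∧ M.interpP (P.pinst (.mu P)) X env ρ = some R := by
  obtain ⟨R, hR⟩ := (hP.mu ho).interpP_eq_some ρ hρ
  exact ⟨R, hR, ((hP.mu ho).interpP_pinst hρ hR).trans (interpP_mu_eq_some.1 hR).1⟩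

theorem Stable.interpP_pinst_nu (hP : M.Stable P env (n + 1)) (ho : P.Occ true 0)
    {ρ : List (PropL X)} (hρ : ρ.length = n) :
    ∃ R, M.interpP (.nu P) X env ρ = some R ∧ M.interpP (P.pinst (.nu P)) X env ρ = some R := by
  obtain ⟨R, hR⟩ := (hP.nu ho).interpP_eq_some ρ hρ
  exact ⟨R, hR, ((hP.nu ho).interpP_pinst hρ hR).trans (interpP_nu_eq_some.1 hR).1⟩

end Stable

/-! ## Soundness of the propositional layer -/

variable (M) in
/-- Semantic validity of `Γ, X₀ : Prop, …, X_{n-1} : Prop ⊢ P : Prop`. -/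
def ValidProp (Γ : List Term) (n : ℕ) (P : Prp) : Prop :=
  ∃ (X : C) (env : List (M.Tm X)), M.interpCtx Γ = some ⟨X, env⟩ ∧ M.Stable P env n

theorem ValidProp.stable {Γ : List Term} {n : ℕ} {P : Prp} (h : M.ValidProp Γ n P) {X : C}
    {env : List (M.Tm X)} (hΓ : M.interpCtx Γ = some ⟨X, env⟩) : M.Stable P env n := by
  obtain ⟨X', env', hΓ', h⟩ := h
  cases hΓ.symm.trans hΓ'
  exact h

variable (M)

theorem validProp_of_isProp {Γ : List Term} {n : ℕ} {P : Prp} (h : IsProp Γ n P) :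
    M.ValidProp Γ n P := by
  induction h with
  | pvar hΓ hk =>
    obtain ⟨X, env, hΓ⟩ := M.interpCtx_of_wfCtx hΓ
    exact ⟨X, env, hΓ, stable_pvar hk⟩
  | top hΓ =>
    obtain ⟨X, env, hΓ⟩ := M.interpCtx_of_wfCtx hΓ
    exact ⟨X, env, hΓ, stable_top⟩
  | bot hΓ =>
    obtain ⟨X, env, hΓ⟩ := M.interpCtx_of_wfCtx hΓ
    exact ⟨X, env, hΓ, stable_bot⟩
  | and _ _ ih ih' =>
    obtain ⟨X, env, hΓ, h⟩ := ih
    exact ⟨X, env, hΓ, h.and (ih'.stable hΓ)⟩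
  | or _ _ ih ih' =>
    obtain ⟨X, env, hΓ, h⟩ := ih
    exact ⟨X, env, hΓ, h.or (ih'.stable hΓ)⟩
  | imp _ _ ih ih' =>
    obtain ⟨X, env, hΓ, h⟩ := ih
    exact ⟨X, env, hΓ, h.imp (ih'.stable hΓ)⟩
  | all hA _ ih =>
    obtain ⟨X, env, hΓ, h⟩ := M.validEq_of_hasTy hA
    obtain ⟨T, hT, -⟩ := h.interpTy_eq
    exact ⟨X, env, hΓ, .all hT (ih.stable (CompModel.interpCtx_cons hΓ hT))⟩
  | ex hA _ ih =>
    obtain ⟨X, env, hΓ, h⟩ := M.validEq_of_hasTy hA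
    obtain ⟨T, hT, -⟩ := h.interpTy_eq
    exact ⟨X, env, hΓ, .ex hT (ih.stable (CompModel.interpCtx_cons hΓ hT))⟩
  | mu _ ho ih =>
    obtain ⟨X, env, hΓ, h⟩ := ih
    exact ⟨X, env, hΓ, h.mu ho⟩
  | nu _ ho ih =>
    obtain ⟨X, env, hΓ, h⟩ := ih
    exact ⟨X, env, hΓ, h.nu ho⟩

/-- Semantic validity of `Γ, X₀ : Prop, …, X_{n-1} : Prop ⊢ P ≡ Q : Prop`. -/
structure ValidPropEq (Γ : List Term) (n : ℕ) (P Q : Prp) : Prop where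
  left : M.ValidProp Γ n P
  right : M.ValidProp Γ n Q
  eq : ∀ {X : C} {env : List (M.Tm X)}, M.interpCtx Γ = some ⟨X, env⟩ →
    ∀ ρ : List (PropL X), ρ.length = n → M.interpP P X env ρ = M.interpP Q X env ρ

theorem validPropEq_of_propEq {Γ : List Term} {n : ℕ} {P Q : Prp} (h : PropEq Γ n P Q) :
    M.ValidPropEq Γ n P Q := by
  induction h with
  | rfl h =>
    have h := M.validProp_of_isProp h
    exact ⟨h, h, fun _ _ _ => rfl⟩
  | symm _ ih => exact ⟨ih.right, ih.left, fun hΓ ρ hρ => (ih.eq hΓ ρ hρ).symm⟩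
  | trans _ _ ih ih' =>
    exact ⟨ih.left, ih'.right, fun hΓ ρ hρ => (ih.eq hΓ ρ hρ).trans (ih'.eq hΓ ρ hρ)⟩
  | and _ _ ih ih' =>
    obtain ⟨X, env, hΓ, h⟩ := ih.left
    refine ⟨⟨X, env, hΓ, h.and (ih'.left.stable hΓ)⟩,
      ⟨X, env, hΓ, (ih.right.stable hΓ).and (ih'.right.stable hΓ)⟩, fun hΓ ρ hρ => ?_⟩
    simp only [interpP, ih.eq hΓ ρ hρ, ih'.eq hΓ ρ hρ]
  | or _ _ ih ih' =>
    obtain ⟨X, env, hΓ, h⟩ := ih.left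
    refine ⟨⟨X, env, hΓ, h.or (ih'.left.stable hΓ)⟩,
      ⟨X, env, hΓ, (ih.right.stable hΓ).or (ih'.right.stable hΓ)⟩, fun hΓ ρ hρ => ?_⟩
    simp only [interpP, ih.eq hΓ ρ hρ, ih'.eq hΓ ρ hρ]
  | imp _ _ ih ih' =>
    obtain ⟨X, env, hΓ, h⟩ := ih.left
    refine ⟨⟨X, env, hΓ, h.imp (ih'.left.stable hΓ)⟩,
      ⟨X, env, hΓ, (ih.right.stable hΓ).imp (ih'.right.stable hΓ)⟩, fun hΓ ρ hρ => ?_⟩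
    simp only [interpP, ih.eq hΓ ρ hρ, ih'.eq hΓ ρ hρ]
  | all hA _ ih =>
    obtain ⟨X, env, hΓ, h⟩ := M.validEq_of_defEq hA
    obtain ⟨T, hT, hT'⟩ := h.interpTy_eq
    have hΓ' := CompModel.interpCtx_cons hΓ hT
    refine ⟨⟨X, env, hΓ, .all hT (ih.left.stable hΓ')⟩,
      ⟨X, env, hΓ, .all hT' (ih.right.stable hΓ')⟩, fun hΓ₁ ρ hρ => ?_⟩
    cases hΓ.symm.trans hΓ₁
    simp only [interpP, hT, hT', Option.bind_some, ih.eq hΓ' _ ((List.length_map _).trans hρ)]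
  | ex hA _ ih =>
    obtain ⟨X, env, hΓ, h⟩ := M.validEq_of_defEq hA
    obtain ⟨T, hT, hT'⟩ := h.interpTy_eq
    have hΓ' := CompModel.interpCtx_cons hΓ hT
    refine ⟨⟨X, env, hΓ, .ex hT (ih.left.stable hΓ')⟩,
      ⟨X, env, hΓ, .ex hT' (ih.right.stable hΓ')⟩, fun hΓ₁ ρ hρ => ?_⟩
    cases hΓ.symm.trans hΓ₁
    simp only [interpP, hT, hT', Option.bind_some, ih.eq hΓ' _ ((List.length_map _).trans hρ)]
  | mu _ ho ho' ih =>
    obtain ⟨X, env, hΓ, h⟩ := ih.left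
    exact ⟨⟨X, env, hΓ, h.mu ho⟩, ⟨X, env, hΓ, (ih.right.stable hΓ).mu ho'⟩,
      fun hΓ ρ hρ => interpP_mu_congr fun Q => ih.eq hΓ (Q :: ρ) (by simp [hρ])⟩
  | nu _ ho ho' ih =>
    obtain ⟨X, env, hΓ, h⟩ := ih.left
    exact ⟨⟨X, env, hΓ, h.nu ho⟩, ⟨X, env, hΓ, (ih.right.stable hΓ).nu ho'⟩,
      fun hΓ ρ hρ => interpP_nu_congr fun Q => ih.eq hΓ (Q :: ρ) (by simp [hρ])⟩

end Model

namespace Model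

variable {C : Type u} [Category.{v} C] [HasFiniteLimits C] [HasLimitsOfShape ℕᵒᵖ C]
  {Tf : Type z} [SmallCategory Tf] {M : Model.{u, v, w, z} C Tf}

/-! ## Proofs of propositions -/

instance subsingleton_prf {X : C} (P : PropL X) : Subsingleton (TmL (prfTy (Tf := Tf) P)) := by
  refine ⟨fun s t => NatTrans.ext (funext fun o => Over.OverMorphism.ext ?_)⟩
  rw [← cancel_mono P.arrow]
  exact (Over.w (s.app o)).trans (Over.w (t.app o)).symm

theorem nonempty_prf_iff {X : C} {P : PropL X} :
    Nonempty (TmL (prfTy (Tf := Tf) P)) ↔ (Nonempty Tf → P = ⊤) := by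
  constructor
  · rintro ⟨t⟩ ⟨o⟩
    have h : (t.app (op o)).left ≫ P.arrow = 𝟙 X := Over.w (t.app (op o))
    have : IsSplitEpi P.arrow := ⟨⟨(t.app (op o)).left, h⟩⟩
    have : IsIso P.arrow := isIso_of_mono_of_isSplitEpi _
    exact Subobject.eq_top_of_isIso_arrow P
  · intro h
    rcases isEmpty_or_nonempty Tf with hT | hT
    · exact ⟨{ app := fun o => hT.elim o.unop, naturality := fun o => hT.elim o.unop }⟩
    · cases h hT
      have hw : inv (⊤ : PropL X).arrow ≫ (⊤ : PropL X).arrow = 𝟙 X := IsIso.inv_hom_id _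
      exact ⟨(Functor.const Tfᵒᵖ).map (Over.homMk (inv (⊤ : PropL X).arrow) hw)⟩

theorem proof_eq_some {X : C} {P : PropL X} (t : TmL (prfTy (Tf := Tf) P)) :
    proof Tf P = some ⟨prfTy P, t⟩ := by
  have h : Nonempty (TmL (prfTy (Tf := Tf) P)) := ⟨t⟩
  rw [proof, dif_pos h, Subsingleton.elim h.some t]

theorem nonempty_prf_of_imp {X : C} {P Q : PropL X}
    (hf : Nonempty (TmL (prfTy (Tf := Tf) (M.imp P Q))))
    (hp : Nonempty (TmL (prfTy (Tf := Tf) P))) : Nonempty (TmL (prfTy (Tf := Tf) Q)) := by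
  rw [nonempty_prf_iff] at hf hp ⊢
  intro h
  refine top_le_iff.1 ?_
  have := (M.le_imp P Q ⊤).1 (hf h).ge
  rwa [hp h, top_inf_eq] at this

variable (M) in
theorem nonempty_prf_imp_self {X : C} (P : PropL X) :
    Nonempty (TmL (prfTy (Tf := Tf) (M.imp P P))) :=
  nonempty_prf_iff.2 fun _ => top_le_iff.1 ((M.le_imp P P ⊤).2 inf_le_right)

/-! ## Semantic judgements of the constructive layer -/

section Judgements

variable {X : C} {env : List (M.Tm X)} {ρ : List (PropL X)}

variable (M env ρ) in
/-- The types `B` and `B'` have the same value, and the same value as elements of the universe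
of level `i`. -/
def LTyEqAt (B B' : LTy) (i : ℕ) : Prop :=
  (∃ T, M.interpLTy B X env ρ = some T ∧ M.interpLTy B' X env ρ = some T) ∧
    ∃ c : TmL (clL (M.UL i) X), ∀ θ, M.interpL (.ty B) X env ρ θ = some ⟨_, c⟩ ∧
      M.interpL (.ty B') X env ρ θ = some ⟨_, c⟩

theorem LTyEqAt.symm {B B' : LTy} {i : ℕ} (h : M.LTyEqAt env ρ B B' i) :
    M.LTyEqAt env ρ B' B i := by
  obtain ⟨⟨T, h₁, h₂⟩, c, hc⟩ := h
  exact ⟨⟨T, h₂, h₁⟩, c, fun θ => (hc θ).symm⟩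

theorem LTyEqAt.trans {B B' B'' : LTy} {i : ℕ} (h : M.LTyEqAt env ρ B B' i)
    (h' : M.LTyEqAt env ρ B' B'' i) : M.LTyEqAt env ρ B B'' i := by
  obtain ⟨⟨T, h₁, h₂⟩, c, hc⟩ := h
  obtain ⟨⟨T', h₁', h₂'⟩, c', hc'⟩ := h'
  refine ⟨⟨T, h₁, h₂'.trans (h₁'.symm.trans h₂)⟩, c, fun θ => ⟨(hc θ).1, ?_⟩⟩
  exact (hc' θ).2.trans ((hc' θ).1.symm.trans (hc θ).2)

theorem lTyEqAt_univ (i : ℕ) : M.LTyEqAt env ρ (.univ i) (.univ i) (i + 1) :=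
  ⟨⟨_, rfl, rfl⟩, _, fun _ => ⟨rfl, rfl⟩⟩

theorem lTyEqAt_prop : M.LTyEqAt env ρ .prop .prop 0 :=
  ⟨⟨_, rfl, rfl⟩, _, fun _ => ⟨rfl, rfl⟩⟩

theorem interpLTy_kf {τ : Term} {t : M.Tm X} (h : M.interp τ X env = some t)
    (ht : M.Is t M.FinT) : M.interpLTy (.kf τ) X env ρ = some (M.kfTy ⟨t, ht⟩) := by
  simp only [interpLTy, h, Option.bind_some]
  rw [dif_pos ht]

theorem interpLTy_kinf {π : Term} {t : M.Tm X} (h : M.interp π X env = some t)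
    (ht : M.Is t M.InfT) :
    M.interpLTy (.kinf π) X env ρ = some (constL Tf (M.kinfObj t ht)) := by
  simp only [interpLTy, h, Option.bind_some]
  rw [dif_pos ht]

theorem interpLTy_prf {P : Prp} {Q : PropL X} (h : M.interpP P X env ρ = some Q) :
    M.interpLTy (.prf P) X env ρ = some (prfTy Q) := by
  simp only [interpLTy, h, Option.map_some]

theorem interpL_ty_kf {τ : Term} {t : M.Tm X} (h : M.interp τ X env = some t)
    (ht : M.Is t M.FinT) (θ) :
    M.interpL (.ty (.kf τ)) X env ρ θ = some ⟨clL (M.UL 0) X, clSec (M.kfCode ⟨t, ht⟩)⟩ := by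
  simp only [interpL, interpCode, h, Option.bind_some]
  rw [dif_pos ht]
  rfl

theorem interpL_ty_kinf {π : Term} {t : M.Tm X} (h : M.interp π X env = some t)
    (ht : M.Is t M.InfT) (θ) :
    M.interpL (.ty (.kinf π)) X env ρ θ = some ⟨clL (M.UL 0) X, clSec (M.kinfCode t ht)⟩ := by
  simp only [interpL, interpCode, h, Option.bind_some]
  rw [dif_pos ht]
  rfl

theorem interpL_ty_prf {P : Prp} {Q : PropL X} (h : M.interpP P X env ρ = some Q) (θ) :
    M.interpL (.ty (.prf P)) X env ρ θ = some ⟨clL (M.UL 0) X, clSec (M.prfCode Q)⟩ := by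
  simp only [interpL, interpCode, h]
  rfl

theorem LTyEqAt.kf {τ τ' : Term} (h : M.EqAt env τ τ' .finTrace) :
    M.LTyEqAt env ρ (.kf τ) (.kf τ') 0 := by
  obtain ⟨t, ht, h₁, h₂⟩ := CompModel.eqAt_finTrace.1 h
  exact ⟨⟨_, interpLTy_kf h₁ ht, interpLTy_kf h₂ ht⟩, _,
    fun θ => ⟨interpL_ty_kf h₁ ht θ, interpL_ty_kf h₂ ht θ⟩⟩

theorem LTyEqAt.kinf {π π' : Term} (h : M.EqAt env π π' .infTrace) :
    M.LTyEqAt env ρ (.kinf π) (.kinf π') 0 := by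
  obtain ⟨t, ht, h₁, h₂⟩ := CompModel.eqAt_infTrace.1 h
  exact ⟨⟨_, interpLTy_kinf h₁ ht, interpLTy_kinf h₂ ht⟩, _,
    fun θ => ⟨interpL_ty_kinf h₁ ht θ, interpL_ty_kinf h₂ ht θ⟩⟩

theorem LTyEqAt.prf {P P' : Prp} {Q : PropL X} (h₁ : M.interpP P X env ρ = some Q)
    (h₂ : M.interpP P' X env ρ = some Q) : M.LTyEqAt env ρ (.prf P) (.prf P') 0 :=
  ⟨⟨_, interpLTy_prf h₁, interpLTy_prf h₂⟩, _,
    fun θ => ⟨interpL_ty_prf h₁ θ, interpL_ty_prf h₂ θ⟩⟩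

variable {θ : List (Σ B : TyL Tf X, TmL B)}

variable (M env ρ θ) in
/-- The terms `u` and `u'` have the same value, of the type that is the value of `B`. -/
def LEqAt (u u' : LTm) (B : LTy) : Prop :=
  ∃ T : TyL Tf X, M.interpLTy B X env ρ = some T ∧ ∃ t : TmL T,
    M.interpL u X env ρ θ = some ⟨T, t⟩ ∧ M.interpL u' X env ρ θ = some ⟨T, t⟩

variable {u u' u'' : LTm} {B B' : LTy}

theorem LEqAt.symm (h : M.LEqAt env ρ θ u u' B) : M.LEqAt env ρ θ u' u B := by
  obtain ⟨T, hT, t, h₁, h₂⟩ := h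
  exact ⟨T, hT, t, h₂, h₁⟩

theorem LEqAt.trans (h : M.LEqAt env ρ θ u u' B) (h' : M.LEqAt env ρ θ u' u'' B) :
    M.LEqAt env ρ θ u u'' B := by
  obtain ⟨T, hT, t, h₁, h₂⟩ := h
  obtain ⟨T', hT', t', h₁', h₂'⟩ := h'
  exact ⟨T, hT, t, h₁, h₂'.trans (h₁'.symm.trans h₂)⟩

theorem LEqAt.of_interpLTy (h : M.LEqAt env ρ θ u u' B) {T : TyL Tf X}
    (hT : M.interpLTy B X env ρ = some T) :
    ∃ t : TmL T, M.interpL u X env ρ θ = some ⟨T, t⟩ ∧ M.interpL u' X env ρ θ = some ⟨T, t⟩ := by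
  obtain ⟨T', hT', h⟩ := h
  cases hT.symm.trans hT'
  exact h

theorem LEqAt.conv {i : ℕ} (h : M.LEqAt env ρ θ u u' B) (hB : M.LTyEqAt env ρ B B' i) :
    M.LEqAt env ρ θ u u' B' := by
  obtain ⟨⟨T, h₁, h₂⟩, -⟩ := hB
  exact ⟨T, h₂, h.of_interpLTy h₁⟩

theorem LTyEqAt.lEqAt {i : ℕ} (h : M.LTyEqAt env ρ B B' i) :
    M.LEqAt env ρ θ (.ty B) (.ty B') (.univ i) := by
  obtain ⟨-, c, hc⟩ := h
  exact ⟨_, rfl, c, hc θ⟩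

theorem lEqAt_prp {P P' : Prp} {Q : PropL X} (h₁ : M.interpP P X env ρ = some Q)
    (h₂ : M.interpP P' X env ρ = some Q) : M.LEqAt env ρ θ (.prp P) (.prp P') .prop := by
  refine ⟨_, rfl, (Functor.const Tfᵒᵖ).map (starSec (M.Ω.χ Q.arrow)), ?_, ?_⟩
  · simp only [interpL, h₁, Option.map_some]
  · simp only [interpL, h₂, Option.map_some]

/-- The restriction map of the constant presheaves `K_f(τ') ⟶ K_f(τ)`. -/
def restrictMap (M : Model.{u, v, w, z} C Tf) {X : C} {τ τ' : M.Tr X} (ε : τ ⟶ τ') :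
    M.kfTy τ' ⟶ M.kfTy τ :=
  (Functor.const Tfᵒᵖ).map ((M.kf X).map ε.op)

theorem restrictMap_id (M : Model.{u, v, w, z} C Tf) {X : C} (τ : M.Tr X) :
    M.restrictMap (𝟙 τ) = 𝟙 (M.kfTy τ) :=
  (congrArg (Functor.const Tfᵒᵖ).map ((M.kf X).map_id (op τ))).trans
    ((Functor.const Tfᵒᵖ).map_id (M.kfObj τ))

theorem restrictMap_comp (M : Model.{u, v, w, z} C Tf) {X : C} {τ τ' τ'' : M.Tr X} (ε : τ ⟶ τ')
    (δ : τ' ⟶ τ'') : M.restrictMap (ε ≫ δ) = M.restrictMap δ ≫ M.restrictMap ε :=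
  (congrArg (Functor.const Tfᵒᵖ).map ((M.kf X).map_comp δ.op ε.op)).trans
    ((Functor.const Tfᵒᵖ).map_comp ((M.kf X).map δ.op) ((M.kf X).map ε.op))

theorem interpL_restrict {τ τ' ε : Term} {t t' e : M.Tm X} (hτ : M.interp τ X env = some t)
    (hτ' : M.interp τ' X env = some t') (hε : M.interp ε X env = some e) (ht : M.Is t M.FinT)
    (ht' : M.Is t' M.FinT) (he : M.tp e = M.Ext t t') {κ : TmL (M.kfTy ⟨t', ht'⟩)}
    (hk : M.interpL u X env ρ θ = some ⟨_, κ⟩) :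
    M.interpL (.restrict τ τ' ε u) X env ρ θ = some ⟨M.kfTy ⟨t, ht⟩,
      κ ≫ M.restrictMap (CompModel.Tr.Hom.mk e he : (⟨t, ht⟩ : M.Tr X) ⟶ ⟨t', ht'⟩)⟩ := by
  simp only [interpL, hτ, hτ', hε, hk, Option.bind_some]
  rw [dif_pos ht, dif_pos ht', dif_pos he, dif_pos trivial, eqToHom_refl, Category.id_comp]
  rfl

theorem LEqAt.restrict {τ₁ τ₁' τ₂ τ₂' ε ε' : Term} {k k' : LTm}
    (h₁ : M.EqAt env τ₁ τ₁' .finTrace) (h₂ : M.EqAt env τ₂ τ₂' .finTrace)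
    (hε : M.EqAt env ε ε' (.ext τ₁ τ₂)) (hk : M.LEqAt env ρ θ k k' (.kf τ₂)) :
    M.LEqAt env ρ θ (.restrict τ₁ τ₂ ε k) (.restrict τ₁' τ₂' ε' k') (.kf τ₁) := by
  obtain ⟨x, hx, hx₁, hx₂⟩ := CompModel.eqAt_finTrace.1 h₁
  obtain ⟨y, hy, hy₁, hy₂⟩ := CompModel.eqAt_finTrace.1 h₂
  obtain ⟨e, he, he₁, he₂⟩ := hε.of_interpTy (CompModel.interpTy_ext hx₁ hy₁ hx hy)
  obtain ⟨κ, hκ₁, hκ₂⟩ := hk.of_interpLTy (interpLTy_kf hy₁ hy)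
  exact ⟨_, interpLTy_kf hx₁ hx, _, interpL_restrict hx₁ hy₁ he₁ hx hy he hκ₁,
    interpL_restrict hx₂ hy₂ he₂ hx hy he hκ₂⟩

theorem LEqAt.restrictId {τ : Term} {k : LTm} (h : M.EqAt env τ τ .finTrace)
    (hk : M.LEqAt env ρ θ k k (.kf τ)) :
    M.LEqAt env ρ θ (.restrict τ τ (.extId τ) k) k (.kf τ) := by
  obtain ⟨x, hx, hx₁, -⟩ := CompModel.eqAt_finTrace.1 h
  obtain ⟨κ, hκ, -⟩ := hk.of_interpLTy (interpLTy_kf hx₁ hx)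
  refine ⟨_, interpLTy_kf hx₁ hx, κ, ?_, hκ⟩
  exact (interpL_restrict hx₁ hx₁ (CompModel.interp_extId hx₁ hx) hx hx (M.tp_eid x hx) hκ).trans
    (congrArg (fun m => some (⟨M.kfTy ⟨x, hx⟩, m⟩ : Σ B : TyL Tf X, TmL B))
      ((congrArg (κ ≫ ·) (M.restrictMap_id ⟨x, hx⟩)).trans (Category.comp_id κ)))

theorem LEqAt.restrictComp {τ τ' τ'' ε₁ ε₂ : Term} {k : LTm} (h : M.EqAt env τ τ .finTrace)
    (h' : M.EqAt env τ' τ' .finTrace) (h'' : M.EqAt env τ'' τ'' .finTrace)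
    (hε₁ : M.EqAt env ε₁ ε₁ (.ext τ τ')) (hε₂ : M.EqAt env ε₂ ε₂ (.ext τ' τ''))
    (hk : M.LEqAt env ρ θ k k (.kf τ'')) :
    M.LEqAt env ρ θ (.restrict τ τ' ε₁ (.restrict τ' τ'' ε₂ k))
      (.restrict τ τ'' (.extComp τ τ' τ'' ε₁ ε₂) k) (.kf τ) := by
  obtain ⟨x, hx, hx₁, -⟩ := CompModel.eqAt_finTrace.1 h
  obtain ⟨y, hy, hy₁, -⟩ := CompModel.eqAt_finTrace.1 h'
  obtain ⟨z, hz, hz₁, -⟩ := CompModel.eqAt_finTrace.1 h''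
  obtain ⟨e, he, he₁, -⟩ := hε₁.of_interpTy (CompModel.interpTy_ext hx₁ hy₁ hx hy)
  obtain ⟨d, hd, hd₁, -⟩ := hε₂.of_interpTy (CompModel.interpTy_ext hy₁ hz₁ hy hz)
  obtain ⟨κ, hκ, -⟩ := hk.of_interpLTy (interpLTy_kf hz₁ hz)
  refine ⟨_, interpLTy_kf hx₁ hx, _,
    interpL_restrict hx₁ hy₁ he₁ hx hy he (interpL_restrict hy₁ hz₁ hd₁ hy hz hd hκ), ?_⟩
  let ε : (⟨x, hx⟩ : M.Tr X) ⟶ ⟨y, hy⟩ := CompModel.Tr.Hom.mk e he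
  let δ : (⟨y, hy⟩ : M.Tr X) ⟶ ⟨z, hz⟩ := CompModel.Tr.Hom.mk d hd
  exact (interpL_restrict hx₁ hz₁ (CompModel.interp_extComp hx₁ hy₁ hz₁ he₁ hd₁ hx hy hz he hd)
    hx hz (M.tp_ecomp x y z e d hx hy hz he hd) hκ).trans
    (congrArg (fun m => some (⟨M.kfTy ⟨x, hx⟩, m⟩ : Σ B : TyL Tf X, TmL B))
      ((congrArg (κ ≫ ·) (M.restrictMap_comp ε δ)).trans (Category.assoc _ _ _).symm))

theorem LEqAt.irrel {P : Prp} {Q : PropL X} (hP : M.interpP P X env ρ = some Q)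
    (h : M.LEqAt env ρ θ u u (.prf P)) (h' : M.LEqAt env ρ θ u' u' (.prf P)) :
    M.LEqAt env ρ θ u u' (.prf P) := by
  obtain ⟨t, ht, -⟩ := h.of_interpLTy (interpLTy_prf hP)
  obtain ⟨t', ht', -⟩ := h'.of_interpLTy (interpLTy_prf hP)
  cases Subsingleton.elim t t'
  exact ⟨_, interpLTy_prf hP, t, ht, ht'⟩

theorem interpP_imp {P Q : Prp} {R S : PropL X} (hP : M.interpP P X env ρ = some R)
    (hQ : M.interpP Q X env ρ = some S) :
    M.interpP (.imp P Q) X env ρ = some (M.imp R S) := by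
  simp only [interpP, hP, hQ, Option.bind_some, Option.map_some]

theorem interpL_mp {P Q : Prp} {R S : PropL X} {f p : LTm} (hP : M.interpP P X env ρ = some R)
    (hQ : M.interpP Q X env ρ = some S) {f' : TmL (prfTy (Tf := Tf) (M.imp R S))}
    {p' : TmL (prfTy (Tf := Tf) R)} (hf : M.interpL f X env ρ θ = some ⟨_, f'⟩)
    (hp : M.interpL p X env ρ θ = some ⟨_, p'⟩) (t : TmL (prfTy (Tf := Tf) S)) :
    M.interpL (.mp P Q f p) X env ρ θ = some ⟨_, t⟩ := by
  simp only [interpL, hP, hQ, hf, hp, Option.bind_some]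
  rw [if_pos ⟨trivial, trivial⟩, proof_eq_some t]

theorem LEqAt.mp {P P' Q Q' : Prp} {R S : PropL X} {f f' p p' : LTm}
    (hP : M.interpP P X env ρ = some R) (hP' : M.interpP P' X env ρ = some R)
    (hQ : M.interpP Q X env ρ = some S) (hQ' : M.interpP Q' X env ρ = some S)
    (hf : M.LEqAt env ρ θ f f' (.prf (.imp P Q))) (hp : M.LEqAt env ρ θ p p' (.prf P)) :
    M.LEqAt env ρ θ (.mp P Q f p) (.mp P' Q' f' p') (.prf Q) := by
  obtain ⟨s, hs₁, hs₂⟩ := hf.of_interpLTy (interpLTy_prf (interpP_imp hP hQ))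
  obtain ⟨r, hr₁, hr₂⟩ := hp.of_interpLTy (interpLTy_prf hP)
  obtain ⟨t⟩ := nonempty_prf_of_imp ⟨s⟩ ⟨r⟩
  exact ⟨_, interpLTy_prf hQ, t, interpL_mp hP hQ hs₁ hr₁ t, interpL_mp hP' hQ' hs₂ hr₂ t⟩

/-- Proofs of an implication between propositions with the same value. -/
theorem lEqAt_of_interpL_eq_proof {P Q : Prp} {R : PropL X} (hP : M.interpP P X env ρ = some R)
    (hQ : M.interpP Q X env ρ = some R)
    (hu : M.interpL u X env ρ θ = (M.interpP (.imp P Q) X env ρ).bind (proof Tf)) :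
    M.LEqAt env ρ θ u u (.prf (.imp P Q)) := by
  have h := interpP_imp hP hQ
  obtain ⟨t⟩ := M.nonempty_prf_imp_self R
  rw [h, Option.bind_some, proof_eq_some t] at hu
  exact ⟨_, interpLTy_prf h, t, hu, hu⟩

section FixedPointProofs

variable {n : ℕ} {φ : Prp}

theorem lEqAt_fold (hφ : M.Stable φ env (n + 1)) (ho : φ.Occ true 0) (hρ : ρ.length = n) :
    M.LEqAt env ρ θ (.fold φ) (.fold φ) (.prf (.imp (φ.pinst (.mu φ)) (.mu φ))) := by
  obtain ⟨R, h₁, h₂⟩ := hφ.interpP_pinst_mu ho hρ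
  exact lEqAt_of_interpL_eq_proof h₂ h₁ rfl

theorem lEqAt_unfold (hφ : M.Stable φ env (n + 1)) (ho : φ.Occ true 0) (hρ : ρ.length = n) :
    M.LEqAt env ρ θ (.unfold φ) (.unfold φ) (.prf (.imp (.mu φ) (φ.pinst (.mu φ)))) := by
  obtain ⟨R, h₁, h₂⟩ := hφ.interpP_pinst_mu ho hρ
  exact lEqAt_of_interpL_eq_proof h₁ h₂ rfl

theorem lEqAt_nuIn (hφ : M.Stable φ env (n + 1)) (ho : φ.Occ true 0) (hρ : ρ.length = n) :
    M.LEqAt env ρ θ (.nuIn φ) (.nuIn φ) (.prf (.imp (φ.pinst (.nu φ)) (.nu φ))) := by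
  obtain ⟨R, h₁, h₂⟩ := hφ.interpP_pinst_nu ho hρ
  exact lEqAt_of_interpL_eq_proof h₂ h₁ rfl

theorem lEqAt_nuOut (hφ : M.Stable φ env (n + 1)) (ho : φ.Occ true 0) (hρ : ρ.length = n) :
    M.LEqAt env ρ θ (.nuOut φ) (.nuOut φ) (.prf (.imp (.nu φ) (φ.pinst (.nu φ)))) := by
  obtain ⟨R, h₁, h₂⟩ := hφ.interpP_pinst_nu ho hρ
  exact lEqAt_of_interpL_eq_proof h₁ h₂ rfl

variable {p : LTm}

theorem LEqAt.foldUnfold (hφ : M.Stable φ env (n + 1)) (ho : φ.Occ true 0) (hρ : ρ.length = n)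
    (hp : M.LEqAt env ρ θ p p (.prf (.mu φ))) :
    M.LEqAt env ρ θ (.mp (φ.pinst (.mu φ)) (.mu φ) (.fold φ)
      (.mp (.mu φ) (φ.pinst (.mu φ)) (.unfold φ) p)) p (.prf (.mu φ)) := by
  obtain ⟨R, h₁, h₂⟩ := hφ.interpP_pinst_mu ho hρ
  exact .irrel h₁ (.mp h₂ h₂ h₁ h₁ (lEqAt_fold hφ ho hρ)
    (.mp h₁ h₁ h₂ h₂ (lEqAt_unfold hφ ho hρ) hp)) hp

theorem LEqAt.unfoldFold (hφ : M.Stable φ env (n + 1)) (ho : φ.Occ true 0) (hρ : ρ.length = n)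
    (hp : M.LEqAt env ρ θ p p (.prf (φ.pinst (.mu φ)))) :
    M.LEqAt env ρ θ (.mp (.mu φ) (φ.pinst (.mu φ)) (.unfold φ)
      (.mp (φ.pinst (.mu φ)) (.mu φ) (.fold φ) p)) p (.prf (φ.pinst (.mu φ))) := by
  obtain ⟨R, h₁, h₂⟩ := hφ.interpP_pinst_mu ho hρ
  exact .irrel h₂ (.mp h₁ h₁ h₂ h₂ (lEqAt_unfold hφ ho hρ)
    (.mp h₂ h₂ h₁ h₁ (lEqAt_fold hφ ho hρ) hp)) hp

theorem LEqAt.inOut (hφ : M.Stable φ env (n + 1)) (ho : φ.Occ true 0) (hρ : ρ.length = n)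
    (hp : M.LEqAt env ρ θ p p (.prf (.nu φ))) :
    M.LEqAt env ρ θ (.mp (φ.pinst (.nu φ)) (.nu φ) (.nuIn φ)
      (.mp (.nu φ) (φ.pinst (.nu φ)) (.nuOut φ) p)) p (.prf (.nu φ)) := by
  obtain ⟨R, h₁, h₂⟩ := hφ.interpP_pinst_nu ho hρ
  exact .irrel h₁ (.mp h₂ h₂ h₁ h₁ (lEqAt_nuIn hφ ho hρ)
    (.mp h₁ h₁ h₂ h₂ (lEqAt_nuOut hφ ho hρ) hp)) hp

theorem LEqAt.outIn (hφ : M.Stable φ env (n + 1)) (ho : φ.Occ true 0) (hρ : ρ.length = n)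
    (hp : M.LEqAt env ρ θ p p (.prf (φ.pinst (.nu φ)))) :
    M.LEqAt env ρ θ (.mp (.nu φ) (φ.pinst (.nu φ)) (.nuOut φ)
      (.mp (φ.pinst (.nu φ)) (.nu φ) (.nuIn φ) p)) p (.prf (φ.pinst (.nu φ))) := by
  obtain ⟨R, h₁, h₂⟩ := hφ.interpP_pinst_nu ho hρ
  exact .irrel h₂ (.mp h₁ h₁ h₂ h₂ (lEqAt_nuOut hφ ho hρ)
    (.mp h₂ h₂ h₁ h₁ (lEqAt_nuIn hφ ho hρ) hp)) hp

end FixedPointProofs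

end Judgements

/-! ## Soundness of the constructive layer -/

variable (M)

/-- Semantic validity of `Γ ⊢ B ≡ B' : Type_ℓ,i`. -/
def ValidLTyEq (Γ : List Term) (n : ℕ) (B B' : LTy) (i : ℕ) : Prop :=
  ∃ (X : C) (env : List (M.Tm X)), M.interpCtx Γ = some ⟨X, env⟩ ∧
    ∀ ρ : List (PropL X), ρ.length = n → M.LTyEqAt env ρ B B' i

/-- Semantic validity of `Γ; Θ ⊢ u ≡ u' : B`. -/
def ValidLEq (Γ : List Term) (n : ℕ) (Θ : List LTy) (u u' : LTm) (B : LTy) : Prop :=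
  ∃ (X : C) (env : List (M.Tm X)), M.interpCtx Γ = some ⟨X, env⟩ ∧
    ∀ ρ : List (PropL X), ρ.length = n → ∀ θ, M.Interprets Θ X env ρ θ → M.LEqAt env ρ θ u u' B

section

variable {M} {Γ : List Term} {n : ℕ} {X : C} {env : List (M.Tm X)}

theorem ValidLTyEq.lTyEqAt {B B' : LTy} {i : ℕ} (h : M.ValidLTyEq Γ n B B' i)
    (hΓ : M.interpCtx Γ = some ⟨X, env⟩) {ρ : List (PropL X)} (hρ : ρ.length = n) :
    M.LTyEqAt env ρ B B' i := by
  obtain ⟨X', env', hΓ', h⟩ := h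
  cases hΓ.symm.trans hΓ'
  exact h ρ hρ

theorem ValidLEq.lEqAt {Θ : List LTy} {u u' : LTm} {B : LTy} (h : M.ValidLEq Γ n Θ u u' B)
    (hΓ : M.interpCtx Γ = some ⟨X, env⟩) {ρ : List (PropL X)} (hρ : ρ.length = n)
    {θ : List (Σ B : TyL Tf X, TmL B)} (hθ : M.Interprets Θ X env ρ θ) :
    M.LEqAt env ρ θ u u' B := by
  obtain ⟨X', env', hΓ', h⟩ := h
  cases hΓ.symm.trans hΓ'
  exact h ρ hρ θ hθ

theorem ValidProp.interpP_eq_some {P : Prp} (h : M.ValidProp Γ n P)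
    (hΓ : M.interpCtx Γ = some ⟨X, env⟩) {ρ : List (PropL X)} (hρ : ρ.length = n) :
    ∃ Q, M.interpP P X env ρ = some Q :=
  (h.stable hΓ).interpP_eq_some ρ hρ

theorem ValidPropEq.interpP_eq_some {P P' : Prp} (h : M.ValidPropEq Γ n P P')
    (hΓ : M.interpCtx Γ = some ⟨X, env⟩) {ρ : List (PropL X)} (hρ : ρ.length = n) :
    ∃ Q, M.interpP P X env ρ = some Q ∧ M.interpP P' X env ρ = some Q := by
  obtain ⟨Q, hQ⟩ := h.left.interpP_eq_some hΓ hρ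
  exact ⟨Q, hQ, (h.eq hΓ ρ hρ).symm.trans hQ⟩

end

theorem validLTyEq_of_isLTy {Γ : List Term} {n : ℕ} {B : LTy} {i : ℕ} (h : IsLTy Γ n B i) :
    M.ValidLTyEq Γ n B B i := by
  cases h with
  | univ hΓ =>
    obtain ⟨X, env, hΓ⟩ := M.interpCtx_of_wfCtx hΓ
    exact ⟨X, env, hΓ, fun _ _ => lTyEqAt_univ _⟩
  | prop hΓ =>
    obtain ⟨X, env, hΓ⟩ := M.interpCtx_of_wfCtx hΓ
    exact ⟨X, env, hΓ, fun _ _ => lTyEqAt_prop⟩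
  | kf h =>
    obtain ⟨X, env, hΓ, h⟩ := M.validEq_of_hasTy h
    exact ⟨X, env, hΓ, fun _ _ => .kf h⟩
  | kinf h =>
    obtain ⟨X, env, hΓ, h⟩ := M.validEq_of_hasTy h
    exact ⟨X, env, hΓ, fun _ _ => .kinf h⟩
  | prf h =>
    obtain ⟨X, env, hΓ, h⟩ := M.validProp_of_isProp h
    refine ⟨X, env, hΓ, fun ρ hρ => ?_⟩
    obtain ⟨Q, hQ⟩ := h.interpP_eq_some ρ hρ
    exact .prf hQ hQ

theorem validLTyEq_of_lTyEq {Γ : List Term} {n : ℕ} {B B' : LTy} {i : ℕ}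
    (h : LTyEq Γ n B B' i) : M.ValidLTyEq Γ n B B' i := by
  induction h with
  | rfl h => exact M.validLTyEq_of_isLTy h
  | symm _ ih =>
    obtain ⟨X, env, hΓ, h⟩ := ih
    exact ⟨X, env, hΓ, fun ρ hρ => (h ρ hρ).symm⟩
  | trans _ _ ih ih' =>
    obtain ⟨X, env, hΓ, h⟩ := ih
    exact ⟨X, env, hΓ, fun ρ hρ => (h ρ hρ).trans (ih'.lTyEqAt hΓ hρ)⟩
  | kf h =>
    obtain ⟨X, env, hΓ, h⟩ := M.validEq_of_defEq h
    exact ⟨X, env, hΓ, fun _ _ => .kf h⟩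
  | kinf h =>
    obtain ⟨X, env, hΓ, h⟩ := M.validEq_of_defEq h
    exact ⟨X, env, hΓ, fun _ _ => .kinf h⟩
  | prf h =>
    have h := M.validPropEq_of_propEq h
    obtain ⟨X, env, hΓ, -⟩ := h.left
    refine ⟨X, env, hΓ, fun ρ hρ => ?_⟩
    obtain ⟨Q, hQ, hQ'⟩ := h.interpP_eq_some hΓ hρ
    exact .prf hQ hQ'

theorem lEqAt_var {Θ : List LTy} {X : C} {env : List (M.Tm X)} {ρ : List (PropL X)}
    {θ : List (Σ B : TyL Tf X, TmL B)} (hθ : M.Interprets Θ X env ρ θ) {k : ℕ} {B : LTy}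
    (hB : Θ[k]? = some B) : M.LEqAt env ρ θ (.var k) (.var k) B := by
  unfold Interprets at hθ
  have : ∃ b, θ[k]? = some b ∧ M.interpLTy B X env ρ = some b.1 := by
    induction hθ generalizing k with
    | nil => simp at hB
    | cons h _ ih =>
      cases k with
      | zero => cases hB; exact ⟨_, rfl, h⟩
      | succ k => exact ih hB
  obtain ⟨b, hb, h⟩ := this
  exact ⟨b.1, h, b.2, hb, hb⟩

theorem validLEq_of_hasLTy {Γ : List Term} {n : ℕ} {Θ : List LTy} {u : LTm} {B : LTy}
    (h : HasLTy Γ n Θ u B) : M.ValidLEq Γ n Θ u u B := by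
  induction h with
  | var hΘ hB =>
    obtain ⟨X, env, hΓ⟩ := M.interpCtx_of_wfCtx hΘ.1
    exact ⟨X, env, hΓ, fun _ _ _ hθ => M.lEqAt_var hθ hB⟩
  | conv _ hB ih =>
    obtain ⟨X, env, hΓ, h⟩ := ih
    exact ⟨X, env, hΓ, fun ρ hρ θ hθ =>
      (h ρ hρ θ hθ).conv ((M.validLTyEq_of_lTyEq hB).lTyEqAt hΓ hρ)⟩
  | ty _ hB =>
    obtain ⟨X, env, hΓ, h⟩ := M.validLTyEq_of_isLTy hB
    exact ⟨X, env, hΓ, fun ρ hρ θ hθ => (h ρ hρ).lEqAt⟩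
  | prp _ hP =>
    obtain ⟨X, env, hΓ, h⟩ := M.validProp_of_isProp hP
    refine ⟨X, env, hΓ, fun ρ hρ θ hθ => ?_⟩
    obtain ⟨Q, hQ⟩ := h.interpP_eq_some ρ hρ
    exact lEqAt_prp hQ hQ
  | restrict h₁ h₂ hε _ ih =>
    obtain ⟨X, env, hΓ, h⟩ := ih
    exact ⟨X, env, hΓ, fun ρ hρ θ hθ => .restrict ((M.validEq_of_hasTy h₁).eqAt hΓ)
      ((M.validEq_of_hasTy h₂).eqAt hΓ) ((M.validEq_of_hasTy hε).eqAt hΓ) (h ρ hρ θ hθ)⟩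
  | fold _ hφ ho =>
    obtain ⟨X, env, hΓ, h⟩ := M.validProp_of_isProp hφ
    exact ⟨X, env, hΓ, fun ρ hρ θ hθ => lEqAt_fold h ho hρ⟩
  | unfold _ hφ ho =>
    obtain ⟨X, env, hΓ, h⟩ := M.validProp_of_isProp hφ
    exact ⟨X, env, hΓ, fun ρ hρ θ hθ => lEqAt_unfold h ho hρ⟩
  | nuIn _ hφ ho =>
    obtain ⟨X, env, hΓ, h⟩ := M.validProp_of_isProp hφ
    exact ⟨X, env, hΓ, fun ρ hρ θ hθ => lEqAt_nuIn h ho hρ⟩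
  | nuOut _ hφ ho =>
    obtain ⟨X, env, hΓ, h⟩ := M.validProp_of_isProp hφ
    exact ⟨X, env, hΓ, fun ρ hρ θ hθ => lEqAt_nuOut h ho hρ⟩
  | mp hP hQ _ _ ihf ihp =>
    obtain ⟨X, env, hΓ, h⟩ := ihf
    refine ⟨X, env, hΓ, fun ρ hρ θ hθ => ?_⟩
    obtain ⟨R, hR⟩ := (M.validProp_of_isProp hP).interpP_eq_some hΓ hρ
    obtain ⟨S, hS⟩ := (M.validProp_of_isProp hQ).interpP_eq_some hΓ hρ
    exact .mp hR hR hS hS (h ρ hρ θ hθ) (ihp.lEqAt hΓ hρ hθ)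

theorem validLEq_of_lDefEq {Γ : List Term} {n : ℕ} {Θ : List LTy} {u u' : LTm} {B : LTy}
    (h : LDefEq Γ n Θ u u' B) : M.ValidLEq Γ n Θ u u' B := by
  induction h with
  | rfl h => exact M.validLEq_of_hasLTy h
  | symm _ ih =>
    obtain ⟨X, env, hΓ, h⟩ := ih
    exact ⟨X, env, hΓ, fun ρ hρ θ hθ => (h ρ hρ θ hθ).symm⟩
  | trans _ _ ih ih' =>
    obtain ⟨X, env, hΓ, h⟩ := ih
    exact ⟨X, env, hΓ, fun ρ hρ θ hθ => (h ρ hρ θ hθ).trans (ih'.lEqAt hΓ hρ hθ)⟩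
  | conv _ hB ih =>
    obtain ⟨X, env, hΓ, h⟩ := ih
    exact ⟨X, env, hΓ, fun ρ hρ θ hθ =>
      (h ρ hρ θ hθ).conv ((M.validLTyEq_of_lTyEq hB).lTyEqAt hΓ hρ)⟩
  | restrictId hτ hk =>
    obtain ⟨X, env, hΓ, h⟩ := M.validEq_of_hasTy hτ
    exact ⟨X, env, hΓ, fun ρ hρ θ hθ => .restrictId h ((M.validLEq_of_hasLTy hk).lEqAt hΓ hρ hθ)⟩
  | restrictComp h₁ h₂ h₃ h₄ h₅ hk =>
    obtain ⟨X, env, hΓ, h⟩ := M.validEq_of_hasTy h₁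
    exact ⟨X, env, hΓ, fun ρ hρ θ hθ => .restrictComp h ((M.validEq_of_hasTy h₂).eqAt hΓ)
      ((M.validEq_of_hasTy h₃).eqAt hΓ) ((M.validEq_of_hasTy h₄).eqAt hΓ)
      ((M.validEq_of_hasTy h₅).eqAt hΓ) ((M.validLEq_of_hasLTy hk).lEqAt hΓ hρ hθ)⟩
  | foldUnfold hφ ho hw =>
    obtain ⟨X, env, hΓ, h⟩ := M.validProp_of_isProp hφ
    exact ⟨X, env, hΓ, fun ρ hρ θ hθ =>
      .foldUnfold h ho hρ ((M.validLEq_of_hasLTy hw).lEqAt hΓ hρ hθ)⟩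
  | unfoldFold hφ ho hw =>
    obtain ⟨X, env, hΓ, h⟩ := M.validProp_of_isProp hφ
    exact ⟨X, env, hΓ, fun ρ hρ θ hθ =>
      .unfoldFold h ho hρ ((M.validLEq_of_hasLTy hw).lEqAt hΓ hρ hθ)⟩
  | inOut hφ ho hw =>
    obtain ⟨X, env, hΓ, h⟩ := M.validProp_of_isProp hφ
    exact ⟨X, env, hΓ, fun ρ hρ θ hθ =>
      .inOut h ho hρ ((M.validLEq_of_hasLTy hw).lEqAt hΓ hρ hθ)⟩
  | outIn hφ ho hw =>
    obtain ⟨X, env, hΓ, h⟩ := M.validProp_of_isProp hφ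
    exact ⟨X, env, hΓ, fun ρ hρ θ hθ =>
      .outIn h ho hρ ((M.validLEq_of_hasLTy hw).lEqAt hΓ hρ hθ)⟩
  | irrel hP hp hp' =>
    obtain ⟨X, env, hΓ, h⟩ := M.validProp_of_isProp hP
    refine ⟨X, env, hΓ, fun ρ hρ θ hθ => ?_⟩
    obtain ⟨Q, hQ⟩ := h.interpP_eq_some ρ hρ
    exact .irrel hQ ((M.validLEq_of_hasLTy hp).lEqAt hΓ hρ hθ)
      ((M.validLEq_of_hasLTy hp').lEqAt hΓ hρ hθ)
  | ty _ hB =>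
    obtain ⟨X, env, hΓ, h⟩ := M.validLTyEq_of_lTyEq hB
    exact ⟨X, env, hΓ, fun ρ hρ θ hθ => (h ρ hρ).lEqAt⟩
  | prp _ hP =>
    have h := M.validPropEq_of_propEq hP
    obtain ⟨X, env, hΓ, -⟩ := h.left
    refine ⟨X, env, hΓ, fun ρ hρ θ hθ => ?_⟩
    obtain ⟨Q, hQ, hQ'⟩ := h.interpP_eq_some hΓ hρ
    exact lEqAt_prp hQ hQ'
  | restrict h₁ h₂ hε _ ih =>
    obtain ⟨X, env, hΓ, h⟩ := ih
    exact ⟨X, env, hΓ, fun ρ hρ θ hθ => .restrict ((M.validEq_of_defEq h₁).eqAt hΓ)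
      ((M.validEq_of_defEq h₂).eqAt hΓ) ((M.validEq_of_defEq hε).eqAt hΓ) (h ρ hρ θ hθ)⟩
  | mp hP hQ _ _ ihf ihp =>
    obtain ⟨X, env, hΓ, h⟩ := ihf
    refine ⟨X, env, hΓ, fun ρ hρ θ hθ => ?_⟩
    obtain ⟨R, hR, hR'⟩ := (M.validPropEq_of_propEq hP).interpP_eq_some hΓ hρ
    obtain ⟨S, hS, hS'⟩ := (M.validPropEq_of_propEq hQ).interpP_eq_some hΓ hρ
    exact .mp hR hR' hS hS' (h ρ hρ θ hθ) (ihp.lEqAt hΓ hρ hθ)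

end Model

end

end NMDEKL

theorem mainTheorem3 {C : Type u} [Category.{v} C] [HasFiniteLimits C] [HasLimitsOfShape ℕᵒᵖ C]
    {Tf : Type z} [SmallCategory Tf] (M : Model.{u, v, w, z} C Tf) :
    -- contexts are interpreted by objects of `C`
    (∀ Γ : List Term, WfCtx Γ → ∃ S, M.interpCtx Γ = some S) ∧
    -- computational types
    (∀ (Γ : List Term) (A : Term) (i : ℕ), HasTy Γ A (.univ i) →
      ∃ S, M.interpCtx Γ = some S ∧ ∃ A' : M.Ty S.1, M.interpTy A S.1 S.2 = some A') ∧
    -- computational terms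
    (∀ (Γ : List Term) (t A : Term), HasTy Γ t A →
      ∃ S, M.interpCtx Γ = some S ∧ ∃ A' : M.Ty S.1, M.interpTy A S.1 S.2 = some A' ∧
        ∃ t' : M.TmC A', M.interp t S.1 S.2 = some t'.1) ∧
    -- constructive types
    (∀ (Γ : List Term) (n : ℕ) (B : LTy) (i : ℕ), IsLTy Γ n B i →
      ∃ S, M.interpCtx Γ = some S ∧ ∀ ρ : List (PropL S.1), ρ.length = n →
        ∃ B' : TyL Tf S.1, M.interpLTy B S.1 S.2 ρ = some B') ∧
    -- constructive terms
    (∀ (Γ : List Term) (n : ℕ) (Θ : List LTy) (t : LTm) (B : LTy), HasLTy Γ n Θ t B →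
      ∃ S, M.interpCtx Γ = some S ∧ ∀ ρ : List (PropL S.1), ρ.length = n →
        ∀ θ, M.Interprets Θ S.1 S.2 ρ θ →
          ∃ B' : TyL Tf S.1, M.interpLTy B S.1 S.2 ρ = some B' ∧
            ∃ t' : TmL B', M.interpL t S.1 S.2 ρ θ = some ⟨B', t'⟩) ∧
    -- propositions
    (∀ (Γ : List Term) (n : ℕ) (P : Prp), IsProp Γ n P →
      ∃ S, M.interpCtx Γ = some S ∧ ∀ ρ : List (PropL S.1), ρ.length = n →
        ∃ P' : PropL S.1, M.interpP P S.1 S.2 ρ = some P') ∧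
    -- definitional equality of computational terms
    (∀ (Γ : List Term) (t₁ t₂ A : Term), DefEq Γ t₁ t₂ A →
      ∃ S, M.interpCtx Γ = some S ∧ ∃ A' : M.Ty S.1, M.interpTy A S.1 S.2 = some A' ∧
        ∃ t' : M.TmC A', M.interp t₁ S.1 S.2 = some t'.1 ∧ M.interp t₂ S.1 S.2 = some t'.1) ∧
    -- definitional equality of constructive types
    (∀ (Γ : List Term) (n : ℕ) (B₁ B₂ : LTy) (i : ℕ), LTyEq Γ n B₁ B₂ i →
      ∃ S, M.interpCtx Γ = some S ∧ ∀ ρ : List (PropL S.1), ρ.length = n →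
        ∃ B' : TyL Tf S.1, M.interpLTy B₁ S.1 S.2 ρ = some B' ∧
          M.interpLTy B₂ S.1 S.2 ρ = some B') ∧
    -- definitional equality of constructive terms
    (∀ (Γ : List Term) (n : ℕ) (Θ : List LTy) (t₁ t₂ : LTm) (B : LTy), LDefEq Γ n Θ t₁ t₂ B →
      ∃ S, M.interpCtx Γ = some S ∧ ∀ ρ : List (PropL S.1), ρ.length = n →
        ∀ θ, M.Interprets Θ S.1 S.2 ρ θ →
          ∃ B' : TyL Tf S.1, M.interpLTy B S.1 S.2 ρ = some B' ∧
            ∃ t' : TmL B', M.interpL t₁ S.1 S.2 ρ θ = some ⟨B', t'⟩ ∧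
              M.interpL t₂ S.1 S.2 ρ θ = some ⟨B', t'⟩) ∧
    -- definitional equality of propositions
    (∀ (Γ : List Term) (n : ℕ) (P₁ P₂ : Prp), PropEq Γ n P₁ P₂ →
      ∃ S, M.interpCtx Γ = some S ∧ ∀ ρ : List (PropL S.1), ρ.length = n →
        ∃ P' : PropL S.1, M.interpP P₁ S.1 S.2 ρ = some P' ∧
          M.interpP P₂ S.1 S.2 ρ = some P') := by
  refine ⟨?_, ?_, ?_, ?_, ?_, ?_, ?_, ?_, ?_, ?_⟩
  · intro Γ h
    obtain ⟨X, env, hΓ⟩ := M.interpCtx_of_wfCtx h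
    exact ⟨_, hΓ⟩
  · intro Γ A i h
    obtain ⟨X, env, hΓ, h⟩ := M.validEq_of_hasTy h
    obtain ⟨T, hT, -⟩ := h.interpTy_eq
    exact ⟨_, hΓ, T, hT⟩
  · intro Γ t A h
    obtain ⟨X, env, hΓ, T, hT, v, hv, h, -⟩ := M.validEq_of_hasTy h
    exact ⟨_, hΓ, T, hT, ⟨v, hv⟩, h⟩
  · intro Γ n B i h
    obtain ⟨X, env, hΓ, h⟩ := M.validLTyEq_of_isLTy h
    refine ⟨_, hΓ, fun ρ hρ => ?_⟩
    obtain ⟨⟨T, hT, -⟩, -⟩ := h ρ hρ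
    exact ⟨T, hT⟩
  · intro Γ n Θ t B h
    obtain ⟨X, env, hΓ, h⟩ := M.validLEq_of_hasLTy h
    refine ⟨_, hΓ, fun ρ hρ θ hθ => ?_⟩
    obtain ⟨T, hT, v, hv, -⟩ := h ρ hρ θ hθ
    exact ⟨T, hT, v, hv⟩
  · intro Γ n P h
    obtain ⟨X, env, hΓ, h⟩ := M.validProp_of_isProp h
    exact ⟨_, hΓ, fun ρ hρ => h.interpP_eq_some ρ hρ⟩
  · intro Γ t₁ t₂ A h
    obtain ⟨X, env, hΓ, T, hT, v, hv, h⟩ := M.validEq_of_defEq h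
    exact ⟨_, hΓ, T, hT, ⟨v, hv⟩, h⟩
  · intro Γ n B₁ B₂ i h
    obtain ⟨X, env, hΓ, h⟩ := M.validLTyEq_of_lTyEq h
    exact ⟨_, hΓ, fun ρ hρ => (h ρ hρ).1⟩
  · intro Γ n Θ t₁ t₂ B h
    obtain ⟨X, env, hΓ, h⟩ := M.validLEq_of_lDefEq h
    exact ⟨_, hΓ, h⟩
  · intro Γ n P₁ P₂ h
    have h := M.validPropEq_of_propEq h
    obtain ⟨X, env, hΓ, -⟩ := h.left
    exact ⟨_, hΓ, fun ρ hρ => h.interpP_eq_some hΓ hρ⟩
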